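/- Let $\beta>0$. Let $\mathcal G$ be the set of right-continuous nondecreasing functions $g:[0,1)\to[0,1]$ with the Borel $\sigma$-algebra of the $L^2([0,1])$-distance (generated by the evaluations $g\mapsto g(t)$), and let $\mathbb Q^\beta$ be the law on $\mathcal G$ of the Dirichlet process with parameter $\beta$: for $0=t_0<t_1<\dots<t_k<t_{k+1}=1$, $(g(t_1),\dots,g(t_k))$ has under $\mathbb Q^\beta$ the density $$\frac{\Gamma(\beta)}{\prod_{i=0}^{k}\Gamma(\beta(t_{i+1}-t_i))}\prod_{i=0}^{k}(x^{i+1}-x^{i})^{\beta(t_{i+1}-t_i)-1}$$ on $\{0=x^0\le x^1\le\dots\le x^k\le x^{k+1}=1\}$. Put $H=L^2(\mathcal G,\mathbb Q^\beta)$. For $N\ge 1$ let $\Sigma_N=\{x\in\mathbb R^{N-1}:0\le x^1\le\dots\le x^{N-1}\le 1\}$, with $x^0=0$, $x^N=1$, $$q_N(dx)=\frac{\Gamma(\beta)}{\Gamma(\beta/N)^N}\prod_{i=1}^N (x^i-x^{i-1})^{\frac\beta N-1}\,dx^1\cdots dx^{N-1}\quad\text{on }\Sigma_N,$$ and $H^N=L^2(\Sigma_N,q_N)$.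 *Forms.* $\mathcal E^N$ is the closure in $H^N$ of $\mathcal E^N(f,f)=\int_{\Sigma_N}|\nabla f|^2\,dq_N$, $f\in C^\infty(\Sigma_N)$. $\mathcal E$ is the closure in $H$ of $\mathcal E(u,u)=\int_{\mathcal G}\|\nabla u_{|g}\|^2_{L^2([0,1])}\,\mathbb Q^\beta(dg)$ on the functions $u(g)=U(\langle f_1,g\rangle_{L^2},\dots,\langle f_m,g\rangle_{L^2})$ with $m\in\mathbb N$, $U\in C^1_c(\mathbb R^m)$, $f_i\in L^2([0,1])$, where $\nabla u_{|g}=\sum_i\partial_iU(\langle f_1,g\rangle_{L^2},\dots,\langle f_m,g\rangle_{L^2})\,f_i$. Write $\mathcal D(\cdot)$ for the domains, and set $\mathcal E(u,u)=+\infty$ for $u\in H\setminus\mathcal D(\mathcal E)$. *Markov uniqueness.* Let $\mathcal Z_0$ be the set of functions $u(g)=U\big(\int_0^1\varphi_1(g(t))dt,\dots,\int_0^1\varphi_m(g(t))dt\big)$ with $m\in\mathbb N$, $U\in C_c^\infty(\mathbb R^m)$, $\varphi_i\in C_c^\infty(\mathbb R)$, $\varphi_i'(0)=\varphi_i'(1)=0$.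 $\mathcal E$ is called Markov-unique if it is maximal (with respect to extension) among the (not necessarily regular) symmetric Dirichlet forms on $H$ that extend $\mathcal E$ and whose generator extends the restriction to $\mathcal Z_0$ of the generator of $\mathcal E$; that is, every such Dirichlet form $\mathcal A$ satisfies $\mathcal D(\mathcal A)=\mathcal D(\mathcal E)$. (In particular, $\mathcal E$ is Markov-unique if it has no proper extension at all among the Dirichlet forms on $H$.) *Convergence.* Let $\Phi^N:H\to H^N$, $(\Phi^Nu)(x)=\mathbb E_{\mathbb Q^\beta}(u\mid g(i/N)=x^i,\ i=1,\dots,N-1)$. A sequence $v_N\in H^N$ converges strongly to $v\in H$ if there are $\tilde v_N\in H$ with $\tilde v_N\to v$ in $H$ and $\lim_N\limsup_M\|\Phi^M\tilde v_N-v_M\|_{H^M}=0$. A sequence $u_N\in H^N$ converges weakly to $u\in H$ if $\langle u_N,v_N\rangle_{H^N}\to\langle u,v\rangle_H$ whenever $v_N\in H^N$ converges strongly to $v\in H$. **Proposition (Mosco I).** Assume that $\mathcal E$ is Markov-unique, and let $u_N\in\mathcal D(\mathcal E^N)$, $N\ge 1$, converge weakly to $u\in H$. Then $$\mathcal E(u,u)\le\liminf_{N\to\infty}N\cdot\mathcal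 E^N(u_N,u_N).$$ In particular $u\in\mathcal D(\mathcal E)$ if the right-hand side is finite. -/

import Mathlib

open MeasureTheory ProbabilityTheory Filter Topology
open scoped ENNReal ContDiff

noncomputable section

namespace WassersteinDiffusion

/-! ### Closure of a gradient form -/

section GradientForm

variable {H T : Type*} [NormedAddCommGroup H] [NormedAddCommGroup T]

/-- Let `D ⊆ H × T` be the graph `{(u, ∇u)}` of a gradient operator given on a class of core
functions, so that the form on the core is `⟨∇u, ∇v⟩_T`. Its closure has as domain all `u ∈ H` which
are limits of core functions `uₙ` with `∇uₙ` Cauchy, i.e. all `u` with `(u, ξ) ∈ closure D`. -/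
def InDomain (D : Set (H × T)) (u : H) : Prop := ∃ ξ : T, (u, ξ) ∈ closure D

/-- The quadratic form `E(u,u) = ‖∇u‖²` of the closure, with value `∞` off the domain. (For a
closable form the infimum runs over at most one `ξ`, namely `ξ = ∇u`.) -/
def closedEnergy (D : Set (H × T)) (u : H) : ℝ≥0∞ :=
  ⨅ (ξ : T) (_ : (u, ξ) ∈ closure D), ‖ξ‖ₑ ^ 2

/-- `u` lies in the domain of the generator `L` of the closure of the form, and `-L u = f`. -/
def IsNegGenerator [InnerProductSpace ℝ H] [InnerProductSpace ℝ T]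
    (D : Set (H × T)) (u f : H) : Prop :=
  ∃ ξ : T, (u, ξ) ∈ closure D ∧
    ∀ (w : H) (η : T), (w, η) ∈ closure D → inner ℝ ξ η = inner ℝ f w

end GradientForm

/-! ### Dirichlet forms -/

/-- A symmetric Dirichlet form on `L²(μ)`: a densely defined, nonnegative, closed symmetric bilinear
form on which the unit contraction operates. Regularity is not required. -/
structure DirichletForm {X : Type*} [MeasurableSpace X] (μ : Measure X) where
  dom : Submodule ℝ (Lp ℝ 2 μ)
  form : dom →ₗ[ℝ] dom →ₗ[ℝ] ℝ
  symm : ∀ u v, form u v = form v u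
  nonneg : ∀ u, 0 ≤ form u u
  dense : Dense (dom : Set (Lp ℝ 2 μ))
  closed : ∀ (s : ℕ → dom) (u : Lp ℝ 2 μ),
    Tendsto (fun n => (s n : Lp ℝ 2 μ)) atTop (𝓝 u) →
    (∀ ε > 0, ∃ n₀, ∀ m ≥ n₀, ∀ n ≥ n₀, form (s m - s n) (s m - s n) < ε) →
    ∃ hu : u ∈ dom, Tendsto (fun n => form (s n - ⟨u, hu⟩) (s n - ⟨u, hu⟩)) atTop (𝓝 0)
  markov : ∀ u : dom, ∃ v : dom,
    (v : Lp ℝ 2 μ) =ᵐ[μ] (fun x => min (max ((u : Lp ℝ 2 μ) x) 0) 1) ∧ form v v ≤ form u u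

/-! ### Ordered Dirichlet distributions -/

/-- The vector `(0, x₁, …, x_k, 1)`. -/
def pad {k : ℕ} (x : Fin k → ℝ) : Fin (k + 2) → ℝ :=
  Fin.cons (α := fun _ => ℝ) 0 (Fin.snoc (α := fun _ => ℝ) x 1)

/-- The increments `x_{i+1} - x_i`, `i = 0, …, k`, where `x₀ = 0` and `x_{k+1} = 1`. -/
def gap {k : ℕ} (x : Fin k → ℝ) (i : Fin (k + 1)) : ℝ := pad x i.succ - pad x i.castSucc

/-- The simplex `{0 ≤ x₁ ≤ ⋯ ≤ x_k ≤ 1}`. -/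
def simplex (k : ℕ) : Set (Fin k → ℝ) := {x | Monotone (pad x)}

/-- The law on the simplex of the partial sums of a Dirichlet vector with parameters
`α₀, …, α_k`; its density is `Γ(∑ αᵢ) / ∏ Γ(αᵢ) * ∏ (x_{i+1} - x_i)^{αᵢ - 1}`. -/
def orderedDirichlet {k : ℕ} (α : Fin (k + 1) → ℝ) : Measure (Fin k → ℝ) :=
  (volume.restrict (simplex k)).withDensity fun x =>
    ENNReal.ofReal
      (Real.Gamma (∑ i, α i) / (∏ i, Real.Gamma (α i)) * ∏ i, gap x i ^ (α i - 1))

/-! ### The finite dimensional forms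

Here and below `n` is the number `N - 1` of particles, so that `N = n + 1`. -/

/-- The measure `q_N` for `N = n + 1`. -/
def q (β : ℝ) (n : ℕ) : Measure (Fin n → ℝ) :=
  orderedDirichlet fun _ : Fin (n + 1) => β / (n + 1)

/-- The graph of the Euclidean gradient on smooth functions on the simplex, in `L²(q_N)`. -/
def particleGraph (β : ℝ) (n : ℕ) :
    Set (Lp ℝ 2 (q β n) × Lp (EuclideanSpace ℝ (Fin n)) 2 (q β n)) :=
  {p | ∃ f : (Fin n → ℝ) → ℝ, ContDiff ℝ ∞ f ∧ p.1 =ᵐ[q β n] f ∧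
    p.2 =ᵐ[q β n] fun x => WithLp.toLp 2 fun i => fderiv ℝ f x (Pi.single i 1)}

/-- The quadratic form `𝓔^N(u,u)`, `N = n + 1`, with value `∞` off `𝓓(𝓔^N)`. -/
def particleEnergy (β : ℝ) (n : ℕ) (u : Lp ℝ 2 (q β n)) : ℝ≥0∞ :=
  closedEnergy (particleGraph β n) u

/-! ### The space of quantile functions and the Dirichlet process -/

/-- The interval `[0,1)`. -/
abbrev I : Type := Set.Ico (0 : ℝ) 1

/-- Lebesgue measure on `[0,1)`; thus `L²([0,1]) = L²(leb)`. -/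
def leb : Measure I := Measure.comap Subtype.val volume

instance : IsProbabilityMeasure leb := by
  constructor
  rw [leb, comap_subtype_coe_apply measurableSet_Ico, Set.image_univ, Subtype.range_coe]
  simp

/-- Right continuous nondecreasing functions `[0,1) → [0,1]` (left limits exist by monotonicity).
The σ-algebra is the one generated by the evaluations `g ↦ g t`, which is the Borel σ-algebra of the
`L²([0,1])` distance. -/
abbrev G : Type :=
  {g : I → ℝ // Monotone g ∧ (∀ t, g t ∈ Set.Icc (0 : ℝ) 1) ∧
    ∀ t, ContinuousWithinAt g (Set.Ici t) t}

/-- `Q` is the law `ℚ^β` of the Dirichlet process with parameter `β`: for `0 < t₁ < ⋯ < t_k < 1` the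
vector `(g(t₁), …, g(t_k))` has the ordered Dirichlet distribution with parameters
`β (t_{i+1} - t_i)`, `i = 0, …, k`. -/
def IsDirichletProcessLaw (β : ℝ) (Q : Measure G) : Prop :=
  ∀ (k : ℕ) (t : Fin k → I), StrictMono t → (∀ i, 0 < (t i : ℝ)) →
    Q.map (fun g i => g.1 (t i)) = orderedDirichlet fun i => β * gap (fun j => (t j : ℝ)) i

/-- The functional `l_f(g) = ⟨f, g⟩_{L²}`. -/
def pairing (f : Lp ℝ 2 leb) (g : G) : ℝ := ∫ t, f t * g.1 t ∂leb

/-- The graph of the `L²`-gradient `∇u(g)(t) = ∑ ∂ᵢU(l_{f₁}(g), …, l_{f_m}(g)) fᵢ(t)` on the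
functions `u(g) = U(l_{f₁}(g), …, l_{f_m}(g))`, `U ∈ C¹_c(ℝᵐ)`, `fᵢ ∈ L²([0,1])`. -/
def wassersteinGraph (Q : Measure G) :
    Set (Lp ℝ 2 Q × Lp ℝ 2 (Q.prod leb)) :=
  {p | ∃ (m : ℕ) (f : Fin m → Lp ℝ 2 leb) (U : (Fin m → ℝ) → ℝ),
    ContDiff ℝ 1 U ∧ HasCompactSupport U ∧
    p.1 =ᵐ[Q] (fun g => U fun i => pairing (f i) g) ∧
    p.2 =ᵐ[Q.prod leb] fun z =>
      ∑ i, fderiv ℝ U (fun j => pairing (f j) z.1) (Pi.single i 1) * f i z.2}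

/-- The quadratic form `𝓔(u,u)` of the Wasserstein Dirichlet form on `L²(𝒢, Q)`, with value `∞` off
`𝓓(𝓔)`. -/
def wassersteinEnergy (Q : Measure G) (u : Lp ℝ 2 Q) : ℝ≥0∞ :=
  closedEnergy (wassersteinGraph Q) u

/-- Smooth cylinder functions `u(g) = U(⟨φ₁, μ⟩, …, ⟨φ_m, μ⟩)` of the measure `μ = g_*(dx)`, so that
`⟨φᵢ, μ⟩ = ∫ φᵢ(g(t)) dt`, with `φᵢ` satisfying Neumann conditions at `0` and `1`. -/
def IsNeumannCylinder (Q : Measure G) (u : Lp ℝ 2 Q) : Prop :=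
  ∃ (m : ℕ) (φ : Fin m → ℝ → ℝ) (U : (Fin m → ℝ) → ℝ),
    (∀ i, ContDiff ℝ ∞ (φ i) ∧ HasCompactSupport (φ i) ∧
      deriv (φ i) 0 = 0 ∧ deriv (φ i) 1 = 0) ∧
    ContDiff ℝ ∞ U ∧ HasCompactSupport U ∧
    u =ᵐ[Q] fun g => U fun i => ∫ t, φ i (g.1 t) ∂leb

/-- The Dirichlet form `A` extends `𝓔`. -/
def Extends (Q : Measure G) (A : DirichletForm Q) : Prop :=
  ∀ u : Lp ℝ 2 Q, InDomain (wassersteinGraph Q) u →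
    ∃ hu : u ∈ A.dom, ENNReal.ofReal (A.form ⟨u, hu⟩ ⟨u, hu⟩) = wassersteinEnergy Q u

/-- The generator of `A` agrees with the generator of `𝓔` on smooth Neumann cylinder functions. -/
def GeneratorExtends (Q : Measure G) (A : DirichletForm Q) : Prop :=
  ∀ u f : Lp ℝ 2 Q, IsNeumannCylinder Q u → IsNegGenerator (wassersteinGraph Q) u f →
    ∃ hu : u ∈ A.dom, ∀ v : A.dom, A.form ⟨u, hu⟩ v = inner ℝ f (v : Lp ℝ 2 Q)

/-- Markov uniqueness: `𝓔` is maximal in the class of Dirichlet forms on `L²(𝒢, Q)` that extend `𝓔`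
and whose generator extends the generator of `𝓔` on smooth Neumann cylinder functions.
(This is implied by maximality of `𝓔` with respect to arbitrary Dirichlet form extensions.) -/
def MarkovUnique (Q : Measure G) : Prop :=
  ∀ A : DirichletForm Q, Extends Q A → GeneratorExtends Q A →
    ∀ u ∈ A.dom, InDomain (wassersteinGraph Q) u

/-! ### Convergence of vectors along `H^N → H` -/

/-- The grid point `(i+1)/(n+1)` of `[0,1)`, `i = 0, …, n-1`. -/
def gridPoint (n : ℕ) (i : Fin n) : I :=
  ⟨((i : ℝ) + 1) / ((n : ℝ) + 1), by positivity, by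
    have : (i : ℝ) < n := by exact_mod_cast i.2
    rw [div_lt_one (by positivity)]; linarith⟩

/-- The map `g ↦ (g(1/N), …, g((N-1)/N))`, `N = n + 1`. -/
def sample (n : ℕ) (g : G) : Fin n → ℝ := fun i => g.1 (gridPoint n i)

/-- The conditional expectation `(Φ^N u)(x) = 𝔼(u | g(i/N) = xᵢ, i = 1, …, N-1)`, `N = n + 1`. -/
def Phi (Q : Measure G) [IsFiniteMeasure Q] (n : ℕ) (u : Lp ℝ 2 Q) (x : Fin n → ℝ) : ℝ :=
  ∫ y, y ∂(condDistrib (fun g => u g) (sample n) Q x)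

/-- Strong convergence of `v_N ∈ H^N = L²(q_N)` to `v ∈ H = L²(𝒢, Q)`. -/
def StrongConv (β : ℝ) (Q : Measure G) [IsFiniteMeasure Q]
    (v : ∀ n, Lp ℝ 2 (q β n)) (v' : Lp ℝ 2 Q) : Prop :=
  ∃ w : ℕ → Lp ℝ 2 Q, Tendsto w atTop (𝓝 v') ∧
    Tendsto (fun n => limsup (fun m => eLpNorm (fun x => Phi Q m (w n) x - v m x) 2 (q β m)) atTop)
      atTop (𝓝 0)

/-- Weak convergence of `u_N ∈ H^N = L²(q_N)` to `u ∈ H = L²(𝒢, Q)`. -/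
def WeakConv (β : ℝ) (Q : Measure G) [IsFiniteMeasure Q]
    (u : ∀ n, Lp ℝ 2 (q β n)) (u' : Lp ℝ 2 Q) : Prop :=
  ∀ (v : ∀ n, Lp ℝ 2 (q β n)) (v' : Lp ℝ 2 Q), StrongConv β Q v v' →
    Tendsto (fun n => (inner ℝ (u n) (v n) : ℝ)) atTop (𝓝 (inner ℝ u' v'))

end WassersteinDiffusion

end

/-! By Markov uniqueness it is enough to find `u'` in the domain of some larger Dirichlet form of
the admissible class, with the right bound on its gradient. The larger form is built from
derivatives along the perturbations `g ↦ g + sin r • φ ∘ g`, where `φ` is C² and vanishes at 0 and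
1; the factor `sin r` keeps the amplitude in `[-1,1]` for every real `r`, so all bounds are uniform
in `r`. The law `Q` is quasi-invariant under these maps, because the change of density of an ordered
Dirichlet law is controlled independently of the number of evaluation points
(`IsVelocity.exists_density_shiftPi`, `IsVelocity.exists_move_bound`). Hence composition with a
perturbation is bounded on `L²(Q)`, and `gradGraph Q` collects the pairs `(u, ξ)` for which the
increments of `u` along every perturbation are the time integrals of `ξ` paired with the velocity `φ
∘ g`. This condition involves bounded linear operators only, so it survives weak limits.

The form `‖ξ‖²` on `gradGraph Q` lies in the class of `MarkovUnique`. The gradient is unique, since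
almost every `g` is strictly increasing and the functions `φ ∘ g` then separate integrable functions
on `[0,1)` (`gradGraph_unique`). The unit contraction operates by a chain rule
(`mem_gradGraph_primitive`). The generator is the right one on Neumann cylinder functions because
the Neumann condition turns `φᵢ'` into an admissible velocity, along which integration by parts is
possible (`Flow.exists_abs_inner_D_le`, `generatorExtends_maximalForm`).

For the limit, `L²(q_N)` is embedded isometrically in `L²(Q)` by sampling, with adjoint `Φ^N`. A
Euclidean gradient becomes a step function in `t`, and its squared norm is multiplied by `N`
(`norm_lift_sq`), which is the factor in the inequality. The lifted pairs satisfy exactly the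
identity of `gradGraph`, except that the velocity is read off at the next grid point; right
continuity makes this difference disappear. A weak limit of the lifted gradients is therefore a
gradient of `u'` (`Flow.eq_of_weak_limit`, `WeakConv.exists_mem_gradGraph`), and the norm is weakly
lower semicontinuous. -/

noncomputable section

namespace WassersteinDiffusion

/-! ### Hilbert space and measure theoretic preliminaries -/

section Preliminaries

/-- Along an ultrafilter bounded real families converge, so the inner products have limits; these
depend linearly and boundedly on `y`, and Riesz representation gives `x₀`. Neither separability nor
a subsequence is needed. -/
theorem exists_weak_limit {ι E : Type*} [NormedAddCommGroup E] [InnerProductSpace ℝ E]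
    [CompleteSpace E] (l : Ultrafilter ι) (x : ι → E) (C : ℝ)
    (h : ∀ᶠ i in (l : Filter ι), ‖x i‖ ≤ C) :
    ∃ x₀ : E, ‖x₀‖ ≤ C ∧ ∀ y, Tendsto (fun i => (inner ℝ (x i) y : ℝ)) l (𝓝 (inner ℝ x₀ y)) := by
  have hlim : ∀ y : E, ∃ a : ℝ, |a| ≤ C * ‖y‖ ∧
      Tendsto (fun i => (inner ℝ (x i) y : ℝ)) l (𝓝 a) := by
    intro y
    have hmem : ∀ᶠ i in (l : Filter ι), (inner ℝ (x i) y : ℝ) ∈ Set.Icc (-(C * ‖y‖)) (C * ‖y‖) := by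
      filter_upwards [h] with i hi
      refine abs_le.1 ?_
      exact (abs_real_inner_le_norm _ _).trans (mul_le_mul_of_nonneg_right hi (norm_nonneg _))
    obtain ⟨a, ha, hle⟩ := (isCompact_Icc (a := -(C * ‖y‖)) (b := C * ‖y‖)).ultrafilter_le_nhds
      (l.map fun i => (inner ℝ (x i) y : ℝ)) (le_principal_iff.2 hmem)
    exact ⟨a, abs_le.2 ha, hle⟩
  choose L hLb hL using hlim
  have hC : 0 ≤ C := by
    obtain ⟨i, hi⟩ := h.exists
    exact (norm_nonneg _).trans hi
  let Λ : E →ₗ[ℝ] ℝ :=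
    { toFun := L
      map_add' := fun y z => tendsto_nhds_unique (hL (y + z))
        (by simpa only [inner_add_right] using (hL y).add (hL z))
      map_smul' := fun c y => tendsto_nhds_unique (hL (c • y))
        (by simpa only [real_inner_smul_right, RingHom.id_apply, smul_eq_mul] using (hL y).const_mul c) }
  let Λ' : E →L[ℝ] ℝ := Λ.mkContinuous C hLb
  refine ⟨(InnerProductSpace.toDual ℝ E).symm Λ', ?_, fun y => ?_⟩
  · rw [LinearIsometryEquiv.norm_map]
    exact Λ.mkContinuous_norm_le hC hLb
  · rw [InnerProductSpace.toDual_symm_apply]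
    exact hL y

variable {X : Type*} {m0 : MeasurableSpace X} {μ : Measure X}

/-- A π-λ argument. The total integral is assumed separately since the step to complements needs it
and the π-system need not contain the whole space. -/
theorem ae_eq_zero_of_generateFrom [IsFiniteMeasure μ] {F : X → ℝ} (hF : Integrable F μ)
    (S : Set (Set X)) (hgen : m0 = MeasurableSpace.generateFrom S) (hpi : IsPiSystem S)
    (huniv : ∫ x, F x ∂μ = 0) (hS : ∀ A ∈ S, ∫ x in A, F x ∂μ = 0) : F =ᵐ[μ] 0 := by
  refine hF.ae_eq_zero_of_forall_setIntegral_eq_zero fun A hA _ => ?_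
  induction A, hA using MeasurableSpace.induction_on_inter hgen hpi with
  | empty => simp
  | basic t ht => exact hS t ht
  | compl t htm ih =>
    have := integral_add_compl htm hF
    have := ih (measure_lt_top _ _)
    linarith
  | iUnion f hd hm ih =>
    rw [integral_iUnion hm hd hF.integrableOn]
    simp [fun i => ih i (measure_lt_top _ _)]

theorem quasiMeasurePreserving_of_map_le {τ : X → X} (hτ : Measurable τ) {C : NNReal}
    (h : μ.map τ ≤ C • μ) : Measure.QuasiMeasurePreserving τ μ μ :=
  ⟨hτ, (Measure.absolutelyContinuous_of_le h).trans Measure.smul_absolutelyContinuous⟩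

theorem memLp_comp_of_map_le {τ : X → X} (hτ : Measurable τ) {C : NNReal} (h : μ.map τ ≤ C • μ)
    (u : Lp ℝ 2 μ) : MemLp (fun x => u (τ x)) 2 μ :=
  MemLp.comp_of_map (f := τ) (g := u)
    (((Lp.memLp u).smul_measure (c := C) ENNReal.coe_ne_top).mono_measure h) hτ.aemeasurable

theorem norm_toLp_comp_le {τ : X → X} (hτ : Measurable τ) {C : NNReal} (h : μ.map τ ≤ C • μ)
    (u : Lp ℝ 2 μ) : ‖(memLp_comp_of_map_le hτ h u).toLp‖ ≤ Real.sqrt C * ‖u‖ := by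
  have h1 : eLpNorm (fun x => u (τ x)) 2 μ ≤ ENNReal.ofReal (Real.sqrt C) * eLpNorm u 2 μ := by
    calc eLpNorm (fun x => u (τ x)) 2 μ = eLpNorm u 2 (μ.map τ) :=
          (eLpNorm_map_measure ((Lp.aestronglyMeasurable u).mono_ac
            (quasiMeasurePreserving_of_map_le hτ h).absolutelyContinuous) hτ.aemeasurable).symm
      _ ≤ eLpNorm u 2 (C • μ) := eLpNorm_mono_measure _ h
      _ = _ := by
        rw [show C • μ = (C : ℝ≥0∞) • μ from rfl,
          eLpNorm_smul_measure_of_ne_top ENNReal.ofNat_ne_top, smul_eq_mul, Real.sqrt_eq_rpow,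
          ← ENNReal.ofReal_rpow_of_nonneg C.coe_nonneg (by norm_num), ENNReal.ofReal_coe_nnreal]
        simp
  rw [Lp.norm_toLp, Lp.norm_def, ← ENNReal.toReal_ofReal (Real.sqrt_nonneg C),
    ← ENNReal.toReal_mul]
  exact ENNReal.toReal_mono (ENNReal.mul_ne_top ENNReal.ofReal_ne_top (Lp.eLpNorm_ne_top u)) h1

/-- Composition with a map that increases the measure at most by a factor. -/
def compL (τ : X → X) (hτ : Measurable τ) (C : NNReal) (h : μ.map τ ≤ C • μ) :
    Lp ℝ 2 μ →L[ℝ] Lp ℝ 2 μ :=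
  LinearMap.mkContinuous
    { toFun := fun u => (memLp_comp_of_map_le hτ h u).toLp
      map_add' := fun u v => by
        rw [← MemLp.toLp_add, MemLp.toLp_eq_toLp_iff]
        exact (quasiMeasurePreserving_of_map_le hτ h).ae (Lp.coeFn_add u v)
      map_smul' := fun c u => by
        rw [RingHom.id_apply, ← MemLp.toLp_const_smul, MemLp.toLp_eq_toLp_iff]
        exact (quasiMeasurePreserving_of_map_le hτ h).ae (Lp.coeFn_smul c u) }
    (Real.sqrt C) (norm_toLp_comp_le hτ h)

theorem compL_coeFn (τ : X → X) (hτ : Measurable τ) (C : NNReal) (h : μ.map τ ≤ C • μ)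
    (u : Lp ℝ 2 μ) : compL τ hτ C h u =ᵐ[μ] fun x => u (τ x) :=
  MemLp.coeFn_toLp (memLp_comp_of_map_le hτ h u)

theorem norm_compL_le (τ : X → X) (hτ : Measurable τ) (C : NNReal) (h : μ.map τ ≤ C • μ)
    (u : Lp ℝ 2 μ) : ‖compL τ hτ C h u‖ ≤ Real.sqrt C * ‖u‖ :=
  norm_toLp_comp_le hτ h u

theorem compL_toLp (τ : X → X) (hτ : Measurable τ) (C : NNReal) (h : μ.map τ ≤ C • μ)
    {u v : X → ℝ} (hu : MemLp u 2 μ) (hv : MemLp v 2 μ) (huv : ∀ x, v x = u (τ x)) :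
    compL τ hτ C h hu.toLp = hv.toLp := by
  have hac : Measure.QuasiMeasurePreserving τ μ μ :=
    ⟨hτ, (Measure.absolutelyContinuous_of_le h).trans (Measure.smul_absolutelyContinuous)⟩
  refine Lp.ext ?_
  filter_upwards [compL_coeFn τ hτ C h hu.toLp, hv.coeFn_toLp, hac.ae hu.coeFn_toLp] with x h1 h2 h3
  rw [h1, h2, h3, huv]

theorem memLp_bounded_mul {m : X → ℝ} (hm : Measurable m) {B : ℝ} (hB : ∀ x, |m x| ≤ B)
    (u : Lp ℝ 2 μ) : MemLp (fun x => m x * u x) 2 μ :=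
  (Lp.memLp u).of_le_mul (c := B) (hm.aestronglyMeasurable.mul (Lp.aestronglyMeasurable u))
    (Eventually.of_forall fun x => by
      rw [norm_mul]; exact mul_le_mul_of_nonneg_right (hB x) (norm_nonneg _))

theorem norm_toLp_bounded_mul_le {m : X → ℝ} (hm : Measurable m) {B : ℝ} (hB : ∀ x, |m x| ≤ B)
    (u : Lp ℝ 2 μ) : ‖(memLp_bounded_mul hm hB u).toLp‖ ≤ B * ‖u‖ := by
  refine Lp.norm_le_mul_norm_of_ae_le_mul ?_
  filter_upwards [(memLp_bounded_mul hm hB u).coeFn_toLp] with x hx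
  rw [hx, norm_mul]
  exact mul_le_mul_of_nonneg_right (hB x) (norm_nonneg _)

/-- Multiplication by a bounded function. -/
def mulL (m : X → ℝ) (hm : Measurable m) (B : ℝ) (hB : ∀ x, |m x| ≤ B) :
    Lp ℝ 2 μ →L[ℝ] Lp ℝ 2 μ :=
  LinearMap.mkContinuous
    { toFun := fun u => (memLp_bounded_mul hm hB u).toLp
      map_add' := fun u v => by
        rw [← MemLp.toLp_add, MemLp.toLp_eq_toLp_iff]
        filter_upwards [Lp.coeFn_add u v] with x hx
        simp only [hx, Pi.add_apply, mul_add]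
      map_smul' := fun c u => by
        rw [RingHom.id_apply, ← MemLp.toLp_const_smul, MemLp.toLp_eq_toLp_iff]
        filter_upwards [Lp.coeFn_smul c u] with x hx
        simp only [hx, Pi.smul_apply, smul_eq_mul]; ring }
    B (norm_toLp_bounded_mul_le hm hB)

theorem mulL_coeFn (m : X → ℝ) (hm : Measurable m) (B : ℝ) (hB : ∀ x, |m x| ≤ B)
    (u : Lp ℝ 2 μ) : mulL m hm B hB u =ᵐ[μ] fun x => m x * u x :=
  MemLp.coeFn_toLp (memLp_bounded_mul hm hB u)

theorem tendsto_toLp_of_dominated {ι : Type*} {l : Filter ι} [l.IsCountablyGenerated]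
    [IsFiniteMeasure μ] {f : ι → X → ℝ} {g : X → ℝ} (hf : ∀ i, MemLp (f i) 2 μ) (hg : MemLp g 2 μ)
    {b : X → ℝ} (hb : MemLp b 2 μ)
    (hfb : ∀ᶠ i in l, ∀ᵐ x ∂μ, |f i x| ≤ b x) (hgb : ∀ᵐ x ∂μ, |g x| ≤ b x)
    (hlim : ∀ᵐ x ∂μ, Tendsto (fun i => f i x) l (𝓝 (g x))) :
    Tendsto (fun i => (hf i).toLp) l (𝓝 hg.toLp) := by
  rw [tendsto_iff_norm_sub_tendsto_zero]
  have hkey : Tendsto (fun i => ∫⁻ x, ‖f i x - g x‖ₑ ^ (2 : ℝ) ∂μ) l (𝓝 0) := by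
    have := tendsto_lintegral_filter_of_dominated_convergence' (μ := μ) (l := l)
      (F := fun i x => ‖f i x - g x‖ₑ ^ (2 : ℝ)) (f := fun _ => 0)
      (fun x => (2 * ‖b x‖ₑ) ^ (2 : ℝ))
      (Eventually.of_forall fun i => (((hf i).1.sub hg.1).enorm.pow_const _)) ?_ ?_ ?_
    · simpa using this
    · filter_upwards [hfb] with i hi
      filter_upwards [hi, hgb] with x h1 h2
      refine ENNReal.rpow_le_rpow ?_ (by norm_num)
      have h0 : 0 ≤ b x := (abs_nonneg _).trans h1
      have : ‖f i x - g x‖ₑ ≤ ‖f i x‖ₑ + ‖g x‖ₑ := enorm_sub_le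
      refine this.trans ?_
      rw [two_mul]
      refine add_le_add ?_ ?_ <;>
      · rw [Real.enorm_eq_ofReal_abs, Real.enorm_eq_ofReal_abs, abs_of_nonneg h0]
        exact ENNReal.ofReal_le_ofReal (by assumption)
    · have hb2 : MemLp (fun x => 2 * b x) 2 μ := hb.const_mul 2
      have := hb2.2
      rw [eLpNorm_lt_top_iff_lintegral_rpow_enorm_lt_top (by norm_num) (by norm_num)] at this
      refine ne_of_lt (lt_of_eq_of_lt ?_ this)
      refine lintegral_congr fun x => ?_
      rw [enorm_mul]; simp [Real.enorm_eq_ofReal_abs]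
    · filter_upwards [hlim] with x hx
      have h1 : Tendsto (fun i => ‖f i x - g x‖ₑ) l (𝓝 0) := by
        have := (continuous_enorm.tendsto _).comp (hx.sub_const (g x))
        simpa [Function.comp_def] using this
      have := (ENNReal.continuous_rpow_const (y := 2)).tendsto 0 |>.comp h1
      simpa [Function.comp_def] using this
  have hn : ∀ i, ‖(hf i).toLp - hg.toLp‖ =
      ((∫⁻ x, ‖f i x - g x‖ₑ ^ (2 : ℝ) ∂μ) ^ (1 / (2 : ℝ))).toReal := fun i => by
    rw [← MemLp.toLp_sub, Lp.norm_toLp, eLpNorm_eq_lintegral_rpow_enorm_toReal (by norm_num) (by norm_num)]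
    simp
  simp_rw [hn]
  have h2 := (ENNReal.continuous_rpow_const (y := 1 / (2 : ℝ))).tendsto 0 |>.comp hkey
  have h3 := (ENNReal.tendsto_toReal (a := (0 : ℝ≥0∞) ^ (1 / (2 : ℝ))) (by simp)).comp h2
  simpa [Function.comp_def] using h3

/-- The mean value inequality bounds all difference quotients by `M`, so pointwise differentiability
passes to `L²` by dominated convergence. -/
theorem hasDerivAt_toLp [IsFiniteMeasure μ] {c c' : ℝ → X → ℝ} (hc : ∀ r, MemLp (c r) 2 μ)
    (hc' : ∀ r, MemLp (c' r) 2 μ) (hd : ∀ x r, HasDerivAt (fun r => c r x) (c' r x) r) {M : ℝ}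
    (hM : ∀ r x, |c' r x| ≤ M) (r : ℝ) :
    HasDerivAt (fun r => (hc r).toLp) (hc' r).toLp r := by
  rw [hasDerivAt_iff_tendsto_slope]
  have hs : ∀ s, MemLp (fun x => slope (fun r => c r x) r s) 2 μ := fun s => by
    have := ((hc s).sub (hc r)).const_smul (s - r)⁻¹
    exact this
  have := tendsto_toLp_of_dominated (l := 𝓝[≠] r) hs (hc' r) (b := fun _ => M) (memLp_const M)
    (Eventually.of_forall fun s => Eventually.of_forall fun x => ?_)
    (Eventually.of_forall fun x => hM r x)
    (Eventually.of_forall fun x => hasDerivAt_iff_tendsto_slope.1 (hd x r))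
  · refine this.congr fun s => ?_
    rw [slope_def_module, ← MemLp.toLp_sub, ← MemLp.toLp_const_smul]
    rfl
  · have hl : ‖c s x - c r x‖ ≤ M * ‖s - r‖ :=
      Convex.norm_image_sub_le_of_norm_hasDerivWithin_le (f := fun r => c r x) (s := Set.univ)
        (fun y _ => (hd x y).hasDerivWithinAt) (fun y _ => hM y x) convex_univ trivial trivial
    have hM0 : 0 ≤ M := (abs_nonneg _).trans (hM r x)
    rw [slope_def_field, abs_div]
    exact div_le_of_le_mul₀ (abs_nonneg _) hM0 hl

end Preliminaries

/-! ### Perturbations of the identity of `[0,1]` -/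

/-- Vector fields on `[0,1]` vanishing at the end points. -/
structure IsVelocity (φ : ℝ → ℝ) : Prop where
  contDiff : ContDiff ℝ 2 φ
  zero : φ 0 = 0
  one : φ 1 = 0
  deriv_le : ∀ x ∈ Set.Icc (0 : ℝ) 1, |deriv φ x| ≤ 1 / 2

/-- The map `x ↦ x + a φ(x)`. -/
def shift (φ : ℝ → ℝ) (a x : ℝ) : ℝ := x + a * φ x

section Shift

variable {φ : ℝ → ℝ} {a : ℝ}

theorem IsVelocity.abs_mul_deriv_le (hφ : IsVelocity φ) (ha : |a| ≤ 1) {x : ℝ}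
    (hx : x ∈ Set.Icc (0 : ℝ) 1) : |a * deriv φ x| ≤ 1 / 2 := by
  rw [abs_mul]
  have := mul_le_mul ha (hφ.deriv_le x hx) (abs_nonneg _) zero_le_one
  linarith

/-- The constant 1/2 in `IsVelocity` is chosen for this bound: for `|a| ≤ 1` the shift is an
increasing bijection of `[0,1]` and the logarithm of its derivative is under control. -/
theorem IsVelocity.deriv_shift_pos (hφ : IsVelocity φ) (ha : |a| ≤ 1) {x : ℝ}
    (hx : x ∈ Set.Icc (0 : ℝ) 1) : 1 / 2 ≤ 1 + a * deriv φ x := by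
  have := (abs_le.1 (hφ.abs_mul_deriv_le ha hx)).1
  linarith

theorem IsVelocity.hasDerivAt (hφ : IsVelocity φ) (x : ℝ) : HasDerivAt φ (deriv φ x) x :=
  (hφ.contDiff.differentiable (by norm_num) x).hasDerivAt

theorem IsVelocity.hasDerivAt_shift (hφ : IsVelocity φ) (a x : ℝ) :
    HasDerivAt (shift φ a) (1 + a * deriv φ x) x :=
  (hasDerivAt_id x).add ((hφ.hasDerivAt x).const_mul a)

theorem IsVelocity.continuous_shift (hφ : IsVelocity φ) (a : ℝ) : Continuous (shift φ a) :=
  continuous_iff_continuousAt.2 fun x => (hφ.hasDerivAt_shift a x).continuousAt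

theorem IsVelocity.exists_shift_sub (hφ : IsVelocity φ) (a : ℝ) {x y : ℝ} (hxy : x ≤ y) :
    ∃ z ∈ Set.Icc x y, shift φ a y - shift φ a x = (1 + a * deriv φ z) * (y - x) := by
  rcases hxy.eq_or_lt with rfl | hlt
  · exact ⟨x, by simp, by simp⟩
  · obtain ⟨z, hz, h⟩ := exists_hasDerivAt_eq_slope (shift φ a) (fun x => 1 + a * deriv φ x) hlt
      (hφ.continuous_shift a).continuousOn fun z _ => hφ.hasDerivAt_shift a z
    refine ⟨z, Set.Ioo_subset_Icc_self hz, ?_⟩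
    rw [h, div_mul_cancel₀ _ (sub_pos.2 hlt).ne']

theorem IsVelocity.strictMonoOn_shift (hφ : IsVelocity φ) (ha : |a| ≤ 1) :
    StrictMonoOn (shift φ a) (Set.Icc 0 1) := by
  intro x hx y hy hxy
  obtain ⟨z, hz, h⟩ := hφ.exists_shift_sub a hxy.le
  have := hφ.deriv_shift_pos ha (x := z) ⟨hx.1.trans hz.1, hz.2.trans hy.2⟩
  have : 0 < shift φ a y - shift φ a x := by
    rw [h]; exact mul_pos (by linarith) (sub_pos.2 hxy)
  linarith

theorem IsVelocity.shift_zero (hφ : IsVelocity φ) : shift φ a 0 = 0 := by simp [shift, hφ.zero]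

theorem IsVelocity.shift_one (hφ : IsVelocity φ) : shift φ a 1 = 1 := by simp [shift, hφ.one]

theorem IsVelocity.shift_mem (hφ : IsVelocity φ) (ha : |a| ≤ 1) {x : ℝ}
    (hx : x ∈ Set.Icc (0 : ℝ) 1) : shift φ a x ∈ Set.Icc (0 : ℝ) 1 := by
  have hm := (hφ.strictMonoOn_shift ha).monotoneOn
  constructor
  · rw [← hφ.shift_zero (a := a)]; exact hm (by simp) hx hx.1
  · rw [← hφ.shift_one (a := a)]; exact hm hx (by simp) hx.2

theorem IsVelocity.exists_shift_eq (hφ : IsVelocity φ) {y : ℝ} (hy : y ∈ Set.Icc (0 : ℝ) 1) (a : ℝ) :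
    ∃ x ∈ Set.Icc (0 : ℝ) 1, shift φ a x = y := by
  have := intermediate_value_Icc zero_le_one (hφ.continuous_shift a).continuousOn
  rw [hφ.shift_zero, hφ.shift_one] at this
  exact this hy

theorem abs_log_sub_log_le {u v : ℝ} (hu : 1 / 2 ≤ u) (hv : 1 / 2 ≤ v) :
    |Real.log u - Real.log v| ≤ 2 * |u - v| := by
  have key : ∀ u v : ℝ, 1 / 2 ≤ u → 1 / 2 ≤ v → Real.log u - Real.log v ≤ 2 * |u - v| := by
    intro u v hu hv
    have hv0 : 0 < v := by linarith
    have hu0 : 0 < u := by linarith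
    rw [← Real.log_div hu0.ne' hv0.ne']
    have h1 := Real.log_le_sub_one_of_pos (div_pos hu0 hv0)
    have h2 : u / v - 1 = (u - v) / v := by field_simp
    have h3 : (u - v) / v ≤ |u - v| / v := div_le_div_of_nonneg_right (le_abs_self _) hv0.le
    have h4 : |u - v| / v ≤ 2 * |u - v| := by
      rw [div_le_iff₀ hv0]
      nlinarith [abs_nonneg (u - v)]
    linarith
  rw [abs_le]
  have := key v u hv hu
  rw [abs_sub_comm] at this
  exact ⟨by linarith, key u v hu hv⟩

/-- This is what C² regularity of the velocity is for: the oscillation of `φ'` between neighbouring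
points of the simplex has to be summable. -/
theorem IsVelocity.exists_lipschitz (hφ : IsVelocity φ) : ∃ K : ℝ, 0 ≤ K ∧
    ∀ x ∈ Set.Icc (0 : ℝ) 1, ∀ y ∈ Set.Icc (0 : ℝ) 1, |deriv φ x - deriv φ y| ≤ K * |x - y| := by
  have hd : ContDiff ℝ 1 (deriv φ) := by
    have := hφ.contDiff
    rw [show (2 : WithTop ℕ∞) = 1 + 1 by norm_num, contDiff_succ_iff_deriv] at this
    exact this.2.2
  obtain ⟨K, hK⟩ := (isCompact_Icc (a := (0 : ℝ)) (b := 1)).exists_bound_of_continuousOn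
    (hd.continuous_deriv le_rfl).continuousOn
  refine ⟨K, (norm_nonneg _).trans (hK 0 (by simp)), fun x hx y hy => ?_⟩
  have := Convex.norm_image_sub_le_of_norm_deriv_le (f := deriv φ) (s := Set.Icc (0 : ℝ) 1)
    (fun z _ => hd.differentiable (by norm_num) z) hK (convex_Icc 0 1) hy hx
  simpa using this

/-- The size and the oscillation of the log-derivative are both linear in `|a|`. The size is used
for boundedly many terms, the oscillation for the unboundedly many others in
`IsVelocity.exists_density_shiftPi`. -/
theorem IsVelocity.exists_log_bound (hφ : IsVelocity φ) : ∃ K : ℝ, 0 ≤ K ∧ ∀ a : ℝ, |a| ≤ 1 →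
    ∀ x ∈ Set.Icc (0 : ℝ) 1, |Real.log (1 + a * deriv φ x)| ≤ |a| ∧ ∀ y ∈ Set.Icc (0 : ℝ) 1,
      |Real.log (1 + a * deriv φ x) - Real.log (1 + a * deriv φ y)| ≤ K * |a| * |x - y| := by
  obtain ⟨K, hK0, hK⟩ := hφ.exists_lipschitz
  refine ⟨2 * K, by positivity, fun a ha x hx => ⟨?_, fun y hy => ?_⟩⟩
  · have := abs_log_sub_log_le (hφ.deriv_shift_pos ha hx) (v := 1) (by norm_num)
    rw [Real.log_one, sub_zero, add_sub_cancel_left, abs_mul] at this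
    nlinarith [hφ.deriv_le x hx, abs_nonneg a]
  · have := abs_log_sub_log_le (hφ.deriv_shift_pos ha hx) (hφ.deriv_shift_pos ha hy)
    rw [add_sub_add_left_eq_sub, ← mul_sub, abs_mul] at this
    have h2 := mul_le_mul_of_nonneg_left (hK x hx y hy) (abs_nonneg a)
    nlinarith

end Shift

/-! ### Ordered Dirichlet distributions under perturbations of the identity -/

section Simplex

variable {k : ℕ}

theorem pad_zero (x : Fin k → ℝ) : pad x 0 = 0 := rfl

theorem pad_last (x : Fin k → ℝ) : pad x (Fin.last (k + 1)) = 1 := by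
  rw [← Fin.succ_last]; simp [pad]

theorem pad_succ_castSucc (x : Fin k → ℝ) (i : Fin k) : pad x i.castSucc.succ = x i := by
  simp [pad]

theorem pad_comp (h : ℝ → ℝ) (h0 : h 0 = 0) (h1 : h 1 = 1) (x : Fin k → ℝ) (j : Fin (k + 2)) :
    pad (fun i => h (x i)) j = h (pad x j) := by
  refine Fin.cases ?_ (fun j => ?_) j
  · rw [pad_zero, pad_zero, h0]
  · refine Fin.lastCases ?_ (fun i => ?_) j
    · rw [Fin.succ_last, pad_last, pad_last, h1]
    · rw [pad_succ_castSucc, pad_succ_castSucc]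

theorem continuous_pad (j : Fin (k + 2)) : Continuous fun x : Fin k → ℝ => pad x j := by
  refine Fin.cases ?_ (fun j => ?_) j
  · simp only [pad_zero]; exact continuous_const
  · refine Fin.lastCases ?_ (fun i => ?_) j
    · simp only [Fin.succ_last, pad_last]; exact continuous_const
    · simp only [pad_succ_castSucc]; exact continuous_apply i

theorem measurableSet_simplex : MeasurableSet (simplex k) := by
  have : simplex k = ⋂ (i) (j) (_ : i ≤ j), {x | pad x i ≤ pad x j} := by
    ext x; simp [simplex, Monotone]
  rw [this]
  exact .iInter fun i => .iInter fun j => .iInter fun _ =>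
    measurableSet_le (continuous_pad i).measurable (continuous_pad j).measurable

theorem pad_mem_Icc {x : Fin k → ℝ} (hx : x ∈ simplex k) (j : Fin (k + 2)) :
    pad x j ∈ Set.Icc (0 : ℝ) 1 := by
  constructor
  · rw [← pad_zero x]; exact hx (Fin.zero_le j)
  · rw [← pad_last x]; exact hx (Fin.le_last j)

theorem mem_Icc_of_mem_simplex {x : Fin k → ℝ} (hx : x ∈ simplex k) (i : Fin k) :
    x i ∈ Set.Icc (0 : ℝ) 1 := by
  rw [← pad_succ_castSucc x i]; exact pad_mem_Icc hx _

theorem gap_nonneg {x : Fin k → ℝ} (hx : x ∈ simplex k) (i : Fin (k + 1)) : 0 ≤ gap x i :=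
  sub_nonneg.2 (hx (Fin.castSucc_le_succ i))

theorem sum_gap (x : Fin k → ℝ) : ∑ i, gap x i = 1 := by
  have h1 := Fin.sum_univ_succ (pad x)
  have h2 := Fin.sum_univ_castSucc (pad x)
  simp only [gap, Finset.sum_sub_distrib]
  rw [pad_zero] at h1
  rw [pad_last] at h2
  linarith

variable {φ : ℝ → ℝ} {a : ℝ}

/-- The coordinatewise action of `shift φ a`. -/
def shiftPi (φ : ℝ → ℝ) (a : ℝ) (x : Fin k → ℝ) : Fin k → ℝ := fun i => shift φ a (x i)

theorem IsVelocity.measurable_shiftPi (hφ : IsVelocity φ) (a : ℝ) :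
    Measurable (shiftPi φ a : (Fin k → ℝ) → _) :=
  measurable_pi_lambda _ fun i => (hφ.continuous_shift a).measurable.comp (measurable_pi_apply i)

theorem IsVelocity.pad_shiftPi (hφ : IsVelocity φ) (x : Fin k → ℝ) (j : Fin (k + 2)) :
    pad (shiftPi φ a x) j = shift φ a (pad x j) :=
  pad_comp _ hφ.shift_zero hφ.shift_one x j

theorem IsVelocity.image_shiftPi (hφ : IsVelocity φ) (ha : |a| ≤ 1) :
    shiftPi φ a '' simplex k = simplex k := by
  apply Set.Subset.antisymm
  · rintro _ ⟨x, hx, rfl⟩ i j hij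
    rw [hφ.pad_shiftPi, hφ.pad_shiftPi]
    exact (hφ.strictMonoOn_shift ha).monotoneOn (pad_mem_Icc hx i) (pad_mem_Icc hx j) (hx hij)
  · intro y hy
    choose x hx hxy using fun i => hφ.exists_shift_eq (mem_Icc_of_mem_simplex hy i) a
    have hxy' : shiftPi φ a x = y := funext hxy
    have hmem : ∀ j, pad x j ∈ Set.Icc (0 : ℝ) 1 := fun j => by
      refine Fin.cases (by simp [pad_zero]) (fun j => ?_) j
      refine Fin.lastCases (by simp [pad_last]) (fun i => ?_) j
      rw [pad_succ_castSucc]; exact hx i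
    refine ⟨x, fun i j hij => ?_, hxy'⟩
    rw [← (hφ.strictMonoOn_shift ha).le_iff_le (hmem i) (hmem j), ← hφ.pad_shiftPi,
      ← hφ.pad_shiftPi, hxy']
    exact hy hij

theorem IsVelocity.injOn_shiftPi (hφ : IsVelocity φ) (ha : |a| ≤ 1) :
    Set.InjOn (shiftPi φ a) (simplex k) := fun _ hx _ hy h => funext fun i =>
  (hφ.strictMonoOn_shift ha).injOn (mem_Icc_of_mem_simplex hx i) (mem_Icc_of_mem_simplex hy i)
    (congrFun h i)

/-- The density of the ordered Dirichlet distribution. -/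
def dirichletDensity (α : Fin (k + 1) → ℝ) (x : Fin k → ℝ) : ℝ :=
  Real.Gamma (∑ i, α i) / (∏ i, Real.Gamma (α i)) * ∏ i, gap x i ^ (α i - 1)

theorem dirichletDensity_nonneg {α : Fin (k + 1) → ℝ} (hα : ∀ i, 0 < α i) {x : Fin k → ℝ}
    (hx : x ∈ simplex k) : 0 ≤ dirichletDensity α x := by
  refine mul_nonneg (div_nonneg (Real.Gamma_nonneg_of_nonneg ?_) (Finset.prod_nonneg fun i _ => ?_))
    (Finset.prod_nonneg fun i _ => Real.rpow_nonneg (gap_nonneg hx i) _)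
  · exact Finset.sum_nonneg fun i _ => (hα i).le
  · exact Real.Gamma_nonneg_of_nonneg (hα i).le

/-- The shift multiplies the `i`-th gap by `1 + a φ'(y i)` with `y i` in that gap, so `E` is a sum
of log-derivatives at the points `x i` and `y i`. The essential point is that `K` does not depend on
`k`, which permits the passage to the infinite dimensional law. -/
theorem IsVelocity.exists_density_shiftPi (hφ : IsVelocity φ) : ∃ K : ℝ, 0 ≤ K ∧ ∀ (k : ℕ)
    (α : Fin (k + 1) → ℝ), (∀ i, 0 < α i) → ∀ a : ℝ, |a| ≤ 1 → ∀ x ∈ simplex k, ∃ E : ℝ,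
      |E| ≤ (∑ i, α i + 1 + K) * |a| ∧
      (∏ i, (1 + a * deriv φ (x i))) * dirichletDensity α (shiftPi φ a x) =
        Real.exp E * dirichletDensity α x := by
  obtain ⟨K, hK0, hK⟩ := hφ.exists_log_bound
  refine ⟨K, hK0, fun k α hα a ha x hx => ?_⟩
  choose y hy hgap using fun i : Fin (k + 1) =>
    hφ.exists_shift_sub a (hx (Fin.castSucc_le_succ i))
  have hy' : ∀ i, y i ∈ Set.Icc (0 : ℝ) 1 := fun i =>
    ⟨(pad_mem_Icc hx _).1.trans (hy i).1, (hy i).2.trans (pad_mem_Icc hx _).2⟩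
  set l : ℝ → ℝ := fun z => Real.log (1 + a * deriv φ z) with hl
  have hexp : ∀ z ∈ Set.Icc (0 : ℝ) 1, Real.exp (l z) = 1 + a * deriv φ z := fun z hz =>
    Real.exp_log (by linarith [hφ.deriv_shift_pos ha hz])
  refine ⟨∑ i, l (x i) + ∑ i, (α i - 1) * l (y i), ?_, ?_⟩
  -- There are `k + 1` points `y i` but only `k` points `x i`. Each `x i` is paired with the mean
  -- value point of the gap that starts at `x i`; the unpaired `y 0` accounts for the `+ 1` in the
  -- bound.
  · have hsum : ∑ i, l (x i) + ∑ i, (α i - 1) * l (y i) =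
        ∑ i, α i * l (y i) - l (y 0) + ∑ i : Fin k, (l (x i) - l (y i.succ)) := by
      have := Fin.sum_univ_succ fun i => l (y i)
      simp only [sub_mul, one_mul, Finset.sum_sub_distrib]
      linarith
    have h1 : |∑ i, α i * l (y i)| ≤ (∑ i, α i) * |a| := by
      rw [Finset.sum_mul]
      refine (Finset.abs_sum_le_sum_abs _ _).trans (Finset.sum_le_sum fun i _ => ?_)
      rw [abs_mul, abs_of_pos (hα i)]
      exact mul_le_mul_of_nonneg_left (hK a ha _ (hy' i)).1 (hα i).le
    have h2 : |l (y 0)| ≤ |a| := (hK a ha _ (hy' 0)).1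
    -- The paired points lie in one gap, so each difference is at most `K * |a|` times that gap, and
    -- the gaps sum to at most one.
    have h3 : |∑ i : Fin k, (l (x i) - l (y i.succ))| ≤ K * |a| := by
      calc |∑ i : Fin k, (l (x i) - l (y i.succ))|
          ≤ ∑ i : Fin k, |l (x i) - l (y i.succ)| := Finset.abs_sum_le_sum_abs _ _
        _ ≤ ∑ i : Fin k, K * |a| * gap x i.succ := by
          refine Finset.sum_le_sum fun i _ => ?_
          refine ((hK a ha _ (mem_Icc_of_mem_simplex hx i)).2 _ (hy' i.succ)).trans ?_
          refine mul_le_mul_of_nonneg_left ?_ (by positivity)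
          have h4 := hy i.succ
          rw [← Fin.succ_castSucc, pad_succ_castSucc] at h4
          rw [abs_sub_comm, abs_of_nonneg (sub_nonneg.2 h4.1), gap, ← Fin.succ_castSucc,
            pad_succ_castSucc]
          linarith [h4.2]
        _ ≤ K * |a| * 1 := by
          rw [← Finset.mul_sum]
          refine mul_le_mul_of_nonneg_left ?_ (by positivity)
          have := sum_gap x
          rw [Fin.sum_univ_succ] at this
          linarith [gap_nonneg hx 0]
        _ = K * |a| := mul_one _
    rw [hsum]
    rw [abs_le] at h1 h2 h3 ⊢
    constructor <;> nlinarith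
  · have hg : ∀ i, gap (shiftPi φ a x) i ^ (α i - 1) =
        Real.exp ((α i - 1) * l (y i)) * gap x i ^ (α i - 1) := fun i => by
      rw [gap, hφ.pad_shiftPi, hφ.pad_shiftPi, hgap, ← hexp _ (hy' i)]
      change (Real.exp (l (y i)) * gap x i) ^ (α i - 1) = _
      rw [Real.mul_rpow (Real.exp_pos _).le (gap_nonneg hx i), ← Real.exp_mul, mul_comm (α i - 1)]
    have hx' : ∏ i, (1 + a * deriv φ (x i)) = Real.exp (∑ i, l (x i)) := by
      rw [Real.exp_sum]
      exact Finset.prod_congr rfl fun i _ => (hexp _ (mem_Icc_of_mem_simplex hx i)).symm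
    simp only [dirichletDensity, hg, hx', Finset.prod_mul_distrib, ← Real.exp_sum, Real.exp_add]
    ring

/-- The shift acts coordinatewise, so its Jacobian matrix is diagonal with positive entries, and it
maps the simplex bijectively onto itself. -/
theorem IsVelocity.lintegral_simplex (hφ : IsVelocity φ) (ha : |a| ≤ 1) (F : (Fin k → ℝ) → ℝ≥0∞) :
    ∫⁻ x in simplex k, F x =
      ∫⁻ x in simplex k, ENNReal.ofReal (∏ i, (1 + a * deriv φ (x i))) * F (shiftPi φ a x) := by
  set f' : (Fin k → ℝ) → (Fin k → ℝ) →L[ℝ] (Fin k → ℝ) := fun x =>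
    ContinuousLinearMap.pi fun i =>
      ((1 + a * deriv φ (x i)) • ContinuousLinearMap.id ℝ ℝ).comp (ContinuousLinearMap.proj i)
  have hf' : ∀ x ∈ simplex k, HasFDerivWithinAt (shiftPi φ a) (f' x) (simplex k) x := by
    intro x _
    refine HasFDerivAt.hasFDerivWithinAt (hasFDerivAt_pi.2 fun i => ?_)
    have h := (hφ.hasDerivAt_shift a (x i)).hasFDerivAt.comp x
      (ContinuousLinearMap.proj (R := ℝ) (φ := fun _ : Fin k => ℝ) i).hasFDerivAt
    refine h.congr_fderiv ?_
    ext v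
    simp [mul_comm]
  have hdet : ∀ x, (f' x).det = ∏ i, (1 + a * deriv φ (x i)) := fun x => by
    rw [ContinuousLinearMap.det_pi]
    refine Finset.prod_congr rfl fun i _ => ?_
    simp [ContinuousLinearMap.det]
  have := lintegral_image_eq_lintegral_abs_det_fderiv_mul volume measurableSet_simplex hf'
    (hφ.injOn_shiftPi ha) F
  rw [hφ.image_shiftPi ha] at this
  rw [this]
  refine setLIntegral_congr_fun measurableSet_simplex fun x hx => ?_
  simp only [hdet]
  rw [abs_of_nonneg]
  exact Finset.prod_nonneg fun i _ => by
    linarith [hφ.deriv_shift_pos ha (mem_Icc_of_mem_simplex hx i)]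

theorem orderedDirichlet_apply (α : Fin (k + 1) → ℝ) {B : Set (Fin k → ℝ)} (hB : MeasurableSet B) :
    orderedDirichlet α B =
      ∫⁻ x in simplex k, B.indicator 1 x * ENNReal.ofReal (dirichletDensity α x) := by
  rw [orderedDirichlet, withDensity_apply _ hB, ← lintegral_indicator hB]
  refine lintegral_congr fun x => ?_
  by_cases hx : x ∈ B <;> simp [hx, dirichletDensity]

/-- After the change of variables both inequalities are the pointwise bound on `E` in the density
ratio. The second direction is needed for integration by parts, where the two measures have to
differ by `O(|a|)`. -/
theorem IsVelocity.exists_orderedDirichlet_shiftPi (hφ : IsVelocity φ) : ∃ K : ℝ, 0 ≤ K ∧ ∀ (k : ℕ)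
    (α : Fin (k + 1) → ℝ), (∀ i, 0 < α i) → ∀ a : ℝ, |a| ≤ 1 → ∀ B, MeasurableSet B →
      orderedDirichlet α (shiftPi φ a ⁻¹' B) ≤
        ENNReal.ofReal (Real.exp ((∑ i, α i + 1 + K) * |a|)) * orderedDirichlet α B ∧
      orderedDirichlet α B ≤
        ENNReal.ofReal (Real.exp ((∑ i, α i + 1 + K) * |a|)) *
          orderedDirichlet α (shiftPi φ a ⁻¹' B) := by
  obtain ⟨K, hK0, hK⟩ := hφ.exists_density_shiftPi
  refine ⟨K, hK0, fun k α hα a ha B hB => ?_⟩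
  have hB' := hφ.measurable_shiftPi a hB
  rw [orderedDirichlet_apply α hB, orderedDirichlet_apply α hB', hφ.lintegral_simplex ha
    fun x => B.indicator 1 x * ENNReal.ofReal (dirichletDensity α x)]
  have hind : ∀ x, (shiftPi φ a ⁻¹' B).indicator (1 : (Fin k → ℝ) → ℝ≥0∞) x =
      B.indicator 1 (shiftPi φ a x) := fun x => rfl
  rw [← lintegral_const_mul' _ _ ENNReal.ofReal_ne_top, ← lintegral_const_mul' _ _ ENNReal.ofReal_ne_top]
  have hprod : ∀ x ∈ simplex k, 0 ≤ ∏ i, (1 + a * deriv φ (x i)) := fun x hx =>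
    Finset.prod_nonneg fun i _ => by
      linarith [hφ.deriv_shift_pos ha (mem_Icc_of_mem_simplex hx i)]
  constructor <;> refine setLIntegral_mono' measurableSet_simplex fun x hx => ?_
  · obtain ⟨E, hE, h⟩ := hK k α hα a ha x hx
    rw [hind, mul_left_comm (ENNReal.ofReal (∏ i, _)), ← ENNReal.ofReal_mul (hprod x hx), h,
      mul_left_comm, ← ENNReal.ofReal_mul (Real.exp_pos _).le, ← mul_assoc, ← Real.exp_add]
    gcongr
    refine le_mul_of_one_le_left (dirichletDensity_nonneg hα hx) (Real.one_le_exp ?_)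
    linarith [(abs_le.1 hE).1]
  · obtain ⟨E, hE, h⟩ := hK k α hα a ha x hx
    rw [hind, mul_left_comm (ENNReal.ofReal (∏ i, _)), ← ENNReal.ofReal_mul (hprod x hx), h,
      mul_left_comm, ← ENNReal.ofReal_mul (Real.exp_pos _).le]
    gcongr
    · exact dirichletDensity_nonneg hα hx
    · exact (abs_le.1 hE).2

end Simplex

/-- An inequality between measures is not inherited by complements, so a π-λ argument does not
apply; instead `A` is approximated by sets of the ring with respect to `μ + ν`. -/
theorem measure_le_of_isSetRing {X : Type*} {m0 : MeasurableSpace X} {μ ν : Measure X}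
    [IsFiniteMeasure μ] [IsFiniteMeasure ν] {S : Set (Set X)} (hS : IsSetRing S)
    (huniv : Set.univ ∈ S) (hgen : m0 = MeasurableSpace.generateFrom S) {c : ℝ≥0∞} (hc : c ≠ ⊤)
    (h : ∀ A ∈ S, ν A ≤ c * μ A) {A : Set X} (hA : MeasurableSet A) : ν A ≤ c * μ A := by
  have key : ∀ ε : ℝ≥0∞, 0 < ε → ν A ≤ c * (μ A + ε) + ε := by
    intro ε hε
    obtain ⟨t, ht, htA⟩ := exists_measure_symmDiff_lt_of_generateFrom_isSetRing (μ := μ + ν) hS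
      ⟨{Set.univ}, Set.countable_singleton _, by simpa using huniv, by simp⟩ hgen hA hε
    rw [Measure.add_apply] at htA
    have h1 : ν A ≤ ν t + ν (symmDiff t A) := by
      refine (measure_mono fun x hx => ?_).trans (measure_union_le _ _)
      by_cases hxt : x ∈ t
      · exact Or.inl hxt
      · exact Or.inr (Or.inr ⟨hx, hxt⟩)
    have h2 : μ t ≤ μ A + μ (symmDiff t A) := by
      refine (measure_mono fun x hx => ?_).trans (measure_union_le _ _)
      by_cases hxA : x ∈ A
      · exact Or.inl hxA
      · exact Or.inr (Or.inl ⟨hx, hxA⟩)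
    calc ν A ≤ ν t + ν (symmDiff t A) := h1
      _ ≤ c * (μ A + ε) + ε := by
        refine add_le_add ((h t ht).trans ?_) ((le_add_self).trans htA.le)
        gcongr
        refine h2.trans ?_
        gcongr
        exact (le_self_add).trans htA.le
  have hlim : Tendsto (fun ε : ℝ≥0∞ => c * (μ A + ε) + ε) (𝓝[>] 0) (𝓝 (c * (μ A + 0) + 0)) := by
    refine Tendsto.mono_left ?_ nhdsWithin_le_nhds
    refine Tendsto.add ?_ tendsto_id
    exact ENNReal.Tendsto.const_mul (tendsto_const_nhds.add tendsto_id) (Or.inr hc)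
  rw [add_zero, add_zero] at hlim
  exact ge_of_tendsto hlim (by filter_upwards [self_mem_nhdsWithin] with ε hε using key ε hε)

/-! ### Quantile functions -/

section Quantile

theorem measurable_eval (t : I) : Measurable fun g : G => g.1 t :=
  (measurable_pi_apply t).comp measurable_subtype_coe

/-- Monotonicity and right continuity express sublevel sets through countably many evaluations. This
yields joint measurability of `(g, t) ↦ g t`, on which all later uses of Fubini rest. -/
theorem lt_iff_exists_rat (g : G) (t : I) (c : ℝ) :
    g.1 t < c ↔ ∃ p : {p : ℚ // (p : ℝ) ∈ Set.Ico (0 : ℝ) 1},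
      (t : ℝ) < (p.1 : ℝ) ∧ g.1 ⟨p.1, p.2⟩ < c := by
  constructor
  · intro h
    have hmem := (g.2.2.2 t).eventually (gt_mem_nhds h)
    rw [eventually_nhdsWithin_iff, Metric.eventually_nhds_iff] at hmem
    obtain ⟨ε, hε, hmem⟩ := hmem
    have ht := t.2
    obtain ⟨p, hp1, hp2⟩ := exists_rat_btwn (show (t : ℝ) < min (t + ε) 1 from
      lt_min (by linarith) ht.2)
    have hp : (p : ℝ) ∈ Set.Ico (0 : ℝ) 1 :=
      ⟨ht.1.trans hp1.le, hp2.trans_le (min_le_right _ _)⟩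
    refine ⟨⟨p, hp⟩, hp1, hmem ?_ (show t ≤ ⟨p, hp⟩ from hp1.le)⟩
    rw [Subtype.dist_eq, Real.dist_eq, abs_lt]
    have := hp2.trans_le (min_le_left _ _)
    constructor <;> simp only <;> linarith
  · rintro ⟨p, hp, h⟩
    exact (g.2.1 (show t ≤ ⟨p.1, p.2⟩ from hp.le)).trans_lt h

theorem measurable_uncurry_eval : Measurable fun p : G × I => p.1.1 p.2 := by
  refine measurable_of_Iio fun c => ?_
  have : (fun p : G × I => p.1.1 p.2) ⁻¹' Set.Iio c =
      ⋃ r : {p : ℚ // (p : ℝ) ∈ Set.Ico (0 : ℝ) 1},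
        {p : G × I | (p.2 : ℝ) < (r.1 : ℝ) ∧ p.1.1 ⟨r.1, r.2⟩ < c} := by
    ext p
    rw [Set.mem_preimage, Set.mem_Iio, lt_iff_exists_rat, Set.mem_iUnion]
    rfl
  rw [this]
  refine .iUnion fun r => .inter ?_ ?_
  · exact measurableSet_lt (measurable_subtype_coe.comp measurable_snd) measurable_const
  · exact measurableSet_lt ((measurable_eval _).comp measurable_fst) measurable_const

theorem measurable_coe_G (g : G) : Measurable g.1 :=
  measurable_uncurry_eval.comp (measurable_const.prodMk measurable_id)

theorem measurable_sample (n : ℕ) : Measurable (sample n) :=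
  measurable_pi_lambda _ fun _ => measurable_eval _

/-- The value of `g` at the grid point to the right of `t`, and `0` if there is none. -/
def rightValue (n : ℕ) (x : Fin n → ℝ) (t : I) : ℝ :=
  if h : ⌊((n : ℝ) + 1) * t⌋₊ < n then x ⟨_, h⟩ else 0

/-- The chosen grid points approach `t` from the right, where `g` is continuous. The default value 0
occurs only on the last cell, which `t < 1` eventually leaves. -/
theorem tendsto_rightValue (g : G) (t : I) {N : ℕ → ℕ} (hN : Tendsto N atTop atTop) :
    Tendsto (fun m => rightValue (N m) (sample (N m) g) t) atTop (𝓝 (g.1 t)) := by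
  have ht := t.2
  have hfl : ∀ n : ℕ, ((n : ℝ) + 1) * t < ⌊((n : ℝ) + 1) * t⌋₊ + 1 := fun n =>
    Nat.lt_floor_add_one _
  have hfl' : ∀ n : ℕ, (⌊((n : ℝ) + 1) * t⌋₊ : ℝ) ≤ ((n : ℝ) + 1) * t := fun n =>
    Nat.floor_le (mul_nonneg (by positivity) ht.1)
  have hlt : ∀ᶠ n : ℕ in atTop, ⌊((n : ℝ) + 1) * t⌋₊ < n := by
    obtain ⟨n₀, hn₀⟩ := exists_nat_gt (1 / (1 - (t : ℝ)))
    filter_upwards [eventually_ge_atTop n₀] with n hn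
    have h1 : 1 / (1 - (t : ℝ)) < n := hn₀.trans_le (by exact_mod_cast hn)
    rw [div_lt_iff₀ (by linarith [ht.2])] at h1
    have h2 : (⌊((n : ℝ) + 1) * t⌋₊ : ℝ) < n := by
      refine (hfl' n).trans_lt ?_
      nlinarith [ht.2]
    exact_mod_cast h2
  set s : ℕ → I := fun n => if h : ⌊((n : ℝ) + 1) * t⌋₊ < n then gridPoint n ⟨_, h⟩ else t with hs
  have hs1 : ∀ n, t ≤ s n := by
    intro n
    by_cases h : ⌊((n : ℝ) + 1) * t⌋₊ < n
    · simp only [hs, h, dif_pos]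
      change (t : ℝ) ≤ ((⌊((n : ℝ) + 1) * t⌋₊ : ℝ) + 1) / ((n : ℝ) + 1)
      rw [le_div_iff₀ (by positivity)]
      nlinarith [hfl n]
    · simp [hs, h]
  have hs2 : Tendsto s atTop (𝓝 t) := by
    rw [tendsto_subtype_rng]
    have hup : ∀ n : ℕ, (s n : ℝ) ≤ t + 1 / ((n : ℝ) + 1) := by
      intro n
      by_cases h : ⌊((n : ℝ) + 1) * t⌋₊ < n
      · simp only [hs, h, dif_pos]
        change ((⌊((n : ℝ) + 1) * t⌋₊ : ℝ) + 1) / ((n : ℝ) + 1) ≤ _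
        rw [div_le_iff₀ (by positivity)]
        have h1 : 1 / ((n : ℝ) + 1) * ((n : ℝ) + 1) = 1 := one_div_mul_cancel (by positivity)
        nlinarith [hfl' n]
      · simp only [hs, h, dif_neg, not_false_eq_true]
        have : 0 < 1 / ((n : ℝ) + 1) := by positivity
        linarith
    refine tendsto_of_tendsto_of_tendsto_of_le_of_le tendsto_const_nhds
      (h := fun n : ℕ => (t : ℝ) + 1 / ((n : ℝ) + 1)) ?_ (fun n => hs1 n) hup
    simpa using tendsto_one_div_add_atTop_nhds_zero_nat.const_add (t : ℝ)
  have hg : Tendsto (fun m => g.1 (s (N m))) atTop (𝓝 (g.1 t)) :=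
    (g.2.2.2 t).tendsto.comp
      (tendsto_nhdsWithin_iff.2 ⟨hs2.comp hN, Eventually.of_forall fun m => hs1 _⟩)
  refine hg.congr' ?_
  filter_upwards [hN.eventually hlt] with m hm
  simp [rightValue, hs, hm, sample]

theorem rightValue_mem (n : ℕ) (g : G) (t : I) :
    rightValue n (sample n g) t ∈ Set.Icc (0 : ℝ) 1 := by
  unfold rightValue
  split_ifs
  · exact g.2.2.1 _
  · simp

theorem measurable_rightValue_left {Y : Type*} [MeasurableSpace Y] (n : ℕ) {f : Y → Fin n → ℝ}
    (hf : Measurable f) (t : I) : Measurable fun y => rightValue n (f y) t := by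
  unfold rightValue
  split_ifs
  · exact (measurable_pi_apply _).comp hf
  · exact measurable_const

/-- Events depending on finitely many dyadic evaluations. -/
def dyadicSets : Set (Set G) :=
  {A | ∃ (m : ℕ) (B : Set (Fin (2 ^ m - 1) → ℝ)), MeasurableSet B ∧
    A = sample (2 ^ m - 1) ⁻¹' B}

/-- `sample n` has mesh `1/(n+1)`, so `2 ^ m - 1` points give mesh `2⁻ᵐ`. These grids are nested,
which makes the dyadic events a ring. -/
theorem exists_sample_eq {m m' : ℕ} (h : m ≤ m') :
    ∃ e : Fin (2 ^ m - 1) → Fin (2 ^ m' - 1), ∀ g i,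
      sample (2 ^ m - 1) g i = sample (2 ^ m' - 1) g (e i) := by
  obtain ⟨d, rfl⟩ := Nat.exists_eq_add_of_le h
  have hd : 0 < 2 ^ d := by positivity
  have hm : 0 < 2 ^ m := by positivity
  have hlt : ∀ i : Fin (2 ^ m - 1), ((i : ℕ) + 1) * 2 ^ d - 1 < 2 ^ (m + d) - 1 := fun i => by
    have h1 : (i : ℕ) + 1 < 2 ^ m := by omega
    have h2 : ((i : ℕ) + 1) * 2 ^ d < 2 ^ m * 2 ^ d := Nat.mul_lt_mul_of_pos_right h1 hd
    rw [pow_add]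
    have h3 : 0 < ((i : ℕ) + 1) * 2 ^ d := by positivity
    omega
  refine ⟨fun i => ⟨_, hlt i⟩, fun g i => ?_⟩
  refine congrArg g.1 (Subtype.ext ?_)
  have h3 : 0 < ((i : ℕ) + 1) * 2 ^ d := by positivity
  change ((i : ℝ) + 1) / (((2 ^ m - 1 : ℕ) : ℝ) + 1) =
    ((((((i : ℕ) + 1) * 2 ^ d - 1 : ℕ) : ℝ) + 1)) / (((2 ^ (m + d) - 1 : ℕ) : ℝ) + 1)
  rw [Nat.cast_pred hm, Nat.cast_pred h3, Nat.cast_pred (by positivity)]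
  push_cast
  rw [sub_add_cancel, sub_add_cancel, sub_add_cancel, pow_add, mul_div_mul_right _ _ (by positivity)]

theorem mem_dyadicSets_mono {m m' : ℕ} (h : m ≤ m') {B : Set (Fin (2 ^ m - 1) → ℝ)}
    (hB : MeasurableSet B) : ∃ B' : Set (Fin (2 ^ m' - 1) → ℝ), MeasurableSet B' ∧
      sample (2 ^ m - 1) ⁻¹' B = sample (2 ^ m' - 1) ⁻¹' B' := by
  obtain ⟨e, he⟩ := exists_sample_eq h
  refine ⟨(fun x i => x (e i)) ⁻¹' B,
    (measurable_pi_lambda _ fun i => measurable_pi_apply (e i)) hB, ?_⟩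
  ext g
  simp only [Set.mem_preimage]
  rw [show sample (2 ^ m - 1) g = fun i => sample (2 ^ m' - 1) g (e i) from funext (he g)]

theorem isSetRing_dyadicSets : IsSetRing dyadicSets := by
  refine ⟨⟨0, ∅, MeasurableSet.empty, by simp⟩, ?_, ?_⟩
  · rintro _ _ ⟨m, B, hB, rfl⟩ ⟨m', B', hB', rfl⟩
    obtain ⟨C, hC, h1⟩ := mem_dyadicSets_mono (le_max_left m m') hB
    obtain ⟨C', hC', h2⟩ := mem_dyadicSets_mono (le_max_right m m') hB'
    exact ⟨max m m', C ∪ C', hC.union hC', by rw [h1, h2, Set.preimage_union]⟩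
  · rintro _ _ ⟨m, B, hB, rfl⟩ ⟨m', B', hB', rfl⟩
    obtain ⟨C, hC, h1⟩ := mem_dyadicSets_mono (le_max_left m m') hB
    obtain ⟨C', hC', h2⟩ := mem_dyadicSets_mono (le_max_right m m') hB'
    exact ⟨max m m', C \ C', hC.diff hC', by rw [h1, h2, Set.preimage_sdiff]⟩

/-- To generate the σ-algebra on `G` it suffices to make the evaluations measurable. -/
theorem generateFrom_G {S : Set (Set G)} (hS : ∀ A ∈ S, MeasurableSet A)
    (h : ∀ t, Measurable[MeasurableSpace.generateFrom S] fun g : G => g.1 t) :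
    (inferInstance : MeasurableSpace G) = MeasurableSpace.generateFrom S := by
  apply le_antisymm
  · change MeasurableSpace.comap _ _ ≤ _
    rw [← measurable_iff_comap_le]
    exact @measurable_pi_lambda _ _ _ (MeasurableSpace.generateFrom S) _ _ h
  · exact MeasurableSpace.generateFrom_le hS

theorem tendsto_two_pow_sub_one : Tendsto (fun m : ℕ => 2 ^ m - 1) atTop atTop :=
  (tendsto_sub_atTop_nat 1).comp (tendsto_pow_atTop_atTop_of_one_lt (by norm_num))

/-- Every evaluation is the limit of the values at the next dyadic points to the right. -/
theorem generateFrom_dyadicSets :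
    (inferInstance : MeasurableSpace G) = MeasurableSpace.generateFrom dyadicSets := by
  refine generateFrom_G ?_ fun t => ?_
  · rintro _ ⟨m, B, hB, rfl⟩
    exact measurable_sample _ hB
  · refine @measurable_of_tendsto_metrizable G ℝ (MeasurableSpace.generateFrom dyadicSets) _ _ _ _
      (fun m g => rightValue (2 ^ m - 1) (sample (2 ^ m - 1) g) t) _ (fun m => ?_)
      (tendsto_pi_nhds.2 fun g => tendsto_rightValue g t tendsto_two_pow_sub_one)
    refine @measurable_rightValue_left G (MeasurableSpace.generateFrom dyadicSets) _ _ ?_ t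
    exact fun B hB => MeasurableSpace.measurableSet_generateFrom ⟨m, B, hB, rfl⟩

variable {φ : ℝ → ℝ}

/-- The perturbation `g ↦ g + sin r • φ ∘ g`. -/
def IsVelocity.move (hφ : IsVelocity φ) (r : ℝ) (g : G) : G :=
  ⟨fun t => shift φ (Real.sin r) (g.1 t),
    fun s t hst => (hφ.strictMonoOn_shift (Real.abs_sin_le_one r)).monotoneOn (g.2.2.1 s)
      (g.2.2.1 t) (g.2.1 hst),
    fun t => hφ.shift_mem (Real.abs_sin_le_one r) (g.2.2.1 t),
    fun t => (hφ.continuous_shift _).continuousAt.comp_continuousWithinAt (g.2.2.2 t)⟩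

theorem IsVelocity.move_apply (hφ : IsVelocity φ) (r : ℝ) (g : G) (t : I) :
    (hφ.move r g).1 t = g.1 t + Real.sin r * φ (g.1 t) := rfl

theorem IsVelocity.move_zero (hφ : IsVelocity φ) (g : G) : hφ.move 0 g = g :=
  Subtype.ext (funext fun t => by simp [hφ.move_apply])

theorem IsVelocity.measurable_move (hφ : IsVelocity φ) (r : ℝ) : Measurable (hφ.move r) :=
  Measurable.subtype_mk (measurable_pi_lambda _ fun t =>
    (hφ.continuous_shift _).measurable.comp (measurable_eval t))

theorem gap_gridPoint (n : ℕ) (i : Fin (n + 1)) :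
    gap (fun j : Fin n => ((gridPoint n j : I) : ℝ)) i = 1 / ((n : ℝ) + 1) := by
  have key : ∀ j : Fin (n + 2),
      pad (fun j : Fin n => ((gridPoint n j : I) : ℝ)) j = (j : ℝ) / ((n : ℝ) + 1) := fun j => by
    refine Fin.cases (by simp [pad_zero]) (fun j => ?_) j
    refine Fin.lastCases ?_ (fun i => ?_) j
    · rw [Fin.succ_last, pad_last]
      have : (n : ℝ) + 1 ≠ 0 := by positivity
      simp [this]
    · rw [pad_succ_castSucc]
      simp [gridPoint]
  rw [gap, key, key, ← sub_div]
  simp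

variable {β : ℝ} {Q : Measure G}

theorem IsDirichletProcessLaw.map_sample (hQ : IsDirichletProcessLaw β Q) (n : ℕ) :
    Q.map (sample n) = q β n := by
  have h := hQ n (gridPoint n) (fun i j hij => ?_) fun i => ?_
  · change Q.map (sample n) = _ at h
    rw [h, q]
    congr 1
    funext i
    rw [gap_gridPoint, mul_one_div]
  · change ((i : ℝ) + 1) / ((n : ℝ) + 1) < ((j : ℝ) + 1) / ((n : ℝ) + 1)
    have : ((i : ℕ) : ℝ) < ((j : ℕ) : ℝ) := by exact_mod_cast hij
    gcongr
  · change 0 < ((i : ℝ) + 1) / ((n : ℝ) + 1)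
    positivity

/-- Sampling intertwines `move` with the coordinatewise shift, so on dyadic events this is the
finite dimensional estimate. Its rate is the same on all grids because the parameters `β / (n + 1)`
always add up to `β`. -/
theorem IsVelocity.exists_move_bound (hφ : IsVelocity φ) (hβ : 0 < β) [IsProbabilityMeasure Q]
    (hQ : IsDirichletProcessLaw β Q) : ∃ K : ℝ, 0 ≤ K ∧ ∀ r A, MeasurableSet A →
      Q (hφ.move r ⁻¹' A) ≤ ENNReal.ofReal (Real.exp (K * |Real.sin r|)) * Q A ∧
      Q A ≤ ENNReal.ofReal (Real.exp (K * |Real.sin r|)) * Q (hφ.move r ⁻¹' A) := by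
  obtain ⟨K, hK0, hK⟩ := hφ.exists_orderedDirichlet_shiftPi
  refine ⟨β + 1 + K, by positivity, fun r => ?_⟩
  have hsum : ∀ n : ℕ, ∑ _i : Fin (n + 1), β / ((n : ℝ) + 1) = β := fun n => by
    rw [Finset.sum_const, Finset.card_univ, Fintype.card_fin, nsmul_eq_mul]
    push_cast
    field_simp
  have hfin : ∀ (n : ℕ) (B : Set (Fin n → ℝ)), MeasurableSet B →
      Q (hφ.move r ⁻¹' (sample n ⁻¹' B)) ≤
        ENNReal.ofReal (Real.exp ((β + 1 + K) * |Real.sin r|)) * Q (sample n ⁻¹' B) ∧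
      Q (sample n ⁻¹' B) ≤ ENNReal.ofReal (Real.exp ((β + 1 + K) * |Real.sin r|)) *
        Q (hφ.move r ⁻¹' (sample n ⁻¹' B)) := fun n B hB => by
    have hpre : hφ.move r ⁻¹' (sample n ⁻¹' B) = sample n ⁻¹' (shiftPi φ (Real.sin r) ⁻¹' B) := rfl
    have := hK n (fun _ => β / ((n : ℝ) + 1)) (fun _ => by positivity) (Real.sin r)
      (Real.abs_sin_le_one r) B hB
    rw [hsum] at this
    rw [hpre, ← Measure.map_apply (measurable_sample n) hB,
      ← Measure.map_apply (measurable_sample n) (hφ.measurable_shiftPi _ hB), hQ.map_sample]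
    exact this
  have hm := hφ.measurable_move r
  have : IsProbabilityMeasure (Q.map (hφ.move r)) := Measure.isProbabilityMeasure_map hm.aemeasurable
  have huniv : Set.univ ∈ dyadicSets := ⟨0, Set.univ, .univ, by simp⟩
  have hdm : ∀ A ∈ dyadicSets, MeasurableSet A := by
    rintro _ ⟨m, B, hB, rfl⟩
    exact measurable_sample _ hB
  refine fun A hA => ⟨?_, ?_⟩ <;> rw [← Measure.map_apply hm hA]
  · refine measure_le_of_isSetRing isSetRing_dyadicSets huniv generateFrom_dyadicSets
      ENNReal.ofReal_ne_top (fun A hA => ?_) hA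
    rw [Measure.map_apply hm (hdm A hA)]
    obtain ⟨m, B, hB, rfl⟩ := hA
    exact (hfin _ B hB).1
  · refine measure_le_of_isSetRing isSetRing_dyadicSets huniv generateFrom_dyadicSets
      ENNReal.ofReal_ne_top (fun A hA => ?_) hA
    rw [Measure.map_apply hm (hdm A hA)]
    obtain ⟨m, B, hB, rfl⟩ := hA
    exact (hfin _ B hB).2

end Quantile

/-! ### Cylinder functions -/

section Cylinder

theorem integrable_Lp_leb (f : Lp ℝ 2 leb) : Integrable f leb :=
  (Lp.memLp f).integrable one_le_two

theorem integrable_mul_bounded {f : I → ℝ} (hf : Integrable f leb) {h : I → ℝ} (hh : Measurable h)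
    {B : ℝ} (hB : ∀ t, |h t| ≤ B) : Integrable (fun t => f t * h t) leb :=
  hf.mul_bdd (c := B) hh.aestronglyMeasurable (Eventually.of_forall hB)

theorem abs_integral_mul_le {f : I → ℝ} (hf : Integrable f leb) {h : I → ℝ} {B : ℝ}
    (hB : ∀ t, |h t| ≤ B) : |∫ t, f t * h t ∂leb| ≤ B * ∫ t, |f t| ∂leb := by
  rw [← integral_const_mul]
  refine (norm_integral_le_integral_norm _).trans (integral_mono_of_nonneg
    (Eventually.of_forall fun _ => norm_nonneg (_ : ℝ)) (hf.norm.const_mul B)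
    (Eventually.of_forall fun t => ?_))
  simp only [Real.norm_eq_abs, abs_mul]
  rw [mul_comm]
  exact mul_le_mul_of_nonneg_right (hB t) (abs_nonneg _)

theorem abs_le_one_G (g : G) (t : I) : |g.1 t| ≤ 1 :=
  abs_le.2 ⟨by linarith [(g.2.2.1 t).1], (g.2.2.1 t).2⟩

theorem abs_pairing_le (f : Lp ℝ 2 leb) (g : G) : |pairing f g| ≤ ∫ t, |f t| ∂leb := by
  have := abs_integral_mul_le (integrable_Lp_leb f) (abs_le_one_G g)
  rwa [one_mul] at this

theorem measurable_integral_mul_comp (f : Lp ℝ 2 leb) {ψ : ℝ → ℝ} (hψ : Measurable ψ) :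
    Measurable fun g : G => ∫ t, f t * ψ (g.1 t) ∂leb := by
  obtain ⟨f', hf', hff'⟩ := Lp.aestronglyMeasurable f
  have : (fun g : G => ∫ t, f t * ψ (g.1 t) ∂leb) = fun g => ∫ t, f' t * ψ (g.1 t) ∂leb := by
    funext g
    refine integral_congr_ae ?_
    filter_upwards [hff'] with t ht
    rw [ht]
  rw [this]
  have hm : Measurable fun p : G × I => f' p.2 * ψ (p.1.1 p.2) :=
    (hf'.measurable.comp measurable_snd).mul (hψ.comp measurable_uncurry_eval)
  exact (hm.stronglyMeasurable.integral_prod_right).measurable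

theorem measurable_pairing (f : Lp ℝ 2 leb) : Measurable (pairing f) :=
  measurable_integral_mul_comp f measurable_id

theorem tendsto_smoothTransition_nat_mul (y : ℝ) :
    Tendsto (fun n : ℕ => Real.smoothTransition (n * y)) atTop (𝓝 (if 0 < y then 1 else 0)) := by
  split_ifs with hy
  · refine tendsto_const_nhds.congr' ?_
    obtain ⟨n₀, hn₀⟩ := exists_nat_gt (1 / y)
    filter_upwards [eventually_ge_atTop n₀] with n hn
    refine (Real.smoothTransition.one_of_one_le ?_).symm
    have h1 : 1 / y < n := hn₀.trans_le (by exact_mod_cast hn)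
    rw [div_lt_iff₀ hy] at h1
    exact h1.le
  · refine tendsto_const_nhds.congr fun n => ?_
    exact (Real.smoothTransition.zero_of_nonpos
      (mul_nonpos_of_nonneg_of_nonpos (Nat.cast_nonneg n) (not_lt.1 hy))).symm

/-- The factor `χ` only provides compact support: it equals one on the region `|x i| ≤ R`, to which
the values of bounded functionals are confined. -/
theorem exists_tendsto_indicator_box {m : ℕ} (c : Fin m → ℝ) (R : ℝ) (hR : 0 ≤ R) :
    ∃ U : ℕ → (Fin m → ℝ) → ℝ, (∀ n, ContDiff ℝ 1 (U n) ∧ HasCompactSupport (U n) ∧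
      ∀ x, |U n x| ≤ 1) ∧ ∀ x, (∀ i, |x i| ≤ R) →
        Tendsto (fun n => U n x) atTop (𝓝 (if ∀ i, x i < c i then 1 else 0)) := by
  let χ : ContDiffBump (0 : Fin m → ℝ) := ⟨R + 1, R + 2, by linarith, by linarith⟩
  refine ⟨fun n x => χ x * ∏ i, Real.smoothTransition (n * (c i - x i)), fun n => ⟨?_, ?_, ?_⟩, ?_⟩
  · refine χ.contDiff.mul (contDiff_prod fun i _ => Real.smoothTransition.contDiff.comp ?_)
    exact contDiff_const.mul (contDiff_const.sub (contDiff_apply ℝ ℝ i))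
  · exact χ.hasCompactSupport.mul_right
  · intro x
    rw [abs_mul, Finset.abs_prod]
    refine mul_le_one₀ ?_ (Finset.prod_nonneg fun i _ => abs_nonneg _)
      (Finset.prod_le_one (fun i _ => abs_nonneg _) fun i _ => ?_)
    · rw [abs_of_nonneg χ.nonneg]; exact χ.le_one
    · rw [abs_of_nonneg (Real.smoothTransition.nonneg _)]; exact Real.smoothTransition.le_one _
  · intro x hx
    have hχ : χ x = 1 := by
      refine χ.one_of_mem_closedBall ?_
      rw [mem_closedBall_zero_iff]
      refine ((pi_norm_le_iff_of_nonneg hR).2 hx).trans ?_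
      change R ≤ R + 1
      linarith
    simp only [hχ, one_mul]
    have h := tendsto_finsetProd Finset.univ fun i _ =>
      tendsto_smoothTransition_nat_mul (c i - x i)
    refine h.trans (le_of_eq (congrArg 𝓝 ?_))
    rw [Finset.prod_ite_zero]
    simp

/-- Sets `{l_{f_1} < c_1, …, l_{f_m} < c_m}`. -/
def pairingSets : Set (Set G) :=
  {A | ∃ (m : ℕ) (f : Fin m → Lp ℝ 2 leb) (c : Fin m → ℝ), A = {g | ∀ i, pairing (f i) g < c i}}

theorem measurableSet_of_mem_pairingSets {A : Set G} (hA : A ∈ pairingSets) : MeasurableSet A := by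
  obtain ⟨m, f, c, rfl⟩ := hA
  have : {g | ∀ i, pairing (f i) g < c i} = ⋂ i, {g | pairing (f i) g < c i} := by
    ext; simp
  rw [this]
  exact .iInter fun i => measurableSet_lt (measurable_pairing _) measurable_const

theorem isPiSystem_pairingSets : IsPiSystem pairingSets := by
  rintro _ ⟨m, f, c, rfl⟩ _ ⟨m', f', c', rfl⟩ -
  refine ⟨m + m', Fin.append f f', Fin.append c c', ?_⟩
  ext g
  simp only [Set.mem_inter_iff, Set.mem_ofPred_eq]
  constructor
  · rintro ⟨h1, h2⟩ i
    refine Fin.addCases (fun i => ?_) (fun i => ?_) i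
    · simpa using h1 i
    · simpa using h2 i
  · intro h
    exact ⟨fun i => by simpa using h (Fin.castAdd m' i), fun i => by simpa using h (Fin.natAdd m i)⟩

theorem leb_preimage (S : Set ℝ) : leb (Subtype.val ⁻¹' S) = volume (S ∩ Set.Ico 0 1) := by
  rw [leb, comap_subtype_coe_apply measurableSet_Ico, Subtype.image_preimage_coe, Set.inter_comm]

theorem leb_Ico (s t : I) : leb (Set.Ico s t) = ENNReal.ofReal (t - s) := by
  have : Set.Ico s t = Subtype.val ⁻¹' Set.Ico (s : ℝ) t := rfl
  rw [this, leb_preimage, Set.inter_eq_left.2, Real.volume_Ico]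
  exact fun x hx => ⟨s.2.1.trans hx.1, hx.2.trans t.2.2⟩

theorem pairing_indicatorConstLp {A : Set I} (hA : MeasurableSet A) (c : ℝ) (g : G) :
    pairing (indicatorConstLp 2 hA (measure_ne_top leb A) c) g = c * ∫ t in A, g.1 t ∂leb := by
  rw [pairing, ← integral_const_mul, ← integral_indicator hA]
  refine integral_congr_ae ?_
  filter_upwards [indicatorConstLp_coeFn (p := 2) (hs := hA) (hμs := measure_ne_top leb A) (c := c)]
    with t ht
  rw [ht]
  by_cases h : t ∈ A <;> simp [h]

theorem integrable_coe_G (g : G) : Integrable g.1 leb :=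
  Integrable.of_bound (measurable_coe_G g).aestronglyMeasurable 1
    (Eventually.of_forall (abs_le_one_G g))

/-- An evaluation is not a pairing with an `L²` function, but it is a limit of averages over `[t, s
n)`, which are squeezed between `g t` and `g (s n)`. -/
theorem exists_tendsto_pairing (t : I) : ∃ f : ℕ → Lp ℝ 2 leb, ∀ g : G,
    Tendsto (fun n => pairing (f n) g) atTop (𝓝 (g.1 t)) := by
  have ht := t.2
  set s : ℕ → I := fun n => ⟨t + (1 - t) / ((n : ℝ) + 2), by
    have : 0 ≤ (1 - (t : ℝ)) / ((n : ℝ) + 2) := div_nonneg (by linarith [ht.2]) (by positivity)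
    linarith [ht.1], by
    have : (1 - (t : ℝ)) / ((n : ℝ) + 2) < 1 - t := by
      refine div_lt_self (by linarith [ht.2]) ?_
      have : (0 : ℝ) ≤ n := Nat.cast_nonneg n
      linarith
    linarith⟩ with hs
  have hts : ∀ n, (t : ℝ) < s n := fun n => by
    have : 0 < (1 - (t : ℝ)) / ((n : ℝ) + 2) := div_pos (by linarith [ht.2]) (by positivity)
    simp only [hs]; linarith
  have hlim : Tendsto s atTop (𝓝 t) := by
    rw [tendsto_subtype_rng]
    have h1 : Tendsto (fun n : ℕ => (n : ℝ) + 2) atTop atTop :=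
      tendsto_atTop_add_const_right _ _ tendsto_natCast_atTop_atTop
    have h2 := (h1.const_div_atTop (1 - (t : ℝ))).const_add (t : ℝ)
    rw [add_zero] at h2
    exact h2
  have hpos : ∀ n, 0 < leb.real (Set.Ico t (s n)) := fun n => by
    rw [Measure.real, leb_Ico, ENNReal.toReal_ofReal (by linarith [hts n])]
    linarith [hts n]
  refine ⟨fun n => indicatorConstLp 2 (measurableSet_Ico (a := t) (b := s n))
    (measure_ne_top leb _) (leb.real (Set.Ico t (s n)))⁻¹, fun g => ?_⟩
  have hg : Tendsto (fun n => g.1 (s n)) atTop (𝓝 (g.1 t)) :=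
    (g.2.2.2 t).tendsto.comp
      (tendsto_nhdsWithin_iff.2 ⟨hlim, Eventually.of_forall fun n => (hts n).le⟩)
  refine tendsto_of_tendsto_of_tendsto_of_le_of_le tendsto_const_nhds hg (fun n => ?_) fun n => ?_
  · simp only [pairing_indicatorConstLp]
    rw [← div_eq_inv_mul, le_div_iff₀ (hpos n)]
    have := setIntegral_mono_on (μ := leb) (s := Set.Ico t (s n)) (f := fun _ => g.1 t) (g := g.1)
      (integrable_const _).integrableOn (integrable_coe_G g).integrableOn measurableSet_Ico
      fun x hx => g.2.1 hx.1
    rwa [setIntegral_const, smul_eq_mul, mul_comm] at this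
  · simp only [pairing_indicatorConstLp]
    rw [← div_eq_inv_mul, div_le_iff₀ (hpos n)]
    have := setIntegral_mono_on (μ := leb) (s := Set.Ico t (s n)) (f := g.1) (g := fun _ => g.1 (s n))
      (integrable_coe_G g).integrableOn (integrable_const _).integrableOn measurableSet_Ico
      fun x hx => g.2.1 hx.2.le
    rwa [setIntegral_const, smul_eq_mul, mul_comm] at this

theorem generateFrom_pairingSets :
    (inferInstance : MeasurableSpace G) = MeasurableSpace.generateFrom pairingSets := by
  refine generateFrom_G (fun A hA => measurableSet_of_mem_pairingSets hA) fun t => ?_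
  obtain ⟨f, hf⟩ := exists_tendsto_pairing t
  refine @measurable_of_tendsto_metrizable G ℝ (MeasurableSpace.generateFrom pairingSets) _ _ _ _
    (fun n g => pairing (f n) g) _ (fun n => ?_) (tendsto_pi_nhds.2 hf)
  refine @measurable_of_Iio ℝ G _ _ _ (MeasurableSpace.generateFrom pairingSets) _ _ _ _ fun c => ?_
  refine MeasurableSpace.measurableSet_generateFrom ⟨1, fun _ => f n, fun _ => c, ?_⟩
  ext g; simp

variable {Q : Measure G}

/-- Integrable functions which are orthogonal to all cylinder functions vanish. -/
theorem ae_eq_zero_of_cylinder [IsFiniteMeasure Q] {F : G → ℝ} (hF : Integrable F Q)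
    (h : ∀ (m : ℕ) (f : Fin m → Lp ℝ 2 leb) (U : (Fin m → ℝ) → ℝ), ContDiff ℝ 1 U →
      HasCompactSupport U → ∫ g, F g * U (fun i => pairing (f i) g) ∂Q = 0) : F =ᵐ[Q] 0 := by
  have hS : ∀ A ∈ pairingSets, ∫ g in A, F g ∂Q = 0 := by
    intro A hA
    have hAm := measurableSet_of_mem_pairingSets hA
    obtain ⟨m, f, c, rfl⟩ := hA
    obtain ⟨U, hU, hlim⟩ := exists_tendsto_indicator_box c (∑ i, ∫ t, |f i t| ∂leb)
      (Finset.sum_nonneg fun i _ => integral_nonneg fun t => abs_nonneg _)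
    have hbd : ∀ g i, |pairing (f i) g| ≤ ∑ i, ∫ t, |f i t| ∂leb := fun g i =>
      (abs_pairing_le (f i) g).trans (Finset.single_le_sum (f := fun i => ∫ t, |f i t| ∂leb)
        (fun i _ => integral_nonneg fun t => abs_nonneg _) (Finset.mem_univ i))
    have hmeas : Measurable fun g i => pairing (f i) g :=
      measurable_pi_lambda _ fun i => measurable_pairing (f i)
    have := tendsto_integral_of_dominated_convergence (μ := Q)
      (F := fun n g => F g * U n fun i => pairing (f i) g)
      (f := fun g => F g * if ∀ i, pairing (f i) g < c i then 1 else 0) (fun g => |F g|)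
      (fun n => hF.1.mul
        (((hU n).1.continuous.measurable.comp hmeas).aestronglyMeasurable)) hF.abs
      (fun n => Eventually.of_forall fun g => ?_)
      (Eventually.of_forall fun g => (hlim _ (hbd g)).const_mul _)
    · simp only [h m f _ (hU _).1 (hU _).2.1] at this
      rw [← integral_indicator hAm]
      refine (integral_congr_ae (Eventually.of_forall fun g => ?_)).trans
        (tendsto_nhds_unique this tendsto_const_nhds)
      by_cases hg : ∀ i, pairing (f i) g < c i <;> simp [hg, Set.indicator]
    · rw [norm_mul]
      exact mul_le_of_le_one_right (abs_nonneg _) ((hU n).2.2 _)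
  refine ae_eq_zero_of_generateFrom hF pairingSets generateFrom_pairingSets isPiSystem_pairingSets
    ?_ hS
  rw [← setIntegral_univ]
  exact hS _ ⟨0, fun i => i.elim0, fun i => i.elim0, by ext; simp⟩

/-- For fixed `B` the function `g ↦ ∫ F(g, t) 1_B(t) dt` is orthogonal to all cylinder functions and
hence vanishes; rectangles generate the product σ-algebra. -/
theorem ae_eq_zero_of_cylinder_prod [IsFiniteMeasure Q] {F : G × I → ℝ}
    (hF : Integrable F (Q.prod leb))
    (h : ∀ (m : ℕ) (f : Fin m → Lp ℝ 2 leb) (U : (Fin m → ℝ) → ℝ) (B : Set I), ContDiff ℝ 1 U →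
      HasCompactSupport U → MeasurableSet B →
        ∫ p, F p * (U (fun i => pairing (f i) p.1) * B.indicator 1 p.2) ∂Q.prod leb = 0) :
    F =ᵐ[Q.prod leb] 0 := by
  have hS : ∀ A ∈ Set.image2 (fun (s : Set G) (t : Set I) => s ×ˢ t) {s | MeasurableSet s}
      {t | MeasurableSet t}, ∫ p in A, F p ∂Q.prod leb = 0 := by
    rintro _ ⟨A, hA, B, hB, rfl⟩
    have hA' : MeasurableSet A := hA
    have hB' : MeasurableSet B := hB
    have hFB : Integrable (fun p : G × I => F p * B.indicator 1 p.2) (Q.prod leb) := by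
      refine hF.mul_bdd (c := 1) ?_ (Eventually.of_forall fun p => ?_)
      · exact ((measurable_one.indicator hB').comp measurable_snd).aestronglyMeasurable
      · by_cases hp : p.2 ∈ B <;> simp [hp]
    have hz : (fun g => ∫ t, F (g, t) * B.indicator 1 t ∂leb) =ᵐ[Q] 0 := by
      refine ae_eq_zero_of_cylinder hFB.integral_prod_left fun m f U hU hUc => ?_
      refine Eq.trans ?_ (h m f U B hU hUc hB')
      obtain ⟨M, hM⟩ := hUc.exists_bound_of_continuous hU.continuous
      rw [integral_prod]
      · refine integral_congr_ae (Eventually.of_forall fun g => ?_)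
        simp only [← integral_mul_const]
        refine integral_congr_ae (Eventually.of_forall fun t => ?_)
        simp only; ring
      · have : (fun p : G × I => F p * (U (fun i => pairing (f i) p.1) * B.indicator 1 p.2)) =
            fun p => (F p * B.indicator 1 p.2) * U (fun i => pairing (f i) p.1) := by
          funext p; ring
        rw [this]
        refine hFB.mul_bdd (c := M) ?_ (Eventually.of_forall fun p => hM _)
        exact (hU.continuous.measurable.comp (measurable_pi_lambda _ fun i =>
          (measurable_pairing (f i)).comp measurable_fst)).aestronglyMeasurable
    rw [setIntegral_prod _ hF.integrableOn]
    refine setIntegral_eq_zero_of_ae_eq_zero ?_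
    filter_upwards [hz] with g hg _
    rw [Pi.zero_apply] at hg
    refine Eq.trans ?_ hg
    rw [← integral_indicator hB']
    refine integral_congr_ae (Eventually.of_forall fun t => ?_)
    by_cases ht : t ∈ B <;> simp [ht]
  refine ae_eq_zero_of_generateFrom hF _ generateFrom_prod.symm isPiSystem_prod ?_ hS
  rw [← setIntegral_univ]
  exact hS _ ⟨Set.univ, by simp, Set.univ, by simp,
    Set.univ_prod_univ⟩

end Cylinder

/-! ### Operators associated with perturbations -/

/-- A vector field on `[0,1]` together with a bound for the change of the measure `Q` under the
perturbations that it generates. -/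
structure Flow (Q : Measure G) where
  vel : ℝ → ℝ
  isVelocity : IsVelocity vel
  rate : ℝ
  rate_nonneg : 0 ≤ rate
  bound : ∀ r A, MeasurableSet A →
    Q (isVelocity.move r ⁻¹' A) ≤ ENNReal.ofReal (Real.exp (rate * |Real.sin r|)) * Q A ∧
    Q A ≤ ENNReal.ofReal (Real.exp (rate * |Real.sin r|)) * Q (isVelocity.move r ⁻¹' A)

theorem IsVelocity.exists_flow {φ : ℝ → ℝ} (hφ : IsVelocity φ) {β : ℝ} (hβ : 0 < β) {Q : Measure G}
    [IsProbabilityMeasure Q] (hQ : IsDirichletProcessLaw β Q) : ∃ V : Flow Q, V.vel = φ := by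
  obtain ⟨K, hK0, hK⟩ := hφ.exists_move_bound hβ hQ
  exact ⟨⟨φ, hφ, K, hK0, hK⟩, rfl⟩

theorem IsVelocity.abs_le {φ : ℝ → ℝ} (hφ : IsVelocity φ) {x : ℝ} (hx : x ∈ Set.Icc (0 : ℝ) 1) :
    |φ x| ≤ 1 := by
  have := hφ.shift_mem (a := 1) (by simp) hx
  have h2 := hφ.shift_mem (a := -1) (by simp) hx
  unfold shift at this h2
  rw [_root_.abs_le]
  constructor <;> linarith [this.1, this.2, h2.1, h2.2, hx.1, hx.2]

section Operators

variable {Q : Measure G}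

namespace Flow

/-- The perturbation of quantile functions. -/
def move (V : Flow Q) (r : ℝ) : G → G := V.isVelocity.move r

theorem measurable_move (V : Flow Q) (r : ℝ) : Measurable (V.move r) :=
  V.isVelocity.measurable_move r

theorem move_apply (V : Flow Q) (r : ℝ) (g : G) (t : I) :
    (V.move r g).1 t = g.1 t + Real.sin r * V.vel (g.1 t) := rfl

theorem move_zero (V : Flow Q) (g : G) : V.move 0 g = g := V.isVelocity.move_zero g

theorem continuous_vel (V : Flow Q) : Continuous V.vel := V.isVelocity.contDiff.continuous

theorem abs_vel_le (V : Flow Q) (g : G) (t : I) : |V.vel (g.1 t)| ≤ 1 :=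
  V.isVelocity.abs_le (g.2.2.1 t)

theorem map_move_le_exp (V : Flow Q) (r : ℝ) :
    Q.map (V.move r) ≤ (Real.exp (V.rate * |Real.sin r|)).toNNReal • Q := by
  refine Measure.le_intro fun A hA _ => ?_
  rw [Measure.map_apply (V.measurable_move r) hA]
  exact (V.bound r A hA).1

theorem le_map_move_exp (V : Flow Q) (r : ℝ) :
    Q ≤ (Real.exp (V.rate * |Real.sin r|)).toNNReal • Q.map (V.move r) := by
  refine Measure.le_intro fun A hA _ => ?_
  rw [Measure.smul_apply, Measure.map_apply (V.measurable_move r) hA]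
  exact (V.bound r A hA).2

/-- A uniform bound for the change of measure. -/
def const (V : Flow Q) : NNReal := (Real.exp V.rate).toNNReal

theorem map_move_le (V : Flow Q) (r : ℝ) : Q.map (V.move r) ≤ V.const • Q := by
  refine Measure.le_intro fun A hA _ => (V.map_move_le_exp r A).trans ?_
  change (_ : ℝ≥0∞) * _ ≤ (_ : ℝ≥0∞) * _
  refine mul_le_mul_left (ENNReal.coe_le_coe.2 (Real.toNNReal_le_toNNReal
    (Real.exp_le_exp.2 ?_))) _
  exact mul_le_of_le_one_right V.rate_nonneg (Real.abs_sin_le_one r)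

/-- The perturbation acting on the first component. -/
def moveProd (V : Flow Q) (r : ℝ) : G × I → G × I := Prod.map (V.move r) id

theorem measurable_moveProd (V : Flow Q) (r : ℝ) : Measurable (V.moveProd r) :=
  (V.measurable_move r).prodMap measurable_id

theorem map_moveProd_le [IsProbabilityMeasure Q] (V : Flow Q) (r : ℝ) :
    (Q.prod leb).map (V.moveProd r) ≤ V.const • Q.prod leb := by
  rw [moveProd, ← Measure.map_prod_map _ _ (V.measurable_move r) measurable_id, Measure.map_id]
  refine (Measure.prod_mono (V.map_move_le r) le_rfl).trans ?_
  rw [show V.const • Q = (V.const : ℝ≥0∞) • Q from rfl, Measure.prod_smul_left]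
  rfl

/-- Composition with the perturbation, on `L²(Q)`. -/
def T (V : Flow Q) (r : ℝ) : Lp ℝ 2 Q →L[ℝ] Lp ℝ 2 Q :=
  compL (V.move r) (V.measurable_move r) V.const (V.map_move_le r)

theorem T_zero (V : Flow Q) (u : Lp ℝ 2 Q) : V.T 0 u = u := by
  refine Lp.ext ?_
  filter_upwards [compL_coeFn (V.move 0) (V.measurable_move 0) V.const (V.map_move_le 0) u] with g hg
  rw [T, hg, V.move_zero]

theorem measurable_weight (V : Flow Q) : Measurable fun p : G × I => V.vel (p.1.1 p.2) :=
  V.continuous_vel.measurable.comp measurable_uncurry_eval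

theorem pairing_move (V : Flow Q) (r : ℝ) (f : Lp ℝ 2 leb) (g : G) :
    pairing f (V.move r g) = pairing f g + Real.sin r * ∫ t, f t * V.vel (g.1 t) ∂leb := by
  have hf := integrable_Lp_leb f
  have h1 := integrable_mul_bounded hf (measurable_coe_G g) (abs_le_one_G g)
  have h2 : Integrable (fun t => f t * V.vel (g.1 t)) leb :=
    integrable_mul_bounded hf (V.continuous_vel.measurable.comp (measurable_coe_G g))
    (V.abs_vel_le g)
  simp only [pairing, V.move_apply, mul_add]
  rw [← integral_const_mul, ← integral_add h1 (h2.const_mul _)]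
  refine integral_congr_ae (Eventually.of_forall fun t => ?_)
  simp only
  ring

variable [IsProbabilityMeasure Q]

/-- Composition with the perturbation, on `L²(Q ⊗ leb)`. -/
def S (V : Flow Q) (r : ℝ) : Lp ℝ 2 (Q.prod leb) →L[ℝ] Lp ℝ 2 (Q.prod leb) :=
  compL (V.moveProd r) (V.measurable_moveProd r) V.const (V.map_moveProd_le r)

theorem norm_S_le (V : Flow Q) (r : ℝ) (ξ : Lp ℝ 2 (Q.prod leb)) :
    ‖V.S r ξ‖ ≤ Real.sqrt V.const * ‖ξ‖ := norm_compL_le _ _ _ _ _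

end Flow

variable [IsProbabilityMeasure Q]

/-- The operator `v ↦ v ⊗ m`. -/
def J (Q : Measure G) [IsProbabilityMeasure Q] (m : G × I → ℝ) (hm : Measurable m) (B : ℝ)
    (hB : ∀ p, |m p| ≤ B) : Lp ℝ 2 Q →L[ℝ] Lp ℝ 2 (Q.prod leb) :=
  (mulL m hm B hB).comp
    (Lp.compMeasurePreservingₗᵢ ℝ Prod.fst (measurePreserving_fst (μ := Q) (ν := leb))).toContinuousLinearMap

theorem J_coeFn (m : G × I → ℝ) (hm : Measurable m) (B : ℝ) (hB : ∀ p, |m p| ≤ B) (v : Lp ℝ 2 Q) :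
    J Q m hm B hB v =ᵐ[Q.prod leb] fun p => m p * v p.1 := by
  refine (mulL_coeFn m hm B hB _).trans ?_
  filter_upwards [Lp.coeFn_compMeasurePreserving v (measurePreserving_fst (μ := Q) (ν := leb))]
    with p hp
  exact congrArg (m p * ·) hp

/-- The operator `ξ ↦ ∫ ξ(·, t) m(·, t) dt`. -/
def P (Q : Measure G) [IsProbabilityMeasure Q] (m : G × I → ℝ) (hm : Measurable m) (B : ℝ)
    (hB : ∀ p, |m p| ≤ B) : Lp ℝ 2 (Q.prod leb) →L[ℝ] Lp ℝ 2 Q :=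
  ContinuousLinearMap.adjoint (J Q m hm B hB)

theorem inner_P (m : G × I → ℝ) (hm : Measurable m) (B : ℝ) (hB : ∀ p, |m p| ≤ B) (v : Lp ℝ 2 Q)
    (ξ : Lp ℝ 2 (Q.prod leb)) :
    (inner ℝ (P Q m hm B hB ξ) v : ℝ) = inner ℝ ξ (J Q m hm B hB v) :=
  ContinuousLinearMap.adjoint_inner_left _ _ _

theorem integrable_bounded_mul_Lp (m : G × I → ℝ) (hm : Measurable m) (B : ℝ) (hB : ∀ p, |m p| ≤ B)
    (ξ : Lp ℝ 2 (Q.prod leb)) : Integrable (fun p => ξ p * m p) (Q.prod leb) :=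
  ((Lp.memLp ξ).integrable one_le_two).mul_bdd (c := B) hm.aestronglyMeasurable
    (Eventually.of_forall hB)

theorem P_coeFn (m : G × I → ℝ) (hm : Measurable m) (B : ℝ) (hB : ∀ p, |m p| ≤ B)
    (ξ : Lp ℝ 2 (Q.prod leb)) : P Q m hm B hB ξ =ᵐ[Q] fun g => ∫ t, ξ (g, t) * m (g, t) ∂leb := by
  have hint := integrable_bounded_mul_Lp m hm B hB ξ
  refine Integrable.ae_eq_of_forall_setIntegral_eq _ _ ((Lp.memLp _).integrable one_le_two)
    hint.integral_prod_left fun A hA _ => ?_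
  rw [← L2.inner_indicatorConstLp_one hA (measure_ne_top Q A), real_inner_comm, inner_P,
    L2.inner_def, ← integral_indicator hA]
  have h1 : ∫ p, (inner ℝ (ξ p) (J Q m hm B hB (indicatorConstLp 2 hA (measure_ne_top Q A) 1) p) : ℝ)
      ∂Q.prod leb = ∫ p, A.indicator 1 p.1 * (ξ p * m p) ∂Q.prod leb := by
    refine integral_congr_ae ?_
    filter_upwards [J_coeFn m hm B hB (indicatorConstLp 2 hA (measure_ne_top Q A) 1),
      (Measure.quasiMeasurePreserving_fst (μ := Q) (ν := leb)).ae
        (indicatorConstLp_coeFn (p := 2) (hs := hA) (hμs := measure_ne_top Q A) (c := (1 : ℝ)))]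
      with p h1 h2
    rw [h1, h2]
    by_cases hp : p.1 ∈ A <;> simp [hp, mul_comm]
  rw [h1, integral_prod]
  · refine integral_congr_ae (Eventually.of_forall fun g => ?_)
    by_cases hg : g ∈ A <;> simp [hg]
  · refine (hint.bdd_mul (c := 1) (f := fun p : G × I => A.indicator 1 p.1) ?_
      (Eventually.of_forall fun p => ?_))
    · exact ((measurable_one.indicator hA).comp measurable_fst).aestronglyMeasurable
    · by_cases hp : p.1 ∈ A <;> simp [hp]

namespace Flow

/-- The directional derivative `ξ ↦ ∫ ξ(·, t) φ(g(t)) dt`. -/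
def D (V : Flow Q) : Lp ℝ 2 (Q.prod leb) →L[ℝ] Lp ℝ 2 Q :=
  P Q (fun p => V.vel (p.1.1 p.2)) V.measurable_weight 1 fun p => V.abs_vel_le p.1 p.2

theorem continuous_S (V : Flow Q) (ξ : Lp ℝ 2 (Q.prod leb)) : Continuous fun r => V.S r ξ := by
  let W : Submodule ℝ (Lp ℝ 2 (Q.prod leb)) :=
    { carrier := {ξ | Continuous fun r => V.S r ξ}
      add_mem' := fun {a b} ha hb => by
        have ha' : Continuous fun r => V.S r a := ha
        have hb' : Continuous fun r => V.S r b := hb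
        change Continuous fun r => V.S r (a + b)
        simp only [map_add]
        exact ha'.add hb'
      zero_mem' := by
        change Continuous fun r => V.S r 0
        simpa only [map_zero] using continuous_const
      smul_mem' := fun c a ha => by
        have ha' : Continuous fun r => V.S r a := ha
        change Continuous fun r => V.S r (c • a)
        simp only [map_smul]
        exact ha'.const_smul c }
  have hWc : IsClosed (W : Set (Lp ℝ 2 (Q.prod leb))) := by
    rw [← closure_subset_iff_isClosed]
    intro a ha
    change Continuous fun r => V.S r a
    refine continuous_of_uniform_approx_of_continuous fun u hu => ?_
    obtain ⟨ε, hε, hεu⟩ := Metric.mem_uniformity_dist.1 hu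
    have hc : 0 < Real.sqrt V.const + 1 := by positivity
    obtain ⟨b, hb, hab⟩ := Metric.mem_closure_iff.1 ha (ε / (Real.sqrt V.const + 1)) (by positivity)
    refine ⟨fun r => V.S r b, hb, fun r => hεu ?_⟩
    rw [dist_eq_norm, ← map_sub]
    rw [dist_eq_norm, lt_div_iff₀ hc] at hab
    refine (V.norm_S_le r _).trans_lt (lt_of_le_of_lt ?_ hab)
    nlinarith [norm_nonneg (a - b)]
  have hW : W = ⊤ := by
    rw [← hWc.submodule_topologicalClosure_eq, Submodule.topologicalClosure_eq_top_iff,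
      Submodule.eq_bot_iff]
    intro η hη
    rw [Submodule.mem_orthogonal] at hη
    have h0 : η =ᵐ[Q.prod leb] 0 := by
      refine ae_eq_zero_of_cylinder_prod ((Lp.memLp η).integrable one_le_two)
        fun m f U B hU hUc hB => ?_
      obtain ⟨M, hM⟩ := hUc.exists_bound_of_continuous hU.continuous
      have hM0 : 0 ≤ M := (norm_nonneg _).trans (hM 0)
      let c : ℝ → G × I → ℝ := fun r p =>
        U (fun i => pairing (f i) (V.move r p.1)) * B.indicator 1 p.2
      have hind : ∀ t, |B.indicator (1 : I → ℝ) t| ≤ 1 := fun t => by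
        by_cases ht : t ∈ B <;> simp [ht]
      have hcM : ∀ r p, |c r p| ≤ M := fun r p => by
        rw [abs_mul]
        exact (mul_le_mul (hM _) (hind _) (abs_nonneg _) hM0).trans (mul_one M).le
      have hcm : ∀ r, Measurable (c r) := fun r =>
        (hU.continuous.measurable.comp (measurable_pi_lambda _ fun i => (measurable_pairing (f i)).comp
          ((V.measurable_move r).comp measurable_fst))).mul
          ((measurable_one.indicator hB).comp measurable_snd)
      have hc : ∀ r, MemLp (c r) 2 (Q.prod leb) := fun r =>
        MemLp.of_bound (hcm r).aestronglyMeasurable M (Eventually.of_forall (hcM r))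
      have hcont : ∀ p, Continuous fun r => c r p := fun p => by
        refine (hU.continuous.comp (continuous_pi fun i => ?_)).mul continuous_const
        simp only [V.pairing_move]
        exact continuous_const.add (Real.continuous_sin.mul continuous_const)
      have hmem : (hc 0).toLp ∈ W := by
        change Continuous fun r => V.S r (hc 0).toLp
        have : ∀ r, V.S r (hc 0).toLp = (hc r).toLp := fun r =>
          compL_toLp _ _ _ _ (hc 0) (hc r) fun p => by
            simp only [c, moveProd, Prod.map_fst, Prod.map_snd, V.move_zero, id]
        simp only [this]
        exact continuous_iff_continuousAt.2 fun r => tendsto_toLp_of_dominated hc (hc r)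
          (memLp_const M) (Eventually.of_forall fun s => Eventually.of_forall (hcM s))
          (Eventually.of_forall (hcM r)) (Eventually.of_forall fun p => (hcont p).tendsto r)
      refine Eq.trans ?_ (hη _ hmem)
      rw [L2.inner_def]
      refine integral_congr_ae ?_
      filter_upwards [(hc 0).coeFn_toLp] with p hp
      rw [hp]
      simp [c, V.move_zero, mul_comm]
    exact Lp.eq_zero_iff_ae_eq_zero.2 h0
  have : ξ ∈ W := hW ▸ Submodule.mem_top
  exact this

theorem continuous_cos_smul_S (V : Flow Q) (ξ : Lp ℝ 2 (Q.prod leb)) :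
    Continuous fun r => Real.cos r • V.S r ξ :=
  Real.continuous_cos.smul (V.continuous_S ξ)

/-- The integrated composition operator `∫₀ˢ cos r • ξ ∘ τ_r dr`. -/
def B (V : Flow Q) (s : ℝ) : Lp ℝ 2 (Q.prod leb) →L[ℝ] Lp ℝ 2 (Q.prod leb) :=
  LinearMap.mkContinuous
    { toFun := fun ξ => ∫ r in (0 : ℝ)..s, Real.cos r • V.S r ξ
      map_add' := fun ξ η => by
        rw [← intervalIntegral.integral_add ((V.continuous_cos_smul_S ξ).intervalIntegrable _ _)
          ((V.continuous_cos_smul_S η).intervalIntegrable _ _)]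
        simp only [map_add, smul_add]
      map_smul' := fun c ξ => by
        rw [RingHom.id_apply, ← intervalIntegral.integral_smul]
        simp only [map_smul, smul_comm c] }
    (Real.sqrt V.const * |s|) (fun ξ => by
      have := intervalIntegral.norm_integral_le_of_norm_le_const (a := 0) (b := s)
        (f := fun r => Real.cos r • V.S r ξ) (C := Real.sqrt V.const * ‖ξ‖) fun r _ => by
          rw [norm_smul]
          calc ‖Real.cos r‖ * ‖V.S r ξ‖ ≤ 1 * (Real.sqrt V.const * ‖ξ‖) :=
                mul_le_mul (Real.abs_cos_le_one r) (V.norm_S_le r ξ) (norm_nonneg _) zero_le_one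
            _ = _ := one_mul _
      rw [sub_zero] at this
      refine this.trans (le_of_eq ?_)
      ring)

theorem B_apply (V : Flow Q) (s : ℝ) (ξ : Lp ℝ 2 (Q.prod leb)) :
    V.B s ξ = ∫ r in (0 : ℝ)..s, Real.cos r • V.S r ξ := rfl

theorem map_B (V : Flow Q) (L : Lp ℝ 2 (Q.prod leb) →L[ℝ] Lp ℝ 2 Q) (s : ℝ)
    (ξ : Lp ℝ 2 (Q.prod leb)) :
    L (V.B s ξ) = ∫ r in (0 : ℝ)..s, Real.cos r • L (V.S r ξ) := by
  rw [B_apply, ← ContinuousLinearMap.intervalIntegral_comp_comm _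
    ((V.continuous_cos_smul_S ξ).intervalIntegrable _ _)]
  simp only [map_smul]

theorem S_zero (V : Flow Q) (ξ : Lp ℝ 2 (Q.prod leb)) : V.S 0 ξ = ξ := by
  refine Lp.ext ?_
  filter_upwards [compL_coeFn (V.moveProd 0) (V.measurable_moveProd 0) V.const
    (V.map_moveProd_le 0) ξ] with p hp
  rw [S, hp, moveProd, Prod.map_apply, V.move_zero, id]

/-- The integrated form of differentiability along a perturbation is equivalent to
differentiability. -/
theorem hasDerivAt_T_iff (V : Flow Q) (L : Lp ℝ 2 (Q.prod leb) →L[ℝ] Lp ℝ 2 Q) (u : Lp ℝ 2 Q)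
    (ξ : Lp ℝ 2 (Q.prod leb)) : (∀ s, V.T s u - u = L (V.B s ξ)) ↔
      ∀ r, HasDerivAt (fun r => V.T r u) (Real.cos r • L (V.S r ξ)) r := by
  have hcont : Continuous fun r => Real.cos r • L (V.S r ξ) :=
    Real.continuous_cos.smul (L.continuous.comp (V.continuous_S ξ))
  constructor
  · intro h r
    have h1 : (fun r => V.T r u) = fun r => u + ∫ r in (0 : ℝ)..r, Real.cos r • L (V.S r ξ) := by
      funext s
      rw [← map_B, ← h s]; abel
    rw [h1]
    exact (hcont.integral_hasStrictDerivAt 0 r).hasDerivAt.const_add u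
  · intro h s
    rw [map_B, intervalIntegral.integral_eq_sub_of_hasDerivAt (fun r _ => h r)
      (hcont.intervalIntegrable _ _), V.T_zero]

end Flow

/-- Pairs `(u, ξ)` such that `ξ` is the gradient of `u` along all perturbations. -/
def gradGraph (Q : Measure G) [IsProbabilityMeasure Q] :
    Submodule ℝ (Lp ℝ 2 Q × Lp ℝ 2 (Q.prod leb)) where
  carrier := {p | ∀ (V : Flow Q) (s : ℝ), V.T s p.1 - p.1 = V.D (V.B s p.2)}
  add_mem' := fun {a b} ha hb V s => by
    have h1 := ha V s
    have h2 := hb V s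
    simp only [Prod.fst_add, Prod.snd_add, map_add, ← h1, ← h2]
    abel
  zero_mem' := fun V s => by simp
  smul_mem' := fun c a ha V s => by
    have h1 := ha V s
    simp only [Prod.smul_fst, Prod.smul_snd, map_smul, ← h1, smul_sub]

/-- Closedness is immediate because the defining identity is integrated in time: both sides are
bounded operators applied to `u` and `ξ`. -/
theorem isClosed_gradGraph :
    IsClosed (gradGraph Q : Set (Lp ℝ 2 Q × Lp ℝ 2 (Q.prod leb))) := by
  have : (gradGraph Q : Set (Lp ℝ 2 Q × Lp ℝ 2 (Q.prod leb))) =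
      ⋂ (V : Flow Q) (s : ℝ), {p | V.T s p.1 - p.1 = V.D (V.B s p.2)} := by
    ext p
    simp only [Set.mem_iInter]
    rfl
  rw [this]
  refine isClosed_iInter fun V => isClosed_iInter fun s => isClosed_eq ?_ ?_
  · exact ((V.T s).continuous.comp continuous_fst).sub continuous_fst
  · exact (V.D.continuous.comp (V.B s).continuous).comp continuous_snd

end Operators

/-! ### Smooth functions along perturbations -/

section Smooth

theorem clm_pi_apply {m : ℕ} (L : (Fin m → ℝ) →L[ℝ] ℝ) (v : Fin m → ℝ) :
    L v = ∑ i, L (Pi.single i 1) * v i := by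
  have h : v = ∑ i, v i • (Pi.single i (1 : ℝ) : Fin m → ℝ) := by
    ext j
    simp [Finset.sum_apply, Pi.single_apply]
  conv_lhs => rw [h]
  simp [mul_comm]

theorem abs_clm_single_le {m : ℕ} (L : (Fin m → ℝ) →L[ℝ] ℝ) (i : Fin m) :
    |L (Pi.single i 1)| ≤ ‖L‖ := by
  refine (L.le_opNorm _).trans (mul_le_of_le_one_right (norm_nonneg _) ?_)
  refine (pi_norm_le_iff_of_nonneg zero_le_one).2 fun j => ?_
  by_cases h : j = i
  · subst h; simp
  · simp [h]

variable {Q : Measure G}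

theorem Flow.hasDerivAt_pairing_move (V : Flow Q) (f : Lp ℝ 2 leb) (r : ℝ) (g : G) :
    HasDerivAt (fun r => pairing f (V.move r g))
      (Real.cos r * ∫ t, f t * V.vel (g.1 t) ∂leb) r := by
  simp only [V.pairing_move]
  exact ((Real.hasDerivAt_sin r).mul_const _).const_add _

theorem measurable_integral_comp {φ : ℝ → ℝ} (hφ : Measurable φ) :
    Measurable fun g : G => ∫ t, φ (g.1 t) ∂leb := by
  have h : Measurable fun p : G × I => φ (p.1.1 p.2) := hφ.comp measurable_uncurry_eval
  exact h.stronglyMeasurable.integral_prod_right.measurable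

theorem Flow.hasDerivAt_integral_move (V : Flow Q) {φ : ℝ → ℝ} (hφ : ContDiff ℝ 1 φ) {M : ℝ}
    (hM : ∀ x, |deriv φ x| ≤ M) (r : ℝ) (g : G) :
    HasDerivAt (fun r => ∫ t, φ ((V.move r g).1 t) ∂leb)
      (Real.cos r * ∫ t, deriv φ ((V.move r g).1 t) * V.vel (g.1 t) ∂leb) r := by
  have hφc := hφ.continuous
  have hφ'c := hφ.continuous_deriv le_rfl
  have hm : ∀ r, Measurable (V.move r g).1 := fun r => measurable_coe_G _
  obtain ⟨C, hC⟩ := (isCompact_Icc (a := (0 : ℝ)) (b := 1)).exists_bound_of_continuousOn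
    hφc.continuousOn
  have hM0 : 0 ≤ M := (abs_nonneg _).trans (hM 0)
  rw [← integral_const_mul]
  refine (hasDerivAt_integral_of_dominated_loc_of_deriv_le (μ := leb)
    (F := fun r t => φ ((V.move r g).1 t))
    (F' := fun r t => Real.cos r * (deriv φ ((V.move r g).1 t) * V.vel (g.1 t)))
    (bound := fun _ => M) (s := Set.univ) univ_mem ?_ ?_ ?_ ?_ (integrable_const M) ?_).2
  · exact Eventually.of_forall fun r => (hφc.measurable.comp (hm r)).aestronglyMeasurable
  · exact Integrable.of_bound (hφc.measurable.comp (hm r)).aestronglyMeasurable C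
      (Eventually.of_forall fun t => hC _ ((V.move r g).2.2.1 t))
  · exact (((hφ'c.measurable.comp (hm r)).mul
      (V.continuous_vel.measurable.comp (measurable_coe_G g))).const_mul _).aestronglyMeasurable
  · refine Eventually.of_forall fun t s _ => ?_
    rw [norm_mul, norm_mul]
    calc ‖Real.cos s‖ * (‖deriv φ ((V.move s g).1 t)‖ * ‖V.vel (g.1 t)‖) ≤ 1 * (M * 1) :=
          mul_le_mul (Real.abs_cos_le_one s)
            (mul_le_mul (hM _) (V.abs_vel_le g t) (norm_nonneg _) hM0)
            (mul_nonneg (norm_nonneg _) (norm_nonneg _)) zero_le_one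
      _ = M := by ring
  · refine Eventually.of_forall fun t s _ => ?_
    have h1 : HasDerivAt (fun s => (V.move s g).1 t) (Real.cos s * V.vel (g.1 t)) s := by
      simp only [V.move_apply]
      exact ((Real.hasDerivAt_sin s).mul_const _).const_add _
    have h2 := ((hφ.differentiable one_ne_zero) ((V.move s g).1 t)).hasDerivAt.comp s h1
    refine h2.congr_deriv ?_
    ring

variable [IsProbabilityMeasure Q] {m : ℕ} {ψ : Fin m → G → ℝ}
  {h : Fin m → G × I → ℝ} {b : Fin m → I → ℝ} {U : (Fin m → ℝ) → ℝ} {M MU : ℝ}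

theorem measurable_fderiv_comp (hψ : ∀ i, Measurable (ψ i)) (hU : ContDiff ℝ 1 U) (i : Fin m) :
    Measurable fun g => fderiv ℝ U (fun j => ψ j g) (Pi.single i 1) :=
  ((hU.continuous_fderiv one_ne_zero).clm_apply continuous_const).measurable.comp
    (measurable_pi_lambda _ hψ)

theorem memLp_gradient (hψ : ∀ i, Measurable (ψ i)) (hh : ∀ i, Measurable (h i))
    (hb : ∀ i, MemLp (b i) 2 leb) (hhb : ∀ i p, |h i p| ≤ b i p.2) (hU : ContDiff ℝ 1 U)
    (hM : ∀ g, ‖fderiv ℝ U fun j => ψ j g‖ ≤ M) :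
    MemLp (fun p : G × I => ∑ i, fderiv ℝ U (fun j => ψ j p.1) (Pi.single i 1) * h i p) 2
      (Q.prod leb) := by
  refine memLp_finsetSum _ fun i _ => ?_
  refine MemLp.of_le_mul (c := M) ((hb i).comp_measurePreserving
    (measurePreserving_snd (μ := Q) (ν := leb))) ?_ (Eventually.of_forall fun p => ?_)
  · exact (((measurable_fderiv_comp hψ hU i).comp measurable_fst).mul (hh i)).aestronglyMeasurable
  · rw [norm_mul]
    have hM0 : 0 ≤ M := (norm_nonneg _).trans (hM p.1)
    exact mul_le_mul ((abs_clm_single_le _ _).trans (hM p.1))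
      ((hhb i p).trans (le_abs_self _)) (norm_nonneg _) hM0

theorem memLp_comp_of_bound (hψ : ∀ i, Measurable (ψ i)) (hU : ContDiff ℝ 1 U)
    (hMU : ∀ g, |U fun j => ψ j g| ≤ MU) : MemLp (fun g => U fun j => ψ j g) 2 Q :=
  MemLp.of_bound (hU.continuous.measurable.comp (measurable_pi_lambda _ hψ)).aestronglyMeasurable MU
    (Eventually.of_forall hMU)

/-- The chain rule along a perturbation. -/
theorem Flow.hasDerivAt_T_of_smooth (V : Flow Q) (w : G × I → ℝ) (hw : Measurable w) (B : ℝ)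
    (hB : ∀ p, |w p| ≤ B) (hψ : ∀ i, Measurable (ψ i)) (hh : ∀ i, Measurable (h i))
    (hb : ∀ i, MemLp (b i) 2 leb) (hhb : ∀ i p, |h i p| ≤ b i p.2)
    (hd : ∀ i r g, HasDerivAt (fun r => ψ i (V.move r g))
      (Real.cos r * ∫ t, h i (V.move r g, t) * w (g, t) ∂leb) r)
    (hU : ContDiff ℝ 1 U) (hM : ∀ g, ‖fderiv ℝ U fun j => ψ j g‖ ≤ M)
    (hMU : ∀ g, |U fun j => ψ j g| ≤ MU) {u : Lp ℝ 2 Q} (hu : u =ᵐ[Q] fun g => U fun j => ψ j g)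
    {ξ : Lp ℝ 2 (Q.prod leb)} (hξ : ξ =ᵐ[Q.prod leb] fun p =>
      ∑ i, fderiv ℝ U (fun j => ψ j p.1) (Pi.single i 1) * h i p) (r : ℝ) :
    HasDerivAt (fun r => V.T r u) (Real.cos r • P Q w hw B hB (V.S r ξ)) r := by
  -- The weight `w` is independent of the velocity of `V` so that the same computation covers both
  -- the exact velocity `φ(g(t))` and its discretization at the grid points.
  have hbi : ∀ i, Integrable (b i) leb := fun i => (hb i).integrable one_le_two
  have hint : ∀ i r g, Integrable (fun t => h i (V.move r g, t) * w (g, t)) leb := fun i r g => by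
    refine Integrable.mul_bdd (c := B) ?_ ?_ (Eventually.of_forall fun t => hB _)
    · exact (hbi i).mono' ((hh i).comp (measurable_const.prodMk measurable_id)).aestronglyMeasurable
        (Eventually.of_forall fun t => hhb i _)
    · exact (hw.comp (measurable_const.prodMk measurable_id)).aestronglyMeasurable
  have hbound : ∀ i r g, |∫ t, h i (V.move r g, t) * w (g, t) ∂leb| ≤ B * ∫ t, b i t ∂leb := by
    intro i r g
    rw [← integral_const_mul]
    refine (norm_integral_le_integral_norm _).trans (integral_mono_of_nonneg
      (Eventually.of_forall fun _ => norm_nonneg (_ : ℝ)) ((hbi i).const_mul B)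
      (Eventually.of_forall fun t => ?_))
    simp only [norm_mul, Real.norm_eq_abs]
    rw [mul_comm]
    exact mul_le_mul (hB _) (hhb i _) (abs_nonneg _) ((abs_nonneg _).trans (hB (g, t)))
  let c : ℝ → G → ℝ := fun r g => U fun j => ψ j (V.move r g)
  let c' : ℝ → G → ℝ := fun r g => ∑ i, fderiv ℝ U (fun j => ψ j (V.move r g)) (Pi.single i 1) *
    (Real.cos r * ∫ t, h i (V.move r g, t) * w (g, t) ∂leb)
  have hc : ∀ r, MemLp (c r) 2 Q := fun r => memLp_comp_of_bound (ψ := fun j g => ψ j (V.move r g))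
    (fun i => (hψ i).comp (V.measurable_move r)) hU fun g => hMU _
  have hc'M : ∀ r g, |c' r g| ≤ ∑ i, M * (B * ∫ t, b i t ∂leb) := fun r g => by
    have hM0 : 0 ≤ M := (norm_nonneg _).trans (hM g)
    refine (Finset.abs_sum_le_sum_abs _ _).trans (Finset.sum_le_sum fun i _ => ?_)
    rw [abs_mul, abs_mul]
    refine mul_le_mul ((abs_clm_single_le _ _).trans (hM _)) ?_
      (mul_nonneg (abs_nonneg _) (abs_nonneg _)) hM0
    exact (mul_le_of_le_one_left (abs_nonneg _) (Real.abs_cos_le_one r)).trans (hbound i r g)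
  have hintm : ∀ i r, Measurable fun g => ∫ t, h i (V.move r g, t) * w (g, t) ∂leb := fun i r => by
    have : Measurable fun p : G × I => h i (V.move r p.1, p.2) * w (p.1, p.2) :=
      ((hh i).comp (((V.measurable_move r).comp measurable_fst).prodMk measurable_snd)).mul hw
    exact this.stronglyMeasurable.integral_prod_right.measurable
  have hc' : ∀ r, MemLp (c' r) 2 Q := fun r => by
    refine MemLp.of_bound (Measurable.aestronglyMeasurable ?_) _ (Eventually.of_forall (hc'M r))
    refine Finset.measurable_fun_sum _ fun i _ => Measurable.mul ?_ ((hintm i r).const_mul _)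
    exact (measurable_fderiv_comp hψ hU i).comp (V.measurable_move r)
  have hder : ∀ g r, HasDerivAt (fun r => c r g) (c' r g) r := fun g r => by
    have h1 := ((hU.differentiable one_ne_zero) fun j => ψ j (V.move r g)).hasFDerivAt.comp_hasDerivAt r
      (hasDerivAt_pi.2 fun i => hd i r g)
    rw [clm_pi_apply] at h1
    exact h1
  have key := hasDerivAt_toLp hc hc' hder hc'M r
  have h1 : (fun r => V.T r u) = fun r => (hc r).toLp := by
    funext r
    have hu' : u = (hc 0).toLp := by
      refine Lp.ext ?_
      filter_upwards [hu, (hc 0).coeFn_toLp] with g h1 h2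
      rw [h1, h2]
      simp only [c, V.move_zero]
    rw [hu']
    exact compL_toLp _ _ _ _ (hc 0) (hc r) fun g => by simp only [c, V.move_zero]
  have h2 : Real.cos r • P Q w hw B hB (V.S r ξ) = (hc' r).toLp := by
    have hS : V.S r ξ =ᵐ[Q.prod leb] fun p => ∑ i, fderiv ℝ U (fun j => ψ j (V.move r p.1))
        (Pi.single i 1) * h i (V.move r p.1, p.2) :=
      (compL_coeFn _ (V.measurable_moveProd r) _ (V.map_moveProd_le r) ξ).trans
        ((quasiMeasurePreserving_of_map_le (V.measurable_moveProd r) (V.map_moveProd_le r)).ae hξ)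
    refine Lp.ext ?_
    filter_upwards [Lp.coeFn_smul (Real.cos r) (P Q w hw B hB (V.S r ξ)), (hc' r).coeFn_toLp,
      P_coeFn w hw B hB (V.S r ξ), Measure.ae_ae_of_ae_prod hS] with g h1 h2 h3 h4
    rw [h1, h2, Pi.smul_apply, h3]
    have h5 : ∫ t, V.S r ξ (g, t) * w (g, t) ∂leb = ∑ i, fderiv ℝ U (fun j => ψ j (V.move r g))
        (Pi.single i 1) * ∫ t, h i (V.move r g, t) * w (g, t) ∂leb := by
      simp only [← integral_const_mul]
      rw [← integral_finsetSum _ fun i _ => (hint i r g).const_mul _]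
      refine integral_congr_ae ?_
      filter_upwards [h4] with t ht
      rw [ht, Finset.sum_mul]
      exact Finset.sum_congr rfl fun i _ => mul_assoc _ _ _
    rw [h5, smul_eq_mul, Finset.mul_sum]
    exact Finset.sum_congr rfl fun i _ => mul_left_comm _ _ _
  rw [h1, h2]
  exact key

/-- Common source for two kinds of cylinder functions: `h i` is `fᵢ(t)` for the pairings and
`φᵢ'(g(t))` for the functionals `∫ φᵢ(g(t)) dt`. -/
theorem mem_gradGraph_of_smooth (hψ : ∀ i, Measurable (ψ i)) (hh : ∀ i, Measurable (h i))
    (hb : ∀ i, MemLp (b i) 2 leb) (hhb : ∀ i p, |h i p| ≤ b i p.2)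
    (hd : ∀ (V : Flow Q) i r g, HasDerivAt (fun r => ψ i (V.move r g))
      (Real.cos r * ∫ t, h i (V.move r g, t) * V.vel (g.1 t) ∂leb) r)
    (hU : ContDiff ℝ 1 U) (hM : ∀ g, ‖fderiv ℝ U fun j => ψ j g‖ ≤ M)
    (hMU : ∀ g, |U fun j => ψ j g| ≤ MU) {u : Lp ℝ 2 Q} (hu : u =ᵐ[Q] fun g => U fun j => ψ j g)
    {ξ : Lp ℝ 2 (Q.prod leb)} (hξ : ξ =ᵐ[Q.prod leb] fun p =>
      ∑ i, fderiv ℝ U (fun j => ψ j p.1) (Pi.single i 1) * h i p) : (u, ξ) ∈ gradGraph Q :=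
  fun V => (V.hasDerivAt_T_iff V.D u ξ).2 fun r =>
    V.hasDerivAt_T_of_smooth _ V.measurable_weight 1 (fun p => V.abs_vel_le p.1 p.2) hψ hh hb hhb
      (hd V) hU hM hMU hu hξ r

theorem exists_fderiv_bound {m : ℕ} {U : (Fin m → ℝ) → ℝ} (hU : ContDiff ℝ 1 U)
    (hUc : HasCompactSupport U) : ∃ M, ∀ x, ‖fderiv ℝ U x‖ ≤ M :=
  (hUc.fderiv (𝕜 := ℝ)).exists_bound_of_continuous (hU.continuous_fderiv one_ne_zero)

theorem mem_gradGraph_of_mem_wassersteinGraph {p : Lp ℝ 2 Q × Lp ℝ 2 (Q.prod leb)}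
    (hp : p ∈ wassersteinGraph Q) : p ∈ gradGraph Q := by
  obtain ⟨m, f, U, hU, hUc, hu, hξ⟩ := hp
  obtain ⟨M, hM⟩ := exists_fderiv_bound hU hUc
  obtain ⟨MU, hMU⟩ := hUc.exists_bound_of_continuous hU.continuous
  exact mem_gradGraph_of_smooth (ψ := fun i => pairing (f i)) (h := fun i p => f i p.2)
    (b := fun i t => |f i t|) (fun i => measurable_pairing (f i))
    (fun i => (Lp.stronglyMeasurable (f i)).measurable.comp measurable_snd)
    (fun i => (Lp.memLp (f i)).abs) (fun i p => le_rfl)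
    (fun V i r g => V.hasDerivAt_pairing_move (f i) r g) hU (fun g => hM _) (fun g => hMU _) hu hξ

/-- Together with `gradGraph_unique` this contains the closability of the Wasserstein form. -/
theorem closure_wassersteinGraph_subset : closure (wassersteinGraph Q) ⊆ gradGraph Q :=
  closure_minimal (fun _ hp => mem_gradGraph_of_mem_wassersteinGraph hp) isClosed_gradGraph

theorem exists_mem_wassersteinGraph {m : ℕ} (f : Fin m → Lp ℝ 2 leb) {U : (Fin m → ℝ) → ℝ}
    (hU : ContDiff ℝ 1 U) (hUc : HasCompactSupport U) : ∃ p ∈ wassersteinGraph Q,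
      p.1 =ᵐ[Q] fun g => U fun i => pairing (f i) g := by
  obtain ⟨M, hM⟩ := exists_fderiv_bound hU hUc
  obtain ⟨MU, hMU⟩ := hUc.exists_bound_of_continuous hU.continuous
  have h1 := memLp_comp_of_bound (Q := Q) (ψ := fun i => pairing (f i))
    (fun i => measurable_pairing (f i)) hU fun g => hMU _
  have h2 := memLp_gradient (Q := Q) (ψ := fun i => pairing (f i)) (h := fun i p => f i p.2)
    (b := fun i t => |f i t|) (fun i => measurable_pairing (f i))
    (fun i => (Lp.stronglyMeasurable (f i)).measurable.comp measurable_snd)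
    (fun i => (Lp.memLp (f i)).abs) (fun i p => le_rfl) hU fun g => hM _
  exact ⟨(h1.toLp, h2.toLp), ⟨m, f, U, hU, hUc, h1.coeFn_toLp, h2.coeFn_toLp⟩, h1.coeFn_toLp⟩

/-- A vector orthogonal to the cylinder functions vanishes. -/
theorem eq_zero_of_inner_wassersteinGraph {v : Lp ℝ 2 Q}
    (hv : ∀ p ∈ wassersteinGraph Q, (inner ℝ v p.1 : ℝ) = 0) : v = 0 := by
  rw [Lp.eq_zero_iff_ae_eq_zero]
  refine ae_eq_zero_of_cylinder ((Lp.memLp v).integrable one_le_two) fun m f U hU hUc => ?_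
  obtain ⟨p, hp, hpU⟩ := exists_mem_wassersteinGraph (Q := Q) f hU hUc
  refine Eq.trans ?_ (hv p hp)
  rw [L2.inner_def]
  refine integral_congr_ae ?_
  filter_upwards [hpU] with g hg
  rw [hg]
  simp [mul_comm]

end Smooth

/-! ### Uniqueness of the gradient -/

section Uniqueness

theorem exists_isVelocity_const_mul {φ : ℝ → ℝ} (hφ : ContDiff ℝ 2 φ) (h0 : φ 0 = 0) (h1 : φ 1 = 0) :
    ∃ κ : ℝ, 0 < κ ∧ IsVelocity fun x => κ * φ x := by
  obtain ⟨M, hM⟩ := (isCompact_Icc (a := (0 : ℝ)) (b := 1)).exists_bound_of_continuousOn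
    (hφ.continuous_deriv one_le_two).continuousOn
  have hM0 : 0 ≤ M := (norm_nonneg _).trans (hM 0 (by simp))
  refine ⟨1 / (2 * (M + 1)), by positivity, contDiff_const.mul hφ, by simp [h0], by simp [h1],
    fun x hx => ?_⟩
  rw [deriv_const_mul _ (hφ.differentiable two_ne_zero x), abs_mul, abs_of_pos (by positivity),
    div_mul_eq_mul_div, one_mul, div_le_div_iff₀ (by positivity) (by norm_num)]
  have := hM x hx
  rw [Real.norm_eq_abs] at this
  linarith

/-- Smooth approximations of the indicator function of `(0, c)`. -/
def bump (c : ℝ) (n : ℕ) (x : ℝ) : ℝ :=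
  Real.smoothTransition (n * x) * Real.smoothTransition (n * (c - x))

theorem contDiff_bump (c : ℝ) (n : ℕ) : ContDiff ℝ 2 (bump c n) :=
  (Real.smoothTransition.contDiff.comp (contDiff_const.mul contDiff_id)).mul
    (Real.smoothTransition.contDiff.comp (contDiff_const.mul (contDiff_const.sub contDiff_id)))

theorem abs_bump_le (c : ℝ) (n : ℕ) (x : ℝ) : |bump c n x| ≤ 1 := by
  rw [bump, abs_of_nonneg (mul_nonneg (Real.smoothTransition.nonneg _)
    (Real.smoothTransition.nonneg _))]
  exact mul_le_one₀ (Real.smoothTransition.le_one _) (Real.smoothTransition.nonneg _)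
    (Real.smoothTransition.le_one _)

theorem bump_zero (c : ℝ) (n : ℕ) : bump c n 0 = 0 := by simp [bump]

theorem bump_one {c : ℝ} (hc : c ≤ 1) (n : ℕ) : bump c n 1 = 0 := by
  rw [bump, Real.smoothTransition.zero_of_nonpos (x := n * (c - 1)), mul_zero]
  exact mul_nonpos_of_nonneg_of_nonpos (Nat.cast_nonneg n) (by linarith)

theorem tendsto_bump (c x : ℝ) : Tendsto (fun n => bump c n x) atTop
    (𝓝 ((Set.Ioo 0 c).indicator 1 x)) := by
  have := (tendsto_smoothTransition_nat_mul x).mul (tendsto_smoothTransition_nat_mul (c - x))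
  refine this.trans (le_of_eq (congrArg 𝓝 ?_))
  by_cases h1 : 0 < x <;> by_cases h2 : x < c <;> simp [h1, h2]

/-- In the limit the bumps give `∫ f = 0` over `{0 < g < c}`. For strictly increasing `g` the level
`c = g a` cuts out the interval left of `a` up to the null set `{0}`, and these intervals generate.
Only rational `c` are assumed, so that countably many test functions suffice; the other levels
follow by approximation from below. -/
theorem ae_eq_zero_of_integral_bump {g : G} (hg : StrictMono g.1) {f : I → ℝ}
    (hf : Integrable f leb)
    (h : ∀ c : ℚ, (c : ℝ) ≤ 1 → ∀ n, ∫ t, f t * bump c n (g.1 t) ∂leb = 0) : f =ᵐ[leb] 0 := by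
  have hgm := measurable_coe_G g
  have hnn : ∀ t, 0 ≤ g.1 t := fun t => (g.2.2.1 t).1
  have h1 : ∀ c : ℚ, (c : ℝ) ≤ 1 →
      ∫ t, f t * (Set.Ioo (0 : ℝ) c).indicator 1 (g.1 t) ∂leb = 0 := by
    intro c hc
    have := tendsto_integral_of_dominated_convergence (μ := leb)
      (F := fun n t => f t * bump c n (g.1 t))
      (f := fun t => f t * (Set.Ioo (0 : ℝ) c).indicator 1 (g.1 t)) (fun t => |f t|)
      (fun n => hf.1.mul ((contDiff_bump c n).continuous.measurable.comp hgm).aestronglyMeasurable)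
      hf.abs (fun n => Eventually.of_forall fun t => ?_)
      (Eventually.of_forall fun t => (tendsto_bump _ _).const_mul _)
    · simp only [h c hc] at this
      exact (tendsto_nhds_unique this tendsto_const_nhds)
    · rw [norm_mul]
      exact mul_le_of_le_one_right (norm_nonneg _) (abs_bump_le _ _ _)
  have h2 : ∀ b : ℝ, b ≤ 1 → ∫ t, f t * (Set.Ioo (0 : ℝ) b).indicator 1 (g.1 t) ∂leb = 0 := by
    intro b hb
    obtain ⟨c, hc, hcb⟩ : ∃ c : ℕ → ℚ, (∀ n, (c n : ℝ) < b) ∧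
        Tendsto (fun n => (c n : ℝ)) atTop (𝓝 b) := by
      have hex : ∀ n : ℕ, ∃ c : ℚ, b - 1 / ((n : ℝ) + 1) < c ∧ (c : ℝ) < b := fun n =>
        exists_rat_btwn (by
          have : 0 < 1 / ((n : ℝ) + 1) := by positivity
          linarith)
      choose c hc1 hc2 using hex
      refine ⟨c, hc2, tendsto_of_tendsto_of_tendsto_of_le_of_le (g := fun n : ℕ =>
        b - 1 / ((n : ℝ) + 1)) ?_ tendsto_const_nhds (fun n => (hc1 n).le) fun n => (hc2 n).le⟩
      simpa using tendsto_one_div_add_atTop_nhds_zero_nat.const_sub b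
    have := tendsto_integral_of_dominated_convergence (μ := leb)
      (F := fun n t => f t * (Set.Ioo (0 : ℝ) (c n)).indicator 1 (g.1 t))
      (f := fun t => f t * (Set.Ioo (0 : ℝ) b).indicator 1 (g.1 t)) (fun t => |f t|)
      (fun n => hf.1.mul ((measurable_one.indicator measurableSet_Ioo).comp hgm).aestronglyMeasurable)
      hf.abs (fun n => Eventually.of_forall fun t => ?_)
      (Eventually.of_forall fun t => Tendsto.const_mul _ ?_)
    · simp only [h1 _ ((hc _).le.trans hb)] at this
      exact (tendsto_nhds_unique this tendsto_const_nhds)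
    · rw [norm_mul]
      refine mul_le_of_le_one_right (norm_nonneg _) ?_
      by_cases ht : g.1 t ∈ Set.Ioo (0 : ℝ) (c n) <;> simp [ht]
    · refine tendsto_const_nhds.congr' ?_
      by_cases ht : g.1 t < b
      · filter_upwards [hcb.eventually (lt_mem_nhds ht)] with n hn
        simp [Set.indicator, ht, hn]
      · refine Eventually.of_forall fun n => ?_
        have : ¬ g.1 t < c n := fun h => ht (h.trans (hc n))
        simp [Set.indicator, ht, this]
  have hz : ∀ t : I, t ≠ ⟨0, by simp⟩ → 0 < g.1 t := fun t ht => by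
    refine (hnn ⟨0, by simp⟩).trans_lt (hg ?_)
    exact lt_of_le_of_ne (show (⟨0, by simp⟩ : I) ≤ t from t.2.1) ht.symm
  have hnull : ∀ᵐ t ∂leb, t ≠ (⟨0, by simp⟩ : I) := by
    have : leb {(⟨0, by simp⟩ : I)} = 0 := by
      rw [leb, comap_subtype_coe_apply measurableSet_Ico]
      simp
    rw [ae_iff]
    simpa using this
  have h3 : ∀ (A : Set I) (b : ℝ), MeasurableSet A → b ≤ 1 → (∀ t, t ∈ A ↔ g.1 t < b) →
      ∫ t in A, f t ∂leb = 0 := by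
    intro A b hA hb hAb
    refine Eq.trans ?_ (h2 b hb)
    rw [← integral_indicator hA]
    refine integral_congr_ae ?_
    filter_upwards [hnull] with t ht
    by_cases htA : t ∈ A
    · simp [Set.indicator, htA, (hAb t).1 htA, hz t ht]
    · have : ¬ g.1 t < b := fun h => htA ((hAb t).2 h)
      simp [Set.indicator, htA, not_lt.1 this]
  refine ae_eq_zero_of_generateFrom hf (Set.range Set.Iio) ?_ isPiSystem_Iio ?_ ?_
  · rw [← borel_eq_generateFrom_Iio]
    exact BorelSpace.measurable_eq
  · rw [← setIntegral_univ]
    -- A strictly increasing `g` with values in `[0,1]` stays below 1 on `[0,1)`, so the level 1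
    -- gives the whole interval.
    refine h3 _ 1 .univ le_rfl fun t => ⟨fun _ => ?_, fun _ => trivial⟩
    have ht := t.2
    refine (hg (show t < ⟨((t : ℝ) + 1) / 2, by constructor <;> linarith [ht.1, ht.2]⟩ from ?_)).trans_le
      (g.2.2.1 _).2
    change (t : ℝ) < ((t : ℝ) + 1) / 2
    linarith [ht.2]
  · rintro _ ⟨a, rfl⟩
    exact h3 _ (g.1 a) measurableSet_Iio (g.2.2.1 a).2 fun t => hg.lt_iff_lt.symm

variable {β : ℝ} {Q : Measure G}

/-- Two evaluations have a joint density, so they coincide with probability zero. A monotone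
function that is strictly increasing on the rationals of `(0,1)` is strictly increasing. -/
theorem IsDirichletProcessLaw.ae_strictMono (hQ : IsDirichletProcessLaw β Q) :
    ∀ᵐ g ∂Q, StrictMono g.1 := by
  have key : ∀ p q : {p : ℚ // (p : ℝ) ∈ Set.Ico (0 : ℝ) 1}, 0 < (p.1 : ℝ) → (p.1 : ℝ) < q.1 →
      ∀ᵐ g ∂Q, g.1 ⟨p.1, p.2⟩ < g.1 ⟨q.1, q.2⟩ := by
    intro p q hp hpq
    have h := hQ 2 ![⟨p.1, p.2⟩, ⟨q.1, q.2⟩] (fun i j hij => ?_) (fun i => ?_)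
    · have hnull : orderedDirichlet (fun i => β * gap (fun j => ((![⟨p.1, p.2⟩, ⟨q.1, q.2⟩] :
          Fin 2 → I) j : ℝ)) i) {x | x 0 = x 1} = 0 := by
        refine (withDensity_absolutelyContinuous _ _).trans Measure.absolutelyContinuous_restrict ?_
        have hE : {x : Fin 2 → ℝ | x 0 = x 1} = (LinearMap.ker
          (LinearMap.proj (R := ℝ) (φ := fun _ : Fin 2 => ℝ) 0 - LinearMap.proj 1) : Set _) := by
          ext x
          simp [sub_eq_zero]
        rw [hE]
        refine Measure.addHaar_submodule _ _ fun htop => ?_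
        have : (![1, 0] : Fin 2 → ℝ) ∈ LinearMap.ker
          (LinearMap.proj (R := ℝ) (φ := fun _ : Fin 2 => ℝ) 0 - LinearMap.proj 1) :=
          htop ▸ Submodule.mem_top
        simp at this
      have hm : Measurable fun (g : G) (i : Fin 2) => g.1 ((![⟨p.1, p.2⟩, ⟨q.1, q.2⟩] :
          Fin 2 → I) i) := measurable_pi_lambda _ fun i => measurable_eval _
      rw [← h, Measure.map_apply hm (measurableSet_eq_fun (measurable_pi_apply 0)
        (measurable_pi_apply 1))] at hnull
      have hne : ∀ᵐ g ∂Q, ¬ g.1 ⟨p.1, p.2⟩ = g.1 ⟨q.1, q.2⟩ := by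
        rw [ae_iff]
        simpa using hnull
      filter_upwards [hne] with g hg
      exact lt_of_le_of_ne (g.2.1 (show (⟨p.1, p.2⟩ : I) ≤ ⟨q.1, q.2⟩ from hpq.le)) hg
    · fin_cases i <;> fin_cases j <;> simp at hij ⊢
      exact_mod_cast hpq
    · fin_cases i
      · exact hp
      · exact hp.trans hpq
  have hall : ∀ᵐ g ∂Q, ∀ p q : {p : ℚ // (p : ℝ) ∈ Set.Ico (0 : ℝ) 1}, 0 < (p.1 : ℝ) →
      (p.1 : ℝ) < q.1 → g.1 ⟨p.1, p.2⟩ < g.1 ⟨q.1, q.2⟩ := by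
    simp only [ae_all_iff]
    exact key
  filter_upwards [hall] with g hg s t hst
  obtain ⟨p, hsp, hpt⟩ := exists_rat_btwn (show (s : ℝ) < t from hst)
  obtain ⟨q, hpq, hqt⟩ := exists_rat_btwn hpt
  have hs := s.2
  have ht := t.2
  have hp : (p : ℝ) ∈ Set.Ico (0 : ℝ) 1 := ⟨hs.1.trans hsp.le, hpt.trans ht.2⟩
  have hq : (q : ℝ) ∈ Set.Ico (0 : ℝ) 1 := ⟨hp.1.trans hpq.le, hqt.trans ht.2⟩
  calc g.1 s ≤ g.1 ⟨p, hp⟩ := g.2.1 (show s ≤ ⟨p, hp⟩ from hsp.le)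
    _ < g.1 ⟨q, hq⟩ := hg ⟨p, hp⟩ ⟨q, hq⟩ (hs.1.trans_lt hsp) hpq
    _ ≤ g.1 t := g.2.1 (show (⟨q, hq⟩ : I) ≤ t from hqt.le)

variable [IsProbabilityMeasure Q]

/-- Each bump becomes a velocity after scaling. Countably many of them suffice, so the exceptional
sets are united before `g` is fixed. -/
theorem eq_zero_of_forall_D (hβ : 0 < β) (hQ : IsDirichletProcessLaw β Q)
    {ξ : Lp ℝ 2 (Q.prod leb)} (h : ∀ V : Flow Q, V.D ξ = 0) : ξ = 0 := by
  have hint := (Lp.memLp ξ).integrable (one_le_two)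
  have key : ∀ c : ℚ, (c : ℝ) ≤ 1 → ∀ n, ∀ᵐ g ∂Q, ∫ t, ξ (g, t) * bump c n (g.1 t) ∂leb = 0 := by
    intro c hc n
    obtain ⟨κ, hκ, hv⟩ := exists_isVelocity_const_mul (contDiff_bump c n) (bump_zero c n)
      (bump_one hc n)
    obtain ⟨V, hV⟩ := hv.exists_flow hβ hQ
    have hD := P_coeFn (fun p => V.vel (p.1.1 p.2)) V.measurable_weight 1
      (fun p => V.abs_vel_le p.1 p.2) ξ
    have h0 : V.D ξ =ᵐ[Q] 0 := by
      rw [h V]; exact Lp.coeFn_zero _ _ _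
    filter_upwards [hD, h0] with g h1 h2
    rw [Flow.D, h1, hV] at h2
    have h3 : ∀ t, ξ (g, t) * (κ * bump c n (g.1 t)) = κ * (ξ (g, t) * bump c n (g.1 t)) :=
      fun t => by ring
    simp only [h3, integral_const_mul, Pi.zero_apply] at h2
    exact (mul_eq_zero.1 h2).resolve_left hκ.ne'
  have hall : ∀ᵐ g ∂Q, ∀ c : ℚ, (c : ℝ) ≤ 1 → ∀ n,
      ∫ t, ξ (g, t) * bump c n (g.1 t) ∂leb = 0 := by
    simp only [ae_all_iff]
    exact key
  have hz : ∀ᵐ g ∂Q, (fun t => ξ (g, t)) =ᵐ[leb] 0 := by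
    filter_upwards [hall, hQ.ae_strictMono, hint.prod_right_ae] with g h1 h2 h3
    exact ae_eq_zero_of_integral_bump h2 h3 h1
  have : ξ =ᵐ[Q.prod leb] 0 := by
    have hm : MeasurableSet {p : G × I | ξ p = 0} :=
      (Lp.stronglyMeasurable ξ).measurable (measurableSet_singleton 0)
    exact (Measure.ae_prod_iff_ae_ae hm).2 hz
  exact Lp.eq_zero_iff_ae_eq_zero.2 this

/-- For the difference of the two pairs the function part is zero, and differentiation at time 0,
where `V.S 0` is the identity, leaves `V.D (ξ - η) = 0`. -/
theorem gradGraph_unique (hβ : 0 < β) (hQ : IsDirichletProcessLaw β Q) {u : Lp ℝ 2 Q}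
    {ξ η : Lp ℝ 2 (Q.prod leb)} (hξ : (u, ξ) ∈ gradGraph Q) (hη : (u, η) ∈ gradGraph Q) :
    ξ = η := by
  have h0 : ((0 : Lp ℝ 2 Q), ξ - η) ∈ gradGraph Q := by
    have := (gradGraph Q).sub_mem hξ hη
    rwa [Prod.mk_sub_mk, sub_self] at this
  rw [← sub_eq_zero]
  refine eq_zero_of_forall_D hβ hQ fun V => ?_
  have h1 := (V.hasDerivAt_T_iff V.D _ _).1 (h0 V) 0
  simp only [map_zero, Real.cos_zero, one_smul, V.S_zero] at h1
  exact h1.unique (hasDerivAt_const 0 0)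

end Uniqueness

/-! ### Weak limits of gradients -/

section WeakLimit

variable {Q : Measure G} [IsProbabilityMeasure Q]

/-- Weak limits commute with the fixed operators `V.T s` and `V.B s`. The varying operator is an
adjoint, so it is moved to the test vector, where it converges strongly; the pairing of a bounded
weakly convergent family with a strongly convergent one passes to the limit. The variation of `J i`
accommodates discretized velocities. -/
theorem Flow.eq_of_weak_limit (V : Flow Q) (s : ℝ) {ι : Type*} {l : Filter ι} [l.NeBot]
    {u : ι → Lp ℝ 2 Q} {u₀ : Lp ℝ 2 Q} {ξ : ι → Lp ℝ 2 (Q.prod leb)} {ξ₀ : Lp ℝ 2 (Q.prod leb)}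
    {J : ι → Lp ℝ 2 Q →L[ℝ] Lp ℝ 2 (Q.prod leb)} {J₀ : Lp ℝ 2 Q →L[ℝ] Lp ℝ 2 (Q.prod leb)}
    (hu : ∀ F, Tendsto (fun i => (inner ℝ (u i) F : ℝ)) l (𝓝 (inner ℝ u₀ F)))
    (hξ : ∀ F, Tendsto (fun i => (inner ℝ (ξ i) F : ℝ)) l (𝓝 (inner ℝ ξ₀ F)))
    {C : ℝ} (hC : ∀ᶠ i in l, ‖ξ i‖ ≤ C) (hJ : ∀ F, Tendsto (fun i => J i F) l (𝓝 (J₀ F)))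
    (h : ∀ᶠ i in l, V.T s (u i) - u i = ContinuousLinearMap.adjoint (J i) (V.B s (ξ i))) :
    V.T s u₀ - u₀ = ContinuousLinearMap.adjoint J₀ (V.B s ξ₀) := by
  refine ext_inner_right ℝ fun F => ?_
  have h1 : Tendsto (fun i => (inner ℝ (V.T s (u i) - u i) F : ℝ)) l
      (𝓝 (inner ℝ (V.T s u₀ - u₀) F)) := by
    simp only [inner_sub_left, ← ContinuousLinearMap.adjoint_inner_right]
    exact (hu _).sub (hu _)
  have h2 : Tendsto (fun i => (inner ℝ (ContinuousLinearMap.adjoint (J i) (V.B s (ξ i))) F : ℝ)) l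
      (𝓝 (inner ℝ (ContinuousLinearMap.adjoint J₀ (V.B s ξ₀)) F)) := by
    simp only [ContinuousLinearMap.adjoint_inner_left]
    have h3 : Tendsto (fun i => (inner ℝ (V.B s (ξ i)) (J₀ F) : ℝ)) l
        (𝓝 (inner ℝ (V.B s ξ₀) (J₀ F))) := by
      simp only [← ContinuousLinearMap.adjoint_inner_right]
      exact hξ _
    have h4 : Tendsto (fun i => (inner ℝ (V.B s (ξ i)) (J i F - J₀ F) : ℝ)) l (𝓝 0) := by
      have h5 : Tendsto (fun i => ‖V.B s‖ * C * ‖J i F - J₀ F‖) l (𝓝 0) := by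
        have := (tendsto_iff_norm_sub_tendsto_zero.1 (hJ F)).const_mul (‖V.B s‖ * C)
        rwa [mul_zero] at this
      refine squeeze_zero_norm' ?_ h5
      filter_upwards [hC] with i hi
      refine (norm_inner_le_norm _ _).trans (mul_le_mul_of_nonneg_right ?_ (norm_nonneg _))
      exact ((V.B s).le_opNorm _).trans (mul_le_mul_of_nonneg_left hi (norm_nonneg _))
    have h6 := h3.add h4
    rw [add_zero] at h6
    refine h6.congr fun i => ?_
    rw [← inner_add_right]
    congr 1
    abel
  refine tendsto_nhds_unique (h1.congr' ?_) h2
  filter_upwards [h] with i hi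
  rw [hi]

theorem mem_gradGraph_of_weak_limit {ι : Type*} {l : Filter ι} [l.NeBot]
    {u : ι → Lp ℝ 2 Q} {u₀ : Lp ℝ 2 Q} {ξ : ι → Lp ℝ 2 (Q.prod leb)} {ξ₀ : Lp ℝ 2 (Q.prod leb)}
    (hu : ∀ F, Tendsto (fun i => (inner ℝ (u i) F : ℝ)) l (𝓝 (inner ℝ u₀ F)))
    (hξ : ∀ F, Tendsto (fun i => (inner ℝ (ξ i) F : ℝ)) l (𝓝 (inner ℝ ξ₀ F)))
    {C : ℝ} (hC : ∀ᶠ i in l, ‖ξ i‖ ≤ C) (h : ∀ i, (u i, ξ i) ∈ gradGraph Q) :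
    (u₀, ξ₀) ∈ gradGraph Q := fun V s =>
  V.eq_of_weak_limit s hu hξ hC (fun _ => tendsto_const_nhds) (Eventually.of_forall fun i => h i V s)

end WeakLimit

/-! ### The chain rule -/

section ChainRule

/-- The primitive of a function vanishing at the origin. -/
def primitive (ψ : ℝ → ℝ) (x : ℝ) : ℝ := ∫ y in (0 : ℝ)..x, ψ y

variable {ψ : ℝ → ℝ} {K : NNReal}

theorem primitive_sub (hψ : Continuous ψ) (a b : ℝ) :
    primitive ψ b - primitive ψ a = ∫ y in a..b, ψ y :=
  intervalIntegral.integral_interval_sub_left (hψ.intervalIntegrable _ _)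
    (hψ.intervalIntegrable _ _)

theorem primitive_zero : primitive ψ 0 = 0 := intervalIntegral.integral_same

theorem lipschitzWith_primitive (hψ : Continuous ψ) (h1 : ∀ x, |ψ x| ≤ 1) :
    LipschitzWith 1 (primitive ψ) := by
  refine LipschitzWith.of_dist_le_mul fun a b => ?_
  rw [Real.dist_eq, primitive_sub hψ, Real.dist_eq, NNReal.coe_one]
  exact intervalIntegral.norm_integral_le_of_norm_le_const (f := ψ) (C := 1) (a := b) (b := a) fun x _ => h1 x

theorem abs_primitive_taylor_le (hψ : LipschitzWith K ψ) (a b : ℝ) :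
    |primitive ψ b - primitive ψ a - ψ a * (b - a)| ≤ K * |b - a| ^ 2 := by
  have h1 : primitive ψ b - primitive ψ a - ψ a * (b - a) = ∫ y in a..b, (ψ y - ψ a) := by
    rw [intervalIntegral.integral_sub (hψ.continuous.intervalIntegrable _ _)
      intervalIntegrable_const, intervalIntegral.integral_const, primitive_sub hψ.continuous,
      smul_eq_mul, mul_comm]
  rw [h1, pow_two, ← mul_assoc]
  refine intervalIntegral.norm_integral_le_of_norm_le_const (f := fun y => ψ y - ψ a)
    (C := K * |b - a|) (a := a) (b := b) fun x hx => ?_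
  have h2 := hψ.dist_le_mul x a
  rw [Real.dist_eq, Real.dist_eq] at h2
  refine h2.trans (mul_le_mul_of_nonneg_left ?_ K.2)
  exact Set.abs_sub_left_of_mem_uIcc (Set.uIoc_subset_uIcc hx)

variable {Q : Measure G}

theorem memLp_mul_gradient (hψ : Continuous ψ) (h1 : ∀ x, |ψ x| ≤ 1) (u : Lp ℝ 2 Q)
    (ξ : Lp ℝ 2 (Q.prod leb)) : MemLp (fun p : G × I => ψ (u p.1) * ξ p) 2 (Q.prod leb) :=
  memLp_bounded_mul (B := 1) ((hψ.measurable.comp (Lp.stronglyMeasurable u).measurable).comp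
    measurable_fst) (fun _ => h1 _) ξ

variable [IsProbabilityMeasure Q]

/-- A quadratic Taylor remainder is controlled only in `L¹` by the `L²` norm of the increment, so it
is tested against indicators. -/
theorem abs_inner_indicator_le {A : Set G} (hA : MeasurableSet A) {X Z : Lp ℝ 2 Q} {K : ℝ}
    (h : ∀ᵐ g ∂Q, |X g| ≤ K * |Z g| ^ 2) :
    |(inner ℝ (indicatorConstLp 2 hA (measure_ne_top Q A) (1 : ℝ)) X : ℝ)| ≤ K * ‖Z‖ ^ 2 := by
  rw [L2.inner_indicatorConstLp_one, ← real_inner_self_eq_norm_sq, L2.inner_def,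
    ← integral_const_mul]
  have hint := (L2.integrable_inner (𝕜 := ℝ) Z Z).const_mul K
  have hle : ∀ᵐ g ∂Q, ‖X g‖ ≤ K * (inner ℝ (Z g) (Z g) : ℝ) := by
    filter_upwards [h] with g hg
    rw [real_inner_self_eq_norm_sq]
    exact hg
  refine (norm_integral_le_integral_norm (fun g => X g)).trans ?_
  refine (setIntegral_le_integral ((Lp.memLp X).integrable one_le_two).norm
    (Eventually.of_forall fun g => norm_nonneg _)).trans ?_
  exact integral_mono_ae ((Lp.memLp X).integrable one_le_two).norm hint hle

/-- Differentiability in `L²` of the composed function is avoided: the pairing with any indicator is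
differentiated, and the resulting integrated identities, over all measurable sets, determine the
function. -/
theorem mem_gradGraph_primitive (hψ : LipschitzWith K ψ) (h1 : ∀ x, |ψ x| ≤ 1) {u : Lp ℝ 2 Q}
    {ξ : Lp ℝ 2 (Q.prod leb)} (h : (u, ξ) ∈ gradGraph Q) :
    ((lipschitzWith_primitive hψ.continuous h1).compLp primitive_zero u,
      (memLp_mul_gradient hψ.continuous h1 u ξ).toLp) ∈ gradGraph Q := by
  set Θ := (lipschitzWith_primitive hψ.continuous h1).compLp (p := 2) (μ := Q) primitive_zero with hΘ
  have hΘc := fun v : Lp ℝ 2 Q =>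
    (lipschitzWith_primitive hψ.continuous h1).coeFn_compLp (primitive_zero (ψ := ψ)) v
  set η := (memLp_mul_gradient hψ.continuous h1 u ξ).toLp with hη
  intro V s
  have hTΘ : ∀ r, V.T r (Θ u) = Θ (V.T r u) := fun r => by
    refine Lp.ext ?_
    have hq := quasiMeasurePreserving_of_map_le (V.measurable_move r) (V.map_move_le r)
    filter_upwards [compL_coeFn _ (V.measurable_move r) _ (V.map_move_le r) (Θ u),
      compL_coeFn _ (V.measurable_move r) _ (V.map_move_le r) u, hq.ae (hΘc u),
      hΘc (V.T r u)] with g h2 h3 h4 h5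
    rw [Flow.T, h2]
    refine h4.trans (Eq.trans ?_ h5.symm)
    simp only [Function.comp]
    rw [Flow.T, h3]
  have hmeas : ∀ r, Measurable fun g => ψ (V.T r u g) := fun r =>
    hψ.continuous.measurable.comp (Lp.stronglyMeasurable _).measurable
  set W : ℝ → Lp ℝ 2 Q →L[ℝ] Lp ℝ 2 Q := fun r => mulL _ (hmeas r) 1 fun _ => h1 _ with hW
  -- `V.D` integrates in `t` only, so a factor depending on `g` alone can be taken out.
  have hDη : ∀ r, V.D (V.S r η) = W r (V.D (V.S r ξ)) := fun r => by
    refine Lp.ext ?_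
    have hq := quasiMeasurePreserving_of_map_le (V.measurable_moveProd r) (V.map_moveProd_le r)
    have hS : V.S r η =ᵐ[Q.prod leb] fun p => ψ (V.T r u p.1) * V.S r ξ p := by
      filter_upwards [compL_coeFn _ (V.measurable_moveProd r) _ (V.map_moveProd_le r) η,
        compL_coeFn _ (V.measurable_moveProd r) _ (V.map_moveProd_le r) ξ,
        hq.ae (memLp_mul_gradient hψ.continuous h1 u ξ).coeFn_toLp,
        (Measure.quasiMeasurePreserving_fst (μ := Q) (ν := leb)).ae
          (compL_coeFn _ (V.measurable_move r) _ (V.map_move_le r) u)] with p h2 h3 h4 h5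
      rw [Flow.S, h2, hη, h4, h3, Flow.T, h5]
      rfl
    filter_upwards [P_coeFn _ V.measurable_weight 1 (fun p => V.abs_vel_le p.1 p.2) (V.S r η),
      P_coeFn _ V.measurable_weight 1 (fun p => V.abs_vel_le p.1 p.2) (V.S r ξ),
      mulL_coeFn _ (hmeas r) 1 (fun _ => h1 _) (V.D (V.S r ξ)),
      Measure.ae_ae_of_ae_prod hS] with g h2 h3 h4 h5
    rw [hW, h4, Flow.D, h2, h3, ← integral_const_mul]
    refine integral_congr_ae ?_
    filter_upwards [h5] with t ht
    rw [ht, mul_assoc]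
  have hder := (V.hasDerivAt_T_iff V.D u ξ).1 (h V)
  refine Lp.ext ?_
  refine Integrable.ae_eq_of_forall_setIntegral_eq _ _ ((Lp.memLp _).integrable one_le_two)
    ((Lp.memLp _).integrable one_le_two) fun A hA _ => ?_
  rw [← L2.inner_indicatorConstLp_one hA (measure_ne_top Q A),
    ← L2.inner_indicatorConstLp_one hA (measure_ne_top Q A)]
  set F := indicatorConstLp 2 hA (measure_ne_top Q A) (1 : ℝ) with hF
  have hder2 : ∀ r, HasDerivAt (fun r => (inner ℝ F (V.T r (Θ u)) : ℝ))
      (inner ℝ F (Real.cos r • V.D (V.S r η))) r := by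
    intro r
    have hmain : HasDerivAt (fun s => (inner ℝ F (W r (V.T s u)) : ℝ))
        (inner ℝ F (W r (Real.cos r • V.D (V.S r ξ)))) r :=
      ((innerSL ℝ F).comp (W r)).hasFDerivAt.comp_hasDerivAt r (hder r)
    -- The Taylor remainder is quadratic in `V.T s u - V.T r u`, whose norm is `O(s - r)`, and hence
    -- does not contribute to the derivative.
    have hrem : HasDerivAt (fun s => (inner ℝ F (Θ (V.T s u) - Θ (V.T r u) -
        W r (V.T s u - V.T r u)) : ℝ)) 0 r := by
      rw [hasDerivAt_iff_isLittleO]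
      have hbig : (fun s => (inner ℝ F (Θ (V.T s u) - Θ (V.T r u) -
          W r (V.T s u - V.T r u)) : ℝ)) =O[𝓝 r] fun s => ‖V.T s u - V.T r u‖ ^ 2 := by
        refine Asymptotics.IsBigO.of_bound K (Eventually.of_forall fun s => ?_)
        rw [norm_pow, norm_norm]
        refine abs_inner_indicator_le hA ?_
        filter_upwards [Lp.coeFn_sub (Θ (V.T s u) - Θ (V.T r u)) (W r (V.T s u - V.T r u)),
          Lp.coeFn_sub (Θ (V.T s u)) (Θ (V.T r u)), Lp.coeFn_sub (V.T s u) (V.T r u),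
          hΘc (V.T s u), hΘc (V.T r u),
          mulL_coeFn _ (hmeas r) 1 (fun _ => h1 _) (V.T s u - V.T r u)] with g h2 h3 h4 h5 h6 h7
        rw [h2, Pi.sub_apply, h3, Pi.sub_apply, hΘ, h5, h6, hW, h7, h4, Pi.sub_apply]
        exact abs_primitive_taylor_le hψ _ _
      have hlit : (fun s => ‖V.T s u - V.T r u‖ ^ 2) =o[𝓝 r] fun s => s - r := by
        have h2 := ((hder r).isBigO_sub.norm_left.pow 2)
        refine h2.trans_isLittleO ?_
        have h3 : (fun s : ℝ => (s - r) ^ 2) = fun s => (s - r) * (s - r) := by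
          funext s; ring
        rw [h3]
        have h4 : (fun s : ℝ => s - r) =o[𝓝 r] fun _ => (1 : ℝ) := by
          rw [Asymptotics.isLittleO_one_iff]
          have : Tendsto (fun s : ℝ => s - r) (𝓝 r) (𝓝 (r - r)) :=
            tendsto_id.sub_const r
          rwa [sub_self] at this
        simpa using h4.mul_isBigO (Asymptotics.isBigO_refl (fun s : ℝ => s - r) (𝓝 r))
      have := hbig.trans_isLittleO hlit
      simpa using this
    have hsum := (hmain.add hrem).add_const (inner ℝ F (Θ (V.T r u) - W r (V.T r u)) : ℝ)
    rw [add_zero, map_smul, ← hDη r] at hsum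
    refine hsum.congr_of_eventuallyEq (Eventually.of_forall fun s => ?_)
    simp only [Pi.add_apply, hTΘ, map_sub, inner_sub_right]
    ring
  have hcont : Continuous fun r => Real.cos r • V.D (V.S r η) :=
    Real.continuous_cos.smul (V.D.continuous.comp (V.continuous_S η))
  rw [V.map_B, inner_sub_right]
  have h2 := intervalIntegral.integral_eq_sub_of_hasDerivAt (a := 0) (b := s) (fun r _ => hder2 r)
    ((continuous_const.inner hcont).intervalIntegrable _ _)
  rw [V.T_zero] at h2
  rw [← h2]
  exact ((innerSL ℝ F).intervalIntegral_comp_comm (hcont.intervalIntegrable _ _))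

end ChainRule

/-! ### The unit contraction -/

section Contraction

/-- Lipschitz approximations of the indicator function of `[0,1]`. -/
def cutoff (n : ℕ) (x : ℝ) : ℝ := max 0 (min 1 (min (1 + n * x) (1 + n * (1 - x))))

theorem lipschitzWith_cutoff (n : ℕ) : LipschitzWith n (cutoff n) := by
  have h1 : LipschitzWith n fun x : ℝ => 1 + n * x := LipschitzWith.of_dist_le_mul fun x y => by
    rw [Real.dist_eq, Real.dist_eq, add_sub_add_left_eq_sub, ← mul_sub, abs_mul]
    simp
  have h2 : LipschitzWith n fun x : ℝ => 1 + n * (1 - x) := LipschitzWith.of_dist_le_mul fun x y => by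
    rw [Real.dist_eq, Real.dist_eq, add_sub_add_left_eq_sub, ← mul_sub, abs_mul,
      sub_sub_sub_cancel_left, abs_sub_comm]
    simp
  have h3 := ((h1.min h2).const_min 1).const_max 0
  rw [max_self] at h3
  exact h3

theorem abs_cutoff_le (n : ℕ) (x : ℝ) : |cutoff n x| ≤ 1 := by
  rw [cutoff, abs_of_nonneg (le_max_left _ _)]
  exact max_le zero_le_one (min_le_left _ _)

theorem tendsto_cutoff (x : ℝ) :
    Tendsto (fun n => cutoff n x) atTop (𝓝 ((Set.Icc 0 1).indicator 1 x)) := by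
  have hneg : ∀ y : ℝ, y < 0 → Tendsto (fun n : ℕ => 1 + n * y) atTop atBot := fun y hy =>
    tendsto_atBot_add_const_left _ _ (tendsto_natCast_atTop_atTop.atTop_mul_const_of_neg hy)
  by_cases h0 : 0 ≤ x
  · by_cases h1 : x ≤ 1
    · refine tendsto_const_nhds.congr fun n => ?_
      have h2 : 1 ≤ 1 + (n : ℝ) * x := by
        have : 0 ≤ (n : ℝ) * x := by positivity
        linarith
      have h3 : 1 ≤ 1 + (n : ℝ) * (1 - x) := by
        have : 0 ≤ (n : ℝ) * (1 - x) := mul_nonneg (Nat.cast_nonneg n) (by linarith)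
        linarith
      rw [cutoff, min_eq_left (le_min h2 h3), max_eq_right zero_le_one]
      simp [h0, h1]
    · refine tendsto_const_nhds.congr' ?_
      filter_upwards [(hneg (1 - x) (by linarith)).eventually (eventually_le_atBot 0)] with n hn
      rw [cutoff, max_eq_left ((min_le_right _ _).trans ((min_le_right _ _).trans hn))]
      simp [h1]
  · refine tendsto_const_nhds.congr' ?_
    filter_upwards [(hneg x (by linarith)).eventually (eventually_le_atBot 0)] with n hn
    rw [cutoff, max_eq_left ((min_le_right _ _).trans ((min_le_left _ _).trans hn))]
    simp [h0]

theorem intervalIntegral_indicator_Icc (x : ℝ) :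
    ∫ y in (0 : ℝ)..x, (Set.Icc (0 : ℝ) 1).indicator 1 y = min (max x 0) 1 := by
  rcases le_total x 0 with hx | hx
  · rw [max_eq_right hx, min_eq_left zero_le_one]
    refine intervalIntegral.integral_zero_ae ?_
    have : ∀ᵐ y : ℝ, y ≠ 0 := by simp [ae_iff]
    filter_upwards [this] with y hy hmem
    rw [Set.uIoc_of_ge hx] at hmem
    have : ¬ (0 ≤ y) := fun h => hy (le_antisymm hmem.2 h)
    simp [this]
  · rw [max_eq_left hx, intervalIntegral.integral_of_le hx, integral_indicator measurableSet_Icc,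
      Measure.restrict_restrict measurableSet_Icc]
    have : Set.Icc (0 : ℝ) 1 ∩ Set.Ioc 0 x = Set.Ioc 0 (min x 1) := by
      ext y
      simp only [Set.mem_inter_iff, Set.mem_Icc, Set.mem_Ioc, le_min_iff]
      constructor
      · rintro ⟨⟨_, h2⟩, h3, h4⟩; exact ⟨h3, h4, h2⟩
      · rintro ⟨h1, h2, h3⟩; exact ⟨⟨h1.le, h3⟩, h1, h2⟩
    rw [this]
    simp [le_min hx zero_le_one]

theorem tendsto_primitive_cutoff (x : ℝ) :
    Tendsto (fun n => primitive (cutoff n) x) atTop (𝓝 (min (max x 0) 1)) := by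
  rw [← intervalIntegral_indicator_Icc]
  exact intervalIntegral.tendsto_integral_filter_of_dominated_convergence (fun _ => 1)
    (Eventually.of_forall fun n =>
      (lipschitzWith_cutoff n).continuous.aestronglyMeasurable)
    (Eventually.of_forall fun n => Eventually.of_forall fun y _ => abs_cutoff_le n y)
    intervalIntegrable_const (Eventually.of_forall fun y _ => tendsto_cutoff y)

variable {Q : Measure G} [IsProbabilityMeasure Q]

/-- The unit contraction is the primitive of the indicator of `[0,1]`, which is not Lipschitz. The
primitives of `cutoff n` converge strongly with gradients bounded by `‖ξ‖`, and a weak limit of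
these gradients serves as `η`. -/
theorem exists_contraction_mem_gradGraph {u : Lp ℝ 2 Q} {ξ : Lp ℝ 2 (Q.prod leb)}
    (h : (u, ξ) ∈ gradGraph Q) : ∃ (v : Lp ℝ 2 Q) (η : Lp ℝ 2 (Q.prod leb)),
      (v =ᵐ[Q] fun g => min (max (u g) 0) 1) ∧ ‖η‖ ≤ ‖ξ‖ ∧ (v, η) ∈ gradGraph Q := by
  have hlip := fun n => lipschitzWith_primitive (lipschitzWith_cutoff n).continuous (abs_cutoff_le n)
  have hmem := fun n => mem_gradGraph_primitive (lipschitzWith_cutoff n) (abs_cutoff_le n) h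
  set w : ℕ → Lp ℝ 2 Q := fun n => (hlip n).compLp primitive_zero u with hw
  set ζ : ℕ → Lp ℝ 2 (Q.prod leb) := fun n =>
    (memLp_mul_gradient (lipschitzWith_cutoff n).continuous (abs_cutoff_le n) u ξ).toLp with hζ
  have hζn : ∀ n, ‖ζ n‖ ≤ ‖ξ‖ := fun n => by
    refine Lp.norm_le_norm_of_ae_le ?_
    filter_upwards [(memLp_mul_gradient (lipschitzWith_cutoff n).continuous
      (abs_cutoff_le n) u ξ).coeFn_toLp] with p hp
    rw [hζ, hp, norm_mul]
    exact mul_le_of_le_one_left (norm_nonneg _) (abs_cutoff_le n _)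
  have hle : ∀ x : ℝ, |min (max x 0) 1| ≤ |x| := fun x => by
    rw [abs_of_nonneg (le_min (le_max_right _ _) zero_le_one)]
    exact (min_le_left _ _).trans (max_le (le_abs_self x) (abs_nonneg x))
  have hv : MemLp (fun g => min (max (u g) 0) 1) 2 Q := by
    refine (Lp.memLp u).mono ?_ (Eventually.of_forall fun g => hle _)
    exact (((Lp.stronglyMeasurable u).measurable.max measurable_const).min
      measurable_const).aestronglyMeasurable
  have hwm : ∀ n, MemLp (fun g => primitive (cutoff n) (u g)) 2 Q := fun n =>
    (hlip n).comp_memLp primitive_zero (Lp.memLp u)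
  have hstrong : Tendsto w atTop (𝓝 hv.toLp) := by
    have := tendsto_toLp_of_dominated (l := atTop) hwm hv (Lp.memLp u).abs
      (Eventually.of_forall fun n => Eventually.of_forall fun g => ?_)
      (Eventually.of_forall fun g => hle _)
      (Eventually.of_forall fun g => tendsto_primitive_cutoff (u g))
    · refine this.congr fun n => Lp.ext ?_
      filter_upwards [(hwm n).coeFn_toLp, (hlip n).coeFn_compLp primitive_zero u] with g h1 h2
      rw [h1, hw, h2, Function.comp]
    · have := (hlip n).dist_le_mul (u g) 0
      simpa [Real.dist_eq, primitive_zero] using this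
  obtain ⟨l, hl⟩ : ∃ l : Ultrafilter ℕ, (l : Filter ℕ) ≤ atTop := Ultrafilter.exists_le atTop
  obtain ⟨η, hη, hlim⟩ := exists_weak_limit l ζ ‖ξ‖ (Eventually.of_forall hζn)
  refine ⟨hv.toLp, η, hv.coeFn_toLp, hη, ?_⟩
  refine mem_gradGraph_of_weak_limit (l := (l : Filter ℕ)) (u := w) (ξ := ζ) (fun F => ?_) hlim
    (Eventually.of_forall hζn) hmem
  exact (hstrong.mono_left hl).inner tendsto_const_nhds

end Contraction

/-! ### The maximal form -/

section MaximalForm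

variable {β : ℝ} {Q : Measure G} [IsProbabilityMeasure Q]

theorem dense_of_wassersteinGraph (W : Submodule ℝ (Lp ℝ 2 Q))
    (h : ∀ p ∈ wassersteinGraph Q, p.1 ∈ W) : Dense (W : Set (Lp ℝ 2 Q)) := by
  rw [Submodule.dense_iff_topologicalClosure_eq_top, Submodule.topologicalClosure_eq_top_iff,
    Submodule.eq_bot_iff]
  intro v hv
  rw [Submodule.mem_orthogonal'] at hv
  exact eq_zero_of_inner_wassersteinGraph fun p hp => hv _ (h p hp)

/-- The gradient along all perturbations as a partially defined operator. -/
def gradient (Q : Measure G) [IsProbabilityMeasure Q] :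
    Lp ℝ 2 Q →ₗ.[ℝ] Lp ℝ 2 (Q.prod leb) :=
  (gradGraph Q).toLinearPMap

theorem mem_gradient_domain {u : Lp ℝ 2 Q} {ξ : Lp ℝ 2 (Q.prod leb)} (h : (u, ξ) ∈ gradGraph Q) :
    u ∈ (gradient Q).domain :=
  Submodule.mem_map.2 ⟨_, h, rfl⟩

theorem gradient_mem (hβ : 0 < β) (hQ : IsDirichletProcessLaw β Q) (u : (gradient Q).domain) :
    ((u : Lp ℝ 2 Q), gradient Q u) ∈ gradGraph Q := by
  refine Submodule.mem_graph_toLinearPMap (fun x hx h0 => ?_) u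
  obtain ⟨w, η⟩ := x
  obtain rfl : w = 0 := h0
  exact gradGraph_unique hβ hQ hx (gradGraph Q).zero_mem

theorem gradient_eq (hβ : 0 < β) (hQ : IsDirichletProcessLaw β Q) {u : (gradient Q).domain}
    {ξ : Lp ℝ 2 (Q.prod leb)} (h : ((u : Lp ℝ 2 Q), ξ) ∈ gradGraph Q) : gradient Q u = ξ :=
  gradGraph_unique hβ hQ (gradient_mem hβ hQ u) h

/-- The bilinear form `(u, v) ↦ ⟨∇u, ∇v⟩`. -/
def gradientForm (Q : Measure G) [IsProbabilityMeasure Q] :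
    (gradient Q).domain →ₗ[ℝ] (gradient Q).domain →ₗ[ℝ] ℝ :=
  (innerₗ (Lp ℝ 2 (Q.prod leb))).compl₁₂ (gradient Q).toFun (gradient Q).toFun

theorem gradientForm_apply (u v : (gradient Q).domain) :
    gradientForm Q u v = inner ℝ (gradient Q u) (gradient Q v) := rfl

theorem gradientForm_self (u : (gradient Q).domain) : gradientForm Q u u = ‖gradient Q u‖ ^ 2 := by
  rw [gradientForm_apply, real_inner_self_eq_norm_sq]

theorem gradientForm_eq (hβ : 0 < β) (hQ : IsDirichletProcessLaw β Q) {u v : (gradient Q).domain}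
    {ξ η : Lp ℝ 2 (Q.prod leb)} (hu : ((u : Lp ℝ 2 Q), ξ) ∈ gradGraph Q)
    (hv : ((v : Lp ℝ 2 Q), η) ∈ gradGraph Q) : gradientForm Q u v = inner ℝ ξ η := by
  rw [gradientForm_apply, gradient_eq hβ hQ hu, gradient_eq hβ hQ hv]

/-- The Dirichlet form `(u, v) ↦ ⟨∇u, ∇v⟩` on all functions that are differentiable along perturbations. -/
def maximalForm (hβ : 0 < β) (hQ : IsDirichletProcessLaw β Q) : DirichletForm Q where
  dom := (gradient Q).domain
  form := gradientForm Q
  symm := fun u v => by rw [gradientForm_apply, gradientForm_apply, real_inner_comm]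
  nonneg := fun u => by rw [gradientForm_self]; positivity
  dense := dense_of_wassersteinGraph _ fun p hp =>
    mem_gradient_domain (ξ := p.2) (mem_gradGraph_of_mem_wassersteinGraph hp)
  closed := fun s u hs hc => by
    simp only [gradientForm_self, LinearPMap.map_sub] at hc
    have hcau : CauchySeq fun n => gradient Q (s n) := by
      refine Metric.cauchySeq_iff.2 fun ε hε => ?_
      obtain ⟨n₀, hn₀⟩ := hc (ε ^ 2) (by positivity)
      refine ⟨n₀, fun m hm n hn => ?_⟩
      rw [dist_eq_norm]
      exact lt_of_pow_lt_pow_left₀ 2 hε.le (hn₀ m hm n hn)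
    obtain ⟨ξ, hξ⟩ := cauchySeq_tendsto_of_complete hcau
    have hmem : (u, ξ) ∈ gradGraph Q :=
      isClosed_gradGraph.mem_of_tendsto (hs.prodMk_nhds hξ)
        (Eventually.of_forall fun n => gradient_mem hβ hQ (s n))
    have hu := mem_gradient_domain hmem
    refine ⟨hu, ?_⟩
    have hgu : gradient Q ⟨u, hu⟩ = ξ := gradient_eq hβ hQ hmem
    simp only [gradientForm_self, LinearPMap.map_sub, hgu]
    have := (tendsto_iff_norm_sub_tendsto_zero.1 hξ).pow 2
    rwa [zero_pow two_ne_zero] at this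
  markov := fun u => by
    obtain ⟨v, η, hv, hη, hmem⟩ := exists_contraction_mem_gradGraph (gradient_mem hβ hQ u)
    refine ⟨⟨v, mem_gradient_domain hmem⟩, hv, ?_⟩
    rw [gradientForm_self, gradientForm_self,
      gradient_eq hβ hQ (u := ⟨v, mem_gradient_domain hmem⟩) hmem]
    exact pow_le_pow_left₀ (norm_nonneg _) hη 2

theorem maximalForm_apply (hβ : 0 < β) (hQ : IsDirichletProcessLaw β Q)
    {u v : (maximalForm hβ hQ).dom} {ξ η : Lp ℝ 2 (Q.prod leb)}
    (hu : ((u : Lp ℝ 2 Q), ξ) ∈ gradGraph Q) (hv : ((v : Lp ℝ 2 Q), η) ∈ gradGraph Q) :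
    (maximalForm hβ hQ).form u v = inner ℝ ξ η :=
  gradientForm_eq hβ hQ hu hv

theorem wassersteinEnergy_eq (hβ : 0 < β) (hQ : IsDirichletProcessLaw β Q) {u : Lp ℝ 2 Q}
    {ξ : Lp ℝ 2 (Q.prod leb)} (h : (u, ξ) ∈ closure (wassersteinGraph Q)) :
    wassersteinEnergy Q u = ‖ξ‖ₑ ^ 2 := by
  refine le_antisymm (iInf₂_le ξ h) (le_iInf₂ fun η hη => ?_)
  rw [gradGraph_unique hβ hQ (closure_wassersteinGraph_subset h)
    (closure_wassersteinGraph_subset hη)]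

theorem extends_maximalForm (hβ : 0 < β) (hQ : IsDirichletProcessLaw β Q) :
    Extends Q (maximalForm hβ hQ) := by
  rintro u ⟨ξ, hξ⟩
  have hmem := closure_wassersteinGraph_subset hξ
  refine ⟨mem_gradient_domain hmem, ?_⟩
  rw [maximalForm_apply hβ hQ hmem hmem, wassersteinEnergy_eq hβ hQ hξ, real_inner_self_eq_norm_sq,
    ENNReal.ofReal_pow (norm_nonneg _), ofReal_norm]

end MaximalForm

/-! ### Integration by parts -/

section IntegrationByParts

/-- For nonnegative integrands the two comparisons bound the difference from both sides; the general
case is split into positive and negative parts. -/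
theorem abs_integral_sub_le {X : Type*} [MeasurableSpace X] {μ ν : Measure X} {c : NNReal}
    (h1 : 1 ≤ c) (hνμ : ν ≤ c • μ) (hμν : μ ≤ c • ν) {f : X → ℝ} (hf : Integrable f μ) :
    |∫ x, f x ∂ν - ∫ x, f x ∂μ| ≤ (c - 1) * ∫ x, |f x| ∂μ := by
  have hc : (1 : ℝ) ≤ c := h1
  have key : ∀ f : X → ℝ, (∀ x, 0 ≤ f x) → Integrable f μ →
      |∫ x, f x ∂ν - ∫ x, f x ∂μ| ≤ (c - 1) * ∫ x, f x ∂μ := by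
    intro f hf0 hf
    have hfc : Integrable f (c • μ) := hf.smul_measure_nnreal
    have hfν : Integrable f ν := hfc.mono_measure hνμ
    have h2 : ∫ x, f x ∂ν ≤ c * ∫ x, f x ∂μ := by
      refine (integral_mono_measure hνμ (Eventually.of_forall hf0) hfc).trans (le_of_eq ?_)
      rw [integral_smul_nnreal_measure]; rfl
    have h3 : ∫ x, f x ∂μ ≤ c * ∫ x, f x ∂ν := by
      refine (integral_mono_measure hμν (Eventually.of_forall hf0) hfν.smul_measure_nnreal).trans
        (le_of_eq ?_)
      rw [integral_smul_nnreal_measure]; rfl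
    have h4 : 0 ≤ ∫ x, f x ∂μ := integral_nonneg hf0
    have h5 : 0 ≤ ∫ x, f x ∂ν := integral_nonneg hf0
    rw [abs_le]
    constructor
    · by_cases h6 : ∫ x, f x ∂μ ≤ ∫ x, f x ∂ν
      · nlinarith
      · push Not at h6
        nlinarith
    · nlinarith
  have hp := key (fun x => max (f x) 0) (fun x => le_max_right _ _) hf.pos_part
  have hn := key (fun x => max (-f x) 0) (fun x => le_max_right _ _) hf.neg_part
  have hfν : Integrable f ν := (hf.smul_measure_nnreal (c := c)).mono_measure hνμ
  have hsub : ∀ ρ : Measure X, Integrable f ρ →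
      ∫ x, f x ∂ρ = ∫ x, max (f x) 0 ∂ρ - ∫ x, max (-f x) 0 ∂ρ := fun ρ hρ => by
    rw [← integral_sub hρ.pos_part hρ.neg_part]
    refine integral_congr_ae (Eventually.of_forall fun x => ?_)
    rcases le_total (f x) 0 with h | h <;> simp [h]
  have habs : ∫ x, |f x| ∂μ = ∫ x, max (f x) 0 ∂μ + ∫ x, max (-f x) 0 ∂μ := by
    rw [← integral_add hf.pos_part hf.neg_part]
    refine integral_congr_ae (Eventually.of_forall fun x => ?_)
    rcases le_total (f x) 0 with h | h <;> simp [h, abs_of_nonneg, abs_of_nonpos]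
  rw [hsub ν hfν, hsub μ hf, habs, mul_add]
  calc _ = |(∫ x, max (f x) 0 ∂ν - ∫ x, max (f x) 0 ∂μ) -
        (∫ x, max (-f x) 0 ∂ν - ∫ x, max (-f x) 0 ∂μ)| := by congr 1; ring
    _ ≤ _ := (abs_sub _ _).trans (add_le_add hp hn)

theorem exp_sub_one_le {x K : ℝ} (h0 : 0 ≤ x) (hK : x ≤ K) : Real.exp x - 1 ≤ x * Real.exp K := by
  have h1 := Real.add_one_le_exp (-x)
  have h2 : Real.exp x * Real.exp (-x) = 1 := by rw [← Real.exp_add]; simp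
  have h3 := Real.exp_le_exp.2 hK
  nlinarith [Real.exp_pos x]

variable {β : ℝ} {Q : Measure G} [IsProbabilityMeasure Q]

/-- Integration by parts as a bound, without computing a logarithmic derivative of `Q`. The
increment of `⟨F, T_r w⟩` is `(⟨T_r F, T_r w⟩ - ⟨F, w⟩) - ⟨T_r F - F, T_r w⟩`: the first part
measures the change of `Q` and is `O(r)` by two-sided quasi-invariance, the second is `O(r)` since
`F` is Lipschitz along the perturbation. Their constants add up to `C`. -/
theorem Flow.exists_abs_inner_D_le (V : Flow Q) {F : G → ℝ} (hF : MemLp F 2 Q) {M L : ℝ}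
    (hM : ∀ g, |F g| ≤ M) (hL : ∀ r g, |F (V.move r g) - F g| ≤ L * |r|) :
    ∃ C, ∀ w ξ, (w, ξ) ∈ gradGraph Q → |(inner ℝ hF.toLp (V.D ξ) : ℝ)| ≤ C * ‖w‖ := by
  have hG : Nonempty G := (nonempty_of_isProbabilityMeasure Q)
  obtain ⟨g₀⟩ := hG
  have hM0 : 0 ≤ M := (abs_nonneg _).trans (hM g₀)
  have hL0 : 0 ≤ L := by simpa using (abs_nonneg _).trans (hL 1 g₀)
  refine ⟨L * Real.sqrt V.const + V.rate * Real.exp V.rate * M, fun w ξ h => ?_⟩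
  have hder := ((innerSL ℝ hF.toLp).hasFDerivAt.comp_hasDerivAt 0
    ((V.hasDerivAt_T_iff V.D w ξ).1 (h V) 0))
  rw [Real.cos_zero, one_smul, V.S_zero] at hder
  refine hder.le_of_lip' (by have := V.rate_nonneg; positivity) ?_
  refine Eventually.of_forall fun r => ?_
  have hq := quasiMeasurePreserving_of_map_le (V.measurable_move r) (V.map_move_le r)
  have hTF := compL_coeFn _ (V.measurable_move r) _ (V.map_move_le r) hF.toLp
  have hTw := compL_coeFn _ (V.measurable_move r) _ (V.map_move_le r) w
  have h1 : ‖V.T r hF.toLp - hF.toLp‖ ≤ L * |r| := by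
    refine (Lp.norm_le_of_ae_bound (by positivity) (C := L * |r|) ?_).trans (le_of_eq ?_)
    · filter_upwards [Lp.coeFn_sub (V.T r hF.toLp) hF.toLp, hTF, hF.coeFn_toLp,
        hq.ae hF.coeFn_toLp] with g h2 h3 h4 h5
      rw [h2, Pi.sub_apply, Flow.T, h3, h4, h5]
      exact hL r g
    · simp [measureUnivNNReal]
  have h2 : ‖V.T r w‖ ≤ Real.sqrt V.const * ‖w‖ := norm_compL_le _ _ _ _ _
  have hint : Integrable (fun g => F g * w g) Q :=
    ((Lp.memLp w).integrable one_le_two).bdd_mul (c := M) hF.aestronglyMeasurable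
      (Eventually.of_forall hM)
  have hFw : (inner ℝ hF.toLp w : ℝ) = ∫ g, F g * w g ∂Q := by
    rw [L2.inner_def]
    refine integral_congr_ae ?_
    filter_upwards [hF.coeFn_toLp] with g hg
    rw [hg]; simp [mul_comm]
  have hTFw : (inner ℝ (V.T r hF.toLp) (V.T r w) : ℝ) = ∫ g, F g * w g ∂Q.map (V.move r) := by
    rw [integral_map (V.measurable_move r).aemeasurable
      (hint.aestronglyMeasurable.mono_ac hq.absolutelyContinuous), L2.inner_def]
    refine integral_congr_ae ?_
    filter_upwards [hTF, hTw, hq.ae hF.coeFn_toLp] with g h3 h4 h5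
    rw [Flow.T, h3, h4, h5]; simp [mul_comm]
  have h3 : ∫ g, |F g * w g| ∂Q ≤ M * ‖w‖ := by
    have h4 : ∫ g, |w g| ∂Q ≤ ‖w‖ := by
      have := abs_real_inner_le_norm ((memLp_const (1 : ℝ) : MemLp _ 2 Q).toLp) |w|
      rw [norm_abs_eq_norm] at this
      refine le_trans (le_of_eq ?_) ((le_abs_self _).trans (this.trans (le_of_eq ?_)))
      · rw [L2.inner_def]
        refine integral_congr_ae ?_
        filter_upwards [(memLp_const (1 : ℝ) : MemLp _ 2 Q).coeFn_toLp, Lp.coeFn_abs w] with g h5 h6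
        rw [h5, h6]; simp
      · rw [show (memLp_const (1 : ℝ) : MemLp _ 2 Q).toLp = Lp.const 2 Q 1 from rfl, Lp.norm_const] <;>
          simp
    calc ∫ g, |F g * w g| ∂Q ≤ ∫ g, M * |w g| ∂Q :=
          integral_mono hint.abs ((((Lp.memLp w).integrable one_le_two).abs).const_mul M) fun g => by
            simp only [abs_mul]
            exact mul_le_mul_of_nonneg_right (hM g) (abs_nonneg _)
      _ ≤ M * ‖w‖ := by
          rw [integral_const_mul]
          exact mul_le_mul_of_nonneg_left h4 hM0
  have h4 : |(inner ℝ (V.T r hF.toLp) (V.T r w) : ℝ) - inner ℝ hF.toLp w| ≤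
      V.rate * Real.exp V.rate * |r| * (M * ‖w‖) := by
    rw [hTFw, hFw]
    have hx0 : 0 ≤ V.rate * |Real.sin r| := mul_nonneg V.rate_nonneg (abs_nonneg _)
    refine (abs_integral_sub_le (Real.one_le_toNNReal.2 (Real.one_le_exp hx0))
      (V.map_move_le_exp r) (V.le_map_move_exp r) hint).trans ?_
    rw [Real.coe_toNNReal _ (Real.exp_pos _).le]
    refine mul_le_mul ?_ h3 (integral_nonneg fun _ => abs_nonneg _)
      (mul_nonneg (mul_nonneg V.rate_nonneg (Real.exp_pos _).le) (abs_nonneg _))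
    refine (exp_sub_one_le hx0 (mul_le_of_le_one_right V.rate_nonneg
      (Real.abs_sin_le_one r))).trans ?_
    have := mul_le_mul_of_nonneg_left (Real.abs_sin_le_abs (x := r)) V.rate_nonneg
    nlinarith [Real.exp_pos V.rate]
  have h5 : |(inner ℝ (V.T r hF.toLp - hF.toLp) (V.T r w) : ℝ)| ≤
      L * |r| * (Real.sqrt V.const * ‖w‖) :=
    (abs_real_inner_le_norm _ _).trans
      (mul_le_mul h1 h2 (norm_nonneg _) (mul_nonneg hL0 (abs_nonneg _)))
  change |(inner ℝ hF.toLp (V.T r w) : ℝ) - inner ℝ hF.toLp (V.T 0 w)| ≤ _ * |r - 0|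
  rw [V.T_zero, sub_zero]
  calc |(inner ℝ hF.toLp (V.T r w) : ℝ) - inner ℝ hF.toLp w|
      = |((inner ℝ (V.T r hF.toLp) (V.T r w) : ℝ) - inner ℝ hF.toLp w) -
          inner ℝ (V.T r hF.toLp - hF.toLp) (V.T r w)| := by
        rw [inner_sub_left]; congr 1; ring
    _ ≤ _ := (abs_sub _ _).trans (add_le_add h4 h5)
    _ = _ := by ring

end IntegrationByParts

/-! ### The generator on Neumann cylinder functions -/

section Neumann

/-- The core `S` need not be dense in `Γ` for the graph norm. Since the pairing with `ξ` is bounded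
by the norm of the first component alone, density of the first components in `H` is enough to extend
the identity. -/
theorem inner_eq_inner_of_dense {H K : Type*} [NormedAddCommGroup H] [InnerProductSpace ℝ H]
    [NormedAddCommGroup K] [InnerProductSpace ℝ K] (Γ : Submodule ℝ (H × K)) {S : Set (H × K)}
    (hS : S ⊆ Γ) (hd : ∀ W : Submodule ℝ H, (∀ p ∈ S, p.1 ∈ W) → Dense (W : Set H)) {ξ : K} {f : H}
    {C : ℝ} (hC : ∀ p ∈ Γ, |(inner ℝ ξ p.2 : ℝ)| ≤ C * ‖p.1‖)
    (hf : ∀ p ∈ S, (inner ℝ ξ p.2 : ℝ) = inner ℝ f p.1) {p : H × K} (hp : p ∈ Γ) :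
    (inner ℝ ξ p.2 : ℝ) = inner ℝ f p.1 := by
  set ℓ : H × K →ₗ[ℝ] ℝ :=
    (innerₗ K ξ).comp (LinearMap.snd ℝ H K) - (innerₗ H f).comp (LinearMap.fst ℝ H K) with hℓ
  have hker : ∀ x, x ∈ LinearMap.ker ℓ ↔ (inner ℝ ξ x.2 : ℝ) = inner ℝ f x.1 := fun x => by
    rw [LinearMap.mem_ker, hℓ]
    exact sub_eq_zero
  have hdense := hd ((Γ ⊓ LinearMap.ker ℓ).map (LinearMap.fst ℝ H K)) fun x hx =>
    Submodule.mem_map.2 ⟨x, ⟨hS hx, (hker x).2 (hf x hx)⟩, rfl⟩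
  obtain ⟨w, hw, hlim⟩ := mem_closure_iff_seq_limit.1 (hdense p.1)
  choose x hx hxw using fun n => Submodule.mem_map.1 (hw n)
  have h1 : Tendsto (fun n => (inner ℝ f (x n).1 : ℝ)) atTop (𝓝 (inner ℝ f p.1)) := by
    have : (fun n => (x n).1) = w := funext hxw
    exact tendsto_const_nhds.inner (this ▸ hlim)
  refine tendsto_nhds_unique ?_ h1
  simp only [← fun n => (hker _).1 (hx n).2]
  rw [tendsto_iff_norm_sub_tendsto_zero]
  have h2 : Tendsto (fun n => C * ‖w n - p.1‖) atTop (𝓝 0) := by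
    have := (tendsto_iff_norm_sub_tendsto_zero.1 hlim).const_mul C
    rwa [mul_zero] at this
  refine squeeze_zero (fun _ => norm_nonneg _) (fun n => ?_) h2
  rw [← inner_sub_right, ← hxw n]
  exact hC _ (Γ.sub_mem (hx n).1 hp)

theorem coeFn_sum_smul {X ι : Type*} [MeasurableSpace X] {μ : Measure X} [Fintype ι] (c : ι → ℝ)
    (f : ι → Lp ℝ 2 μ) : (∑ i, c i • f i : Lp ℝ 2 μ) =ᵐ[μ] fun x => ∑ i, c i * f i x := by
  refine (Lp.coeFn_fun_finsetSum _ _).trans ?_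
  filter_upwards [ae_all_iff.2 fun i => Lp.coeFn_smul (c i) (f i)] with x hx
  exact Finset.sum_congr rfl fun i _ => hx i

variable {β : ℝ} {Q : Measure G}

theorem Flow.abs_integral_move_sub_le (V : Flow Q) {φ : ℝ → ℝ} (hφ : ContDiff ℝ 1 φ) {M : ℝ}
    (hM : ∀ x, |deriv φ x| ≤ M) (r : ℝ) (g : G) :
    |∫ t, φ ((V.move r g).1 t) ∂leb - ∫ t, φ (g.1 t) ∂leb| ≤ M * |r| := by
  have hM0 : 0 ≤ M := (abs_nonneg _).trans (hM 0)
  have h := Convex.norm_image_sub_le_of_norm_hasDerivWithin_le (s := Set.univ) (C := M) (x := 0)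
    (y := r) (fun s _ => (V.hasDerivAt_integral_move hφ hM s g).hasDerivWithinAt) (fun s _ => ?_)
    convex_univ (Set.mem_univ _) (Set.mem_univ _)
  · simpa only [V.move_zero, sub_zero, Real.norm_eq_abs] using h
  · rw [norm_mul]
    have h1 : ‖∫ t, deriv φ ((V.move s g).1 t) * V.vel (g.1 t) ∂leb‖ ≤ M := by
      have := norm_integral_le_of_norm_le_const (μ := leb) (C := M)
        (f := fun t => deriv φ ((V.move s g).1 t) * V.vel (g.1 t)) (Eventually.of_forall fun t => by
          rw [norm_mul]
          exact (mul_le_mul (hM _) (V.abs_vel_le g t) (abs_nonneg _) hM0).trans (mul_one M).le)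
      simpa using this
    exact (mul_le_mul (Real.abs_cos_le_one s) h1 (norm_nonneg _) zero_le_one).trans (one_mul M).le

variable [IsProbabilityMeasure Q]

/-- The Neumann condition says that `φᵢ'` vanishes at 0 and 1, so `κᵢ φᵢ'` is an admissible velocity
for a small `κᵢ`. The gradient `∑ ∂ᵢU φᵢ'(g(t))` then acts on `η` through the directional
derivatives `(V i).D η` with coefficients `F i = ∂ᵢU`, which are bounded and Lipschitz along the
perturbations, and integration by parts applies. -/
theorem exists_gradient_of_isNeumannCylinder (hβ : 0 < β) (hQ : IsDirichletProcessLaw β Q)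
    {u : Lp ℝ 2 Q} (hu : IsNeumannCylinder Q u) : ∃ ξ : Lp ℝ 2 (Q.prod leb),
      (u, ξ) ∈ gradGraph Q ∧ ∃ C, ∀ w η, (w, η) ∈ gradGraph Q →
        |(inner ℝ ξ η : ℝ)| ≤ C * ‖w‖ := by
  obtain ⟨m, φ, U, hφ, hU, hUc, hu⟩ := hu
  have hvel : ∀ i, ∃ κ : ℝ, 0 < κ ∧ ∃ V : Flow Q, V.vel = fun x => κ * deriv (φ i) x := fun i => by
    have h2 : ContDiff ℝ 2 (deriv (φ i)) := by
      have : ContDiff ℝ (2 + 1) (φ i) := (contDiff_infty.1 (hφ i).1 3).of_le (by norm_num)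
      exact ((contDiff_succ_iff_deriv (n := 2)).1 this).2.2
    obtain ⟨κ, hκ, hv⟩ := exists_isVelocity_const_mul h2 (hφ i).2.2.1 (hφ i).2.2.2
    exact ⟨κ, hκ, hv.exists_flow hβ hQ⟩
  choose κ hκ V hV using hvel
  have hφ1 : ∀ i, ContDiff ℝ 1 (φ i) := fun i => (hφ i).1.of_le (by exact_mod_cast le_top)
  have hU1 : ContDiff ℝ 1 U := hU.of_le (by exact_mod_cast le_top)
  have hφM : ∀ i, ∃ M, ∀ x, |deriv (φ i) x| ≤ M := fun i =>
    ((hφ i).2.1.deriv).exists_bound_of_continuous ((hφ1 i).continuous_deriv le_rfl)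
  choose Mφ hMφ using hφM
  obtain ⟨M, hM⟩ := exists_fderiv_bound hU1 hUc
  obtain ⟨MU, hMU⟩ := hUc.exists_bound_of_continuous hU.continuous
  set ψ : Fin m → G → ℝ := fun i g => ∫ t, φ i (g.1 t) ∂leb with hψdef
  set F : Fin m → G → ℝ := fun i g => fderiv ℝ U (fun j => ψ j g) (Pi.single i 1) with hFdef
  have hψ : ∀ i, Measurable (ψ i) := fun i => measurable_integral_comp (hφ1 i).continuous.measurable
  have hFM : ∀ i g, |F i g| ≤ M := fun i g => (abs_clm_single_le _ _).trans (hM _)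
  have hF : ∀ i, MemLp (F i) 2 Q := fun i =>
    MemLp.of_bound (measurable_fderiv_comp hψ hU1 i).aestronglyMeasurable M
      (Eventually.of_forall (hFM i))
  have hU' : ContDiff ℝ 1 (fderiv ℝ U) := by
    have : ContDiff ℝ (1 + 1) U := (contDiff_infty.1 hU 2).of_le (by norm_num)
    exact ((contDiff_succ_iff_fderiv (n := 1)).1 this).2.2
  obtain ⟨K, hK⟩ := ContDiff.lipschitzWith_of_hasCompactSupport (hUc.fderiv (𝕜 := ℝ)) hU'
    one_ne_zero
  set Mm : ℝ := ∑ i, Mφ i with hMm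
  have hMφ0 : ∀ i, 0 ≤ Mφ i := fun i => (abs_nonneg _).trans (hMφ i 0)
  have hFL : ∀ i r g, |F i ((V i).move r g) - F i g| ≤ K * Mm * |r| := fun i r g => by
    have h1 := hK.dist_le_mul (fun j => ψ j ((V i).move r g)) (fun j => ψ j g)
    rw [dist_eq_norm, dist_eq_norm] at h1
    have h2 : ‖(fun j => ψ j ((V i).move r g)) - fun j => ψ j g‖ ≤ Mm * |r| := by
      refine (pi_norm_le_iff_of_nonneg (mul_nonneg (Finset.sum_nonneg fun i _ => hMφ0 i)
        (abs_nonneg _))).2 fun j => ?_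
      refine ((V i).abs_integral_move_sub_le (hφ1 j) (hMφ j) r g).trans ?_
      exact mul_le_mul_of_nonneg_right
        (Finset.single_le_sum (fun i _ => hMφ0 i) (Finset.mem_univ j)) (abs_nonneg _)
    have h3 : F i ((V i).move r g) - F i g = (fderiv ℝ U (fun j => ψ j ((V i).move r g)) -
        fderiv ℝ U fun j => ψ j g) (Pi.single i 1) := rfl
    rw [h3, mul_assoc]
    exact (abs_clm_single_le _ _).trans (h1.trans (mul_le_mul_of_nonneg_left h2 K.2))
  set Jw : Fin m → Lp ℝ 2 (Q.prod leb) := fun i =>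
    J Q (fun p => (V i).vel (p.1.1 p.2)) (V i).measurable_weight 1
      (fun p => (V i).abs_vel_le p.1 p.2) (hF i).toLp with hJw
  refine ⟨∑ i, (κ i)⁻¹ • Jw i, ?_, ?_⟩
  · refine mem_gradGraph_of_smooth (ψ := ψ) (h := fun i p => deriv (φ i) (p.1.1 p.2))
      (b := fun i _ => Mφ i) hψ (fun i => ((hφ1 i).continuous_deriv le_rfl).measurable.comp
        measurable_uncurry_eval) (fun i => memLp_const _) (fun i p => hMφ i _)
      (fun V i r g => V.hasDerivAt_integral_move (hφ1 i) (hMφ i) r g) hU1 (fun g => hM _)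
      (fun g => hMU _) hu ?_
    have hJ : ∀ᵐ p ∂Q.prod leb, ∀ i, Jw i p = (V i).vel (p.1.1 p.2) * F i p.1 := by
      refine ae_all_iff.2 fun i => ?_
      filter_upwards [J_coeFn (fun p => (V i).vel (p.1.1 p.2)) (V i).measurable_weight 1
        (fun p => (V i).abs_vel_le p.1 p.2) (hF i).toLp,
        (Measure.quasiMeasurePreserving_fst (μ := Q) (ν := leb)).ae (hF i).coeFn_toLp] with p h1 h2
      rw [hJw, h1, h2]
    filter_upwards [coeFn_sum_smul (fun i => (κ i)⁻¹) Jw, hJ] with p h1 h2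
    rw [h1]
    refine Finset.sum_congr rfl fun i _ => ?_
    rw [h2, hV]
    have := (hκ i).ne'
    field_simp
    rfl
  · choose C hC using fun i => (V i).exists_abs_inner_D_le (hF i) (hFM i) (hFL i)
    refine ⟨∑ i, (κ i)⁻¹ * C i, fun w η h => ?_⟩
    rw [sum_inner, Finset.sum_mul]
    refine (Finset.abs_sum_le_sum_abs _ _).trans (Finset.sum_le_sum fun i _ => ?_)
    have h1 : (inner ℝ (Jw i) η : ℝ) = inner ℝ (hF i).toLp ((V i).D η) := by
      rw [real_inner_comm, real_inner_comm _ ((hF i).toLp), Flow.D, inner_P]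
    rw [real_inner_smul_left, h1, abs_mul, abs_of_pos (inv_pos.2 (hκ i)), mul_assoc]
    exact mul_le_mul_of_nonneg_left (hC i w η h) (inv_pos.2 (hκ i)).le

theorem generatorExtends_maximalForm (hβ : 0 < β) (hQ : IsDirichletProcessLaw β Q) :
    GeneratorExtends Q (maximalForm hβ hQ) := by
  rintro u f hu ⟨ξ, hξ, hf⟩
  have hmem := closure_wassersteinGraph_subset hξ
  obtain ⟨ξ', hξ', C, hC⟩ := exists_gradient_of_isNeumannCylinder hβ hQ hu
  obtain rfl := gradGraph_unique hβ hQ hmem hξ'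
  refine ⟨mem_gradient_domain hmem, fun v => ?_⟩
  have hv := gradient_mem hβ hQ v
  rw [maximalForm_apply hβ hQ hmem hv]
  exact inner_eq_inner_of_dense (gradGraph Q) (S := wassersteinGraph Q)
    (fun _ hp => mem_gradGraph_of_mem_wassersteinGraph hp) dense_of_wassersteinGraph
    (fun p hp => hC p.1 p.2 hp) (fun p hp => hf p.1 p.2 (subset_closure hp)) hv

end Neumann

/-! ### Convergence along the approximating spaces -/

section Convergence

variable {β : ℝ} {Q : Measure G}

theorem IsDirichletProcessLaw.measurePreserving_sample (hQ : IsDirichletProcessLaw β Q) (n : ℕ) :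
    MeasurePreserving (sample n) Q (q β n) :=
  ⟨measurable_sample n, hQ.map_sample n⟩

/-- The isometric embedding of `L²(q_N)` into `L²(Q)`. -/
def pull (hQ : IsDirichletProcessLaw β Q) (n : ℕ) : Lp ℝ 2 (q β n) →L[ℝ] Lp ℝ 2 Q :=
  (Lp.compMeasurePreservingₗᵢ ℝ (sample n) (hQ.measurePreserving_sample n)).toContinuousLinearMap

theorem pull_coeFn (hQ : IsDirichletProcessLaw β Q) (n : ℕ) (u : Lp ℝ 2 (q β n)) :
    pull hQ n u =ᵐ[Q] fun g => u (sample n g) :=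
  Lp.coeFn_compMeasurePreserving u (hQ.measurePreserving_sample n)

theorem norm_pull (hQ : IsDirichletProcessLaw β Q) (n : ℕ) (u : Lp ℝ 2 (q β n)) :
    ‖pull hQ n u‖ = ‖u‖ :=
  LinearIsometry.norm_map _ u

theorem inner_pull (hQ : IsDirichletProcessLaw β Q) (n : ℕ) (u v : Lp ℝ 2 (q β n)) :
    (inner ℝ (pull hQ n u) (pull hQ n v) : ℝ) = inner ℝ u v :=
  LinearIsometry.inner_map_map _ u v

variable [IsProbabilityMeasure Q]

theorem stronglyMeasurable_Phi (n : ℕ) (v : Lp ℝ 2 Q) : StronglyMeasurable (Phi Q n v) :=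
  StronglyMeasurable.integral_condDistrib (f := fun p : (Fin n → ℝ) × ℝ => p.2)
    measurable_snd.stronglyMeasurable

theorem Phi_sample_ae_eq (n : ℕ) (v : Lp ℝ 2 Q) :
    Q[v | MeasurableSpace.comap (sample n) inferInstance] =ᵐ[Q] fun g => Phi Q n v (sample n g) :=
  condExp_ae_eq_integral_condDistrib' (measurable_sample n) ((Lp.memLp v).integrable one_le_two)

theorem memLp_Phi (hQ : IsDirichletProcessLaw β Q) (n : ℕ) (v : Lp ℝ 2 Q) :
    MemLp (Phi Q n v) 2 (q β n) := by
  rw [← hQ.map_sample n, memLp_map_measure_iff (stronglyMeasurable_Phi n v).aestronglyMeasurable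
    (measurable_sample n).aemeasurable]
  exact ((Lp.memLp v).condExp one_le_two).ae_eq (Phi_sample_ae_eq n v)

/-- `Φ^N` is the adjoint of the embedding `pull`, by the pull-out property of conditional
expectation. -/
theorem inner_toLp_Phi (hQ : IsDirichletProcessLaw β Q) (n : ℕ) (u : Lp ℝ 2 (q β n))
    (v : Lp ℝ 2 Q) : (inner ℝ u (memLp_Phi hQ n v).toLp : ℝ) = inner ℝ (pull hQ n u) v := by
  have hu : AEStronglyMeasurable[MeasurableSpace.comap (sample n) inferInstance] (pull hQ n u) Q :=
    ⟨fun g => u (sample n g),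
      (Lp.stronglyMeasurable u).comp_measurable (comap_measurable (sample n)), pull_coeFn hQ n u⟩
  have hint : Integrable (⇑(pull hQ n u) * ⇑v) Q := (Lp.memLp _).integrable_mul (Lp.memLp v)
  have h1 := condExp_mul_of_aestronglyMeasurable_left hu hint ((Lp.memLp v).integrable one_le_two)
  have h2 : (inner ℝ (pull hQ n u) v : ℝ) = ∫ g, (⇑(pull hQ n u) * ⇑v) g ∂Q := by
    rw [L2.inner_def]
    refine integral_congr_ae (Eventually.of_forall fun g => ?_)
    simp [mul_comm]
  rw [← inner_pull hQ, h2, ← integral_condExp (measurable_sample n).comap_le, L2.inner_def]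
  refine integral_congr_ae ?_
  filter_upwards [h1, Phi_sample_ae_eq n v, pull_coeFn hQ n (memLp_Phi hQ n v).toLp,
    (hQ.measurePreserving_sample n).quasiMeasurePreserving.ae (memLp_Phi hQ n v).coeFn_toLp]
    with g h3 h4 h5 h6
  rw [h3, Pi.mul_apply, h4, h5, h6]
  simp [mul_comm]

theorem strongConv_Phi (hQ : IsDirichletProcessLaw β Q) (v : Lp ℝ 2 Q) :
    StrongConv β Q (fun n => (memLp_Phi hQ n v).toLp) v := by
  refine ⟨fun _ => v, tendsto_const_nhds, ?_⟩
  have h : ∀ m, eLpNorm (fun x => Phi Q m v x - ((memLp_Phi hQ m v).toLp : Lp ℝ 2 (q β m)) x) 2 (q β m) = 0 :=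
    fun m => by
      rw [← eLpNorm_zero (μ := q β m) (p := 2) (ε := ℝ)]
      refine eLpNorm_congr_ae ?_
      filter_upwards [(memLp_Phi hQ m v).coeFn_toLp] with x hx
      rw [hx, sub_self]; rfl
  simp only [h, limsup_const]
  exact tendsto_const_nhds

/-- `Φ^N v` converges strongly to `v`, so testing with it and using the adjoint relation turns weak
convergence along `H^N → H` into ordinary weak convergence of the embedded functions. -/
theorem WeakConv.tendsto_inner_pull (hQ : IsDirichletProcessLaw β Q) {u : ∀ n, Lp ℝ 2 (q β n)}
    {u' : Lp ℝ 2 Q} (h : WeakConv β Q u u') (v : Lp ℝ 2 Q) :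
    Tendsto (fun n => (inner ℝ (pull hQ n (u n)) v : ℝ)) atTop (𝓝 (inner ℝ u' v)) := by
  have := h _ v (strongConv_Phi hQ v)
  simpa only [inner_toLp_Phi hQ] using this

end Convergence

/-! ### Lifting gradients -/

section Lift

theorem integral_sq_eq_norm_sq {X : Type*} [MeasurableSpace X] {μ : Measure X} (u : Lp ℝ 2 μ) :
    ∫ x, u x ^ 2 ∂μ = ‖u‖ ^ 2 := by
  rw [← real_inner_self_eq_norm_sq, L2.inner_def]
  simp [pow_two]

/-- The interval `[i/(n+1), (i+1)/(n+1))`. -/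
def cell (n : ℕ) (i : Fin n) : Set I := {t | ⌊((n : ℝ) + 1) * t⌋₊ = i}

theorem measurableSet_cell (n : ℕ) (i : Fin n) : MeasurableSet (cell n i) :=
  (Nat.measurable_floor.comp (measurable_const.mul measurable_subtype_coe))
    (measurableSet_singleton (i : ℕ))

theorem leb_cell (n : ℕ) (i : Fin n) : leb.real (cell n i) = ((n : ℝ) + 1)⁻¹ := by
  have hn : 0 < (n : ℝ) + 1 := by positivity
  have hi : (i : ℝ) + 1 ≤ n := by exact_mod_cast i.2
  have h : cell n i = Subtype.val ⁻¹' Set.Ico ((i : ℝ) / (n + 1)) (((i : ℝ) + 1) / (n + 1)) := by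
    ext t
    have ht : 0 ≤ ((n : ℝ) + 1) * t := mul_nonneg hn.le t.2.1
    rw [Set.mem_preimage, Set.mem_Ico, div_le_iff₀ hn, lt_div_iff₀ hn, mul_comm (t : ℝ)]
    exact Nat.floor_eq_iff ht
  rw [measureReal_def, h, leb_preimage, Set.inter_eq_left.2, Real.volume_Ico, ← sub_div,
    add_sub_cancel_left, ENNReal.toReal_ofReal (by positivity), one_div]
  refine fun x hx => ⟨le_trans (by positivity) hx.1, hx.2.trans_le ?_⟩
  rw [div_le_one hn]
  linarith

theorem rightValue_of_mem_cell {n : ℕ} {i : Fin n} {t : I} (ht : t ∈ cell n i) (x : Fin n → ℝ) :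
    rightValue n x t = x i := by
  have ht' : ⌊((n : ℝ) + 1) * t⌋₊ = i := ht
  have hlt : ⌊((n : ℝ) + 1) * t⌋₊ < n := ht' ▸ i.2
  rw [rightValue, dif_pos hlt]
  exact congrArg x (Fin.ext ht')

theorem rightValue_eq_sum (n : ℕ) (x : Fin n → ℝ) (t : I) :
    rightValue n x t = ∑ i, (cell n i).indicator 1 t * x i := by
  by_cases h : ⌊((n : ℝ) + 1) * t⌋₊ < n
  · have ht : t ∈ cell n ⟨_, h⟩ := rfl
    rw [rightValue_of_mem_cell ht, Finset.sum_eq_single (⟨_, h⟩ : Fin n)]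
    · simp [ht]
    · intro j _ hj
      have : t ∉ cell n j := fun h' => hj (Fin.ext (Eq.symm h'))
      simp [this]
    · simp
  · rw [rightValue, dif_neg h, Finset.sum_eq_zero]
    intro j _
    have : t ∉ cell n j := fun h' => h (by rw [show ⌊((n : ℝ) + 1) * t⌋₊ = j from h']; exact j.2)
    simp [this]

theorem rightValue_sq (n : ℕ) (x : Fin n → ℝ) (t : I) :
    rightValue n x t ^ 2 = rightValue n (fun i => x i ^ 2) t := by
  unfold rightValue
  split_ifs <;> simp

theorem measurable_rightValue (n : ℕ) :
    Measurable fun p : G × I => rightValue n (sample n p.1) p.2 := by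
  simp only [rightValue_eq_sum]
  refine Finset.measurable_fun_sum _ fun i _ => Measurable.mul ?_ ?_
  · exact (measurable_one.indicator (measurableSet_cell n i)).comp measurable_snd
  · exact (measurable_pi_apply i).comp ((measurable_sample n).comp measurable_fst)

/-- The weight `(n + 1) 1_{[i/(n+1), (i+1)/(n+1))}`. -/
def cellWeight (n : ℕ) (i : Fin n) (t : I) : ℝ := ((n : ℝ) + 1) * (cell n i).indicator 1 t

theorem measurable_cellWeight (n : ℕ) (i : Fin n) : Measurable (cellWeight n i) :=
  (measurable_one.indicator (measurableSet_cell n i)).const_mul _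

theorem abs_cellWeight_le (n : ℕ) (i : Fin n) (t : I) : |cellWeight n i t| ≤ (n : ℝ) + 1 := by
  rw [cellWeight, abs_mul, abs_of_nonneg (by positivity)]
  refine mul_le_of_le_one_right (by positivity) ?_
  by_cases h : t ∈ cell n i <;> simp [h]

theorem integral_cellWeight_mul (n : ℕ) (i : Fin n) {f : I → ℝ} {c : ℝ}
    (hf : ∀ t ∈ cell n i, f t = c) : ∫ t, cellWeight n i t * f t ∂leb = c := by
  have h : (fun t => cellWeight n i t * f t) =
      (cell n i).indicator fun _ => ((n : ℝ) + 1) * c := by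
    funext t
    by_cases ht : t ∈ cell n i
    · simp [cellWeight, ht, hf t ht]
    · simp [cellWeight, ht]
  rw [h, integral_indicator_const _ (measurableSet_cell n i), leb_cell, smul_eq_mul,
    inv_mul_cancel_left₀ (by positivity)]

variable {β : ℝ} {Q : Measure G}

/-- A coordinate of a vector valued function, as a function on `G`. -/
def coordPull (hQ : IsDirichletProcessLaw β Q) (n : ℕ) (i : Fin n) :
    Lp (EuclideanSpace ℝ (Fin n)) 2 (q β n) →L[ℝ] Lp ℝ 2 Q :=
  (pull hQ n).comp ((EuclideanSpace.proj (𝕜 := ℝ) i).compLpL 2 (q β n))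

theorem coordPull_coeFn (hQ : IsDirichletProcessLaw β Q) (n : ℕ) (i : Fin n)
    (ξ : Lp (EuclideanSpace ℝ (Fin n)) 2 (q β n)) :
    coordPull hQ n i ξ =ᵐ[Q] fun g => ξ (sample n g) i := by
  filter_upwards [pull_coeFn hQ n ((EuclideanSpace.proj (𝕜 := ℝ) i).compLpL 2 (q β n) ξ),
    (hQ.measurePreserving_sample n).quasiMeasurePreserving.ae
      ((EuclideanSpace.proj (𝕜 := ℝ) i).coeFn_compLpL (p := 2) ξ)] with g h1 h2
  exact h1.trans h2

variable [IsProbabilityMeasure Q]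

/-- The gradient on `G` corresponding to a gradient on the simplex. -/
def lift (hQ : IsDirichletProcessLaw β Q) (n : ℕ) :
    Lp (EuclideanSpace ℝ (Fin n)) 2 (q β n) →L[ℝ] Lp ℝ 2 (Q.prod leb) :=
  ∑ i, (J Q (fun p => cellWeight n i p.2) ((measurable_cellWeight n i).comp measurable_snd)
    ((n : ℝ) + 1) (fun p => abs_cellWeight_le n i p.2)).comp (coordPull hQ n i)

theorem lift_coeFn_coordPull (hQ : IsDirichletProcessLaw β Q) (n : ℕ)
    (ξ : Lp (EuclideanSpace ℝ (Fin n)) 2 (q β n)) : lift hQ n ξ =ᵐ[Q.prod leb]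
      fun p => ∑ i, cellWeight n i p.2 * coordPull hQ n i ξ p.1 := by
  rw [lift, sum_apply]
  refine (Lp.coeFn_fun_finsetSum _ _).trans ?_
  filter_upwards [ae_all_iff.2 fun i => J_coeFn (Q := Q) (fun p => cellWeight n i p.2)
    ((measurable_cellWeight n i).comp measurable_snd) ((n : ℝ) + 1)
    (fun p => abs_cellWeight_le n i p.2) (coordPull hQ n i ξ)] with p hp
  exact Finset.sum_congr rfl fun i _ => hp i

theorem lift_coeFn (hQ : IsDirichletProcessLaw β Q) (n : ℕ)
    (ξ : Lp (EuclideanSpace ℝ (Fin n)) 2 (q β n)) : lift hQ n ξ =ᵐ[Q.prod leb]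
      fun p => ∑ i, cellWeight n i p.2 * ξ (sample n p.1) i := by
  filter_upwards [lift_coeFn_coordPull hQ n ξ, ae_all_iff.2 fun i =>
    (Measure.quasiMeasurePreserving_fst (μ := Q) (ν := leb)).ae (coordPull_coeFn hQ n i ξ)]
    with p h1 h2
  rw [h1]
  exact Finset.sum_congr rfl fun i _ => by rw [h2 i]

/-- The cells are disjoint with mass `1/(n+1)` and carry the weight `n+1`, so each squared
coordinate is multiplied by `(n+1)² / (n+1)`. -/
theorem norm_lift_sq (hQ : IsDirichletProcessLaw β Q) (n : ℕ)
    (ξ : Lp (EuclideanSpace ℝ (Fin n)) 2 (q β n)) :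
    ‖lift hQ n ξ‖ ^ 2 = ((n : ℝ) + 1) * ‖ξ‖ ^ 2 := by
  have hsq : ∀ i, Integrable (fun g => coordPull hQ n i ξ g ^ 2) Q := fun i =>
    (Lp.memLp _).integrable_sq
  have hcw : ∀ i, Integrable (fun t => cellWeight n i t * ((n : ℝ) + 1)) leb := fun i =>
    (Integrable.of_bound (measurable_cellWeight n i).aestronglyMeasurable _
      (Eventually.of_forall (abs_cellWeight_le n i))).mul_const _
  have hint1 : ∀ i, ∫ t, cellWeight n i t * ((n : ℝ) + 1) ∂leb = (n : ℝ) + 1 := fun i =>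
    integral_cellWeight_mul n i fun _ _ => rfl
  have hcoord : ∀ i, ∫ g, coordPull hQ n i ξ g ^ 2 ∂Q = ∫ x, ξ x i ^ 2 ∂q β n := fun i => by
    rw [integral_sq_eq_norm_sq, coordPull, ContinuousLinearMap.comp_apply, norm_pull,
      ← integral_sq_eq_norm_sq]
    refine integral_congr_ae ?_
    filter_upwards [(EuclideanSpace.proj (𝕜 := ℝ) i).coeFn_compLpL (p := 2) ξ] with x hx
    rw [hx]
    rfl
  have hcoordi : ∀ i, Integrable (fun x => ξ x i ^ 2) (q β n) := fun i =>
    ((EuclideanSpace.proj (𝕜 := ℝ) i).comp_memLp' (Lp.memLp ξ)).integrable_sq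
  calc ‖lift hQ n ξ‖ ^ 2 = ∫ p, lift hQ n ξ p ^ 2 ∂Q.prod leb := by
        rw [integral_sq_eq_norm_sq]
    _ = ∫ p, ∑ i, coordPull hQ n i ξ p.1 ^ 2 * (cellWeight n i p.2 * ((n : ℝ) + 1))
          ∂Q.prod leb := by
        refine integral_congr_ae ?_
        filter_upwards [lift_coeFn_coordPull hQ n ξ] with p hp
        have h1 : ∀ x : Fin n → ℝ, ∑ i, cellWeight n i p.2 * x i =
            ((n : ℝ) + 1) * rightValue n x p.2 := fun x => by
          rw [rightValue_eq_sum, Finset.mul_sum]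
          exact Finset.sum_congr rfl fun i _ => mul_assoc _ _ _
        rw [hp, h1, mul_pow, rightValue_sq, pow_two, mul_assoc, ← h1, Finset.mul_sum]
        exact Finset.sum_congr rfl fun i _ => by ring
    _ = ∑ i, (∫ g, coordPull hQ n i ξ g ^ 2 ∂Q) * ∫ t, cellWeight n i t * ((n : ℝ) + 1) ∂leb := by
        rw [integral_finsetSum _ fun i _ => (hsq i).mul_prod (hcw i)]
        exact Finset.sum_congr rfl fun i _ => integral_prod_mul (L := ℝ)
          (fun g => coordPull hQ n i ξ g ^ 2) fun t => cellWeight n i t * ((n : ℝ) + 1)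
    _ = ((n : ℝ) + 1) * ∫ x, ∑ i, ξ x i ^ 2 ∂q β n := by
        rw [integral_finsetSum _ fun i _ => hcoordi i, Finset.mul_sum]
        exact Finset.sum_congr rfl fun i _ => by rw [hint1, hcoord, mul_comm]
    _ = ((n : ℝ) + 1) * ‖ξ‖ ^ 2 := by
        rw [← real_inner_self_eq_norm_sq ξ, L2.inner_def]
        simp only [real_inner_self_eq_norm_sq, EuclideanSpace.real_norm_sq_eq]

end Lift

/-! ### Perturbations of the approximating functions -/

section Approximation

variable {β : ℝ} {Q : Measure G}

/-- The velocity at the discretized quantile function. -/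
def Flow.discreteVel (V : Flow Q) (n : ℕ) (p : G × I) : ℝ :=
  V.vel (rightValue n (sample n p.1) p.2)

theorem Flow.measurable_discreteVel (V : Flow Q) (n : ℕ) : Measurable (V.discreteVel n) :=
  V.continuous_vel.measurable.comp (measurable_rightValue n)

theorem Flow.abs_discreteVel_le (V : Flow Q) (n : ℕ) (p : G × I) : |V.discreteVel n p| ≤ 1 :=
  V.isVelocity.abs_le (rightValue_mem n p.1 p.2)

variable [IsProbabilityMeasure Q]

/-- Multiplication with the discretized velocity. -/
def Flow.discreteJ (V : Flow Q) (n : ℕ) : Lp ℝ 2 Q →L[ℝ] Lp ℝ 2 (Q.prod leb) :=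
  J Q (V.discreteVel n) (V.measurable_discreteVel n) 1 (V.abs_discreteVel_le n)

/-- Right continuity of `g` makes the discretized velocity converge pointwise, and the products are
dominated by `|F|`. -/
theorem Flow.tendsto_discreteJ (V : Flow Q) (F : Lp ℝ 2 Q) :
    Tendsto (fun n => V.discreteJ n F) atTop
      (𝓝 (J Q (fun p => V.vel (p.1.1 p.2)) V.measurable_weight 1
        (fun p => V.abs_vel_le p.1 p.2) F)) := by
  have hF : MemLp (fun p : G × I => F p.1) 2 (Q.prod leb) :=
    (Lp.memLp F).comp_measurePreserving measurePreserving_fst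
  have hmem : ∀ (m : G × I → ℝ), Measurable m → (∀ p, |m p| ≤ 1) →
      MemLp (fun p => m p * F p.1) 2 (Q.prod leb) := fun m hm hB =>
    hF.of_le_mul (c := 1) (hm.aestronglyMeasurable.mul hF.aestronglyMeasurable)
      (Eventually.of_forall fun p => by
        rw [norm_mul]; exact mul_le_mul_of_nonneg_right (hB p) (norm_nonneg _))
  have hJ : ∀ (m : G × I → ℝ) (hm : Measurable m) (hB : ∀ p, |m p| ≤ 1),
      J Q m hm 1 hB F = (hmem m hm hB).toLp := fun m hm hB => Lp.ext <|
    (J_coeFn m hm 1 hB F).trans (hmem m hm hB).coeFn_toLp.symm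
  have hle : ∀ (m : G × I → ℝ) (_ : ∀ p, |m p| ≤ 1) p, |m p * F p.1| ≤ |F p.1| := fun m hB p => by
    rw [abs_mul]; exact mul_le_of_le_one_left (abs_nonneg _) (hB p)
  simp only [Flow.discreteJ, hJ]
  exact tendsto_toLp_of_dominated _ _ hF.abs
    (Eventually.of_forall fun n => Eventually.of_forall (hle _ (V.abs_discreteVel_le n)))
    (Eventually.of_forall (hle _ fun p => V.abs_vel_le p.1 p.2))
    (Eventually.of_forall fun p => ((V.continuous_vel.tendsto _).comp
      (tendsto_rightValue p.1 p.2 tendsto_id)).mul_const _)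

/-- An evaluation at a grid point has no gradient in `L²([0,1])`, but its derivative along `V`, the
velocity at that value, is exactly the integral of `cellWeight` against the discretized velocity.
Hence the identity has no error term at fixed `n`. -/
theorem Flow.T_pull_sub_of_mem_particleGraph (hQ : IsDirichletProcessLaw β Q) (V : Flow Q) (n : ℕ)
    {p : Lp ℝ 2 (q β n) × Lp (EuclideanSpace ℝ (Fin n)) 2 (q β n)} (hp : p ∈ particleGraph β n)
    (s : ℝ) : V.T s (pull hQ n p.1) - pull hQ n p.1 =
      ContinuousLinearMap.adjoint (V.discreteJ n) (V.B s (lift hQ n p.2)) := by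
  obtain ⟨f, hf, hp1, hp2⟩ := hp
  have hf1 : ContDiff ℝ 1 f := (contDiff_infty.1 hf 1)
  have hcpt : IsCompact (Set.univ.pi fun _ : Fin n => Set.Icc (0 : ℝ) 1) :=
    isCompact_univ_pi fun _ => isCompact_Icc
  have hmem : ∀ g, sample n g ∈ Set.univ.pi fun _ : Fin n => Set.Icc (0 : ℝ) 1 := fun g i _ =>
    g.2.2.1 _
  obtain ⟨MU, hMU⟩ := hcpt.exists_bound_of_continuousOn hf.continuous.continuousOn
  obtain ⟨M, hM⟩ := hcpt.exists_bound_of_continuousOn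
    (hf1.continuous_fderiv one_ne_zero).continuousOn
  have hqm := (hQ.measurePreserving_sample n).quasiMeasurePreserving
  refine (V.hasDerivAt_T_iff (P Q (V.discreteVel n) (V.measurable_discreteVel n) 1
    (V.abs_discreteVel_le n)) _ _).2 (fun r => ?_) s
  refine V.hasDerivAt_T_of_smooth (ψ := fun i g => sample n g i)
    (h := fun i p => cellWeight n i p.2) (b := fun i t => |cellWeight n i t|) (U := f) (M := M)
    (MU := MU) _ _ 1 _ (fun i => (measurable_pi_apply i).comp (measurable_sample n))
    (fun i => (measurable_cellWeight n i).comp measurable_snd)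
    (fun i => (MemLp.of_bound (measurable_cellWeight n i).aestronglyMeasurable _
      (Eventually.of_forall (abs_cellWeight_le n i))).abs) (fun i p => le_rfl) (fun i r g => ?_)
    hf1 (fun g => hM _ (hmem g)) (fun g => hMU _ (hmem g)) ?_ ?_ r
  · have h1 : ∫ t, cellWeight n i t * V.discreteVel n (g, t) ∂leb = V.vel (sample n g i) :=
      integral_cellWeight_mul n i fun t ht => by
        rw [Flow.discreteVel, rightValue_of_mem_cell ht]
    rw [h1]
    exact ((Real.hasDerivAt_sin r).mul_const _).const_add _
  · exact (pull_coeFn hQ n p.1).trans (hqm.ae hp1)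
  · filter_upwards [lift_coeFn hQ n p.2,
      (Measure.quasiMeasurePreserving_fst (μ := Q) (ν := leb)).ae (hqm.ae hp2)] with z h1 h2
    rw [h1, h2]
    exact Finset.sum_congr rfl fun i _ => mul_comm _ _

theorem Flow.T_pull_sub_of_mem_closure (hQ : IsDirichletProcessLaw β Q) (V : Flow Q) (n : ℕ)
    {p : Lp ℝ 2 (q β n) × Lp (EuclideanSpace ℝ (Fin n)) 2 (q β n)}
    (hp : p ∈ closure (particleGraph β n)) (s : ℝ) : V.T s (pull hQ n p.1) - pull hQ n p.1 =
      ContinuousLinearMap.adjoint (V.discreteJ n) (V.B s (lift hQ n p.2)) := by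
  have h1 := (pull hQ n).continuous.comp (continuous_fst (X := Lp ℝ 2 (q β n))
    (Y := Lp (EuclideanSpace ℝ (Fin n)) 2 (q β n)))
  have h2 := ((V.T s).continuous.comp h1).sub h1
  have h3 := (ContinuousLinearMap.adjoint (V.discreteJ n)).continuous.comp ((V.B s).continuous.comp
    ((lift hQ n).continuous.comp (continuous_snd (X := Lp ℝ 2 (q β n))
      (Y := Lp (EuclideanSpace ℝ (Fin n)) 2 (q β n)))))
  exact closure_minimal (fun p hp => V.T_pull_sub_of_mem_particleGraph hQ n hp s)
    (isClosed_eq h2 h3) hp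

theorem norm_lift_le (hQ : IsDirichletProcessLaw β Q) {n : ℕ}
    {ξ : Lp (EuclideanSpace ℝ (Fin n)) 2 (q β n)} {c : NNReal}
    (h : ((n : ℝ≥0∞) + 1) * ‖ξ‖ₑ ^ 2 ≤ c) : ‖lift hQ n ξ‖ ≤ Real.sqrt c := by
  refine Real.le_sqrt_of_sq_le ?_
  rw [norm_lift_sq]
  have h1 : (((n : NNReal) + 1) * ‖ξ‖₊ ^ 2 : NNReal) ≤ c := by
    rw [← ENNReal.coe_le_coe]
    push_cast
    exact h
  exact_mod_cast h1

/-- The bound is conditional so that a gradient can be chosen for every `n`, although the energy is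
small only along a subsequence. -/
theorem exists_gradient_lt {n : ℕ} {u : Lp ℝ 2 (q β n)} (hu : InDomain (particleGraph β n) u)
    (c : ℝ≥0∞) : ∃ ξ, (u, ξ) ∈ closure (particleGraph β n) ∧
      (((n : ℝ≥0∞) + 1) * particleEnergy β n u < c → ((n : ℝ≥0∞) + 1) * ‖ξ‖ₑ ^ 2 < c) := by
  by_cases h : ((n : ℝ≥0∞) + 1) * particleEnergy β n u < c
  · have h0 : ((n : ℝ≥0∞) + 1) ≠ 0 := by simp
    have ht : ((n : ℝ≥0∞) + 1) ≠ ⊤ := by simp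
    rw [mul_comm, ← ENNReal.lt_div_iff_mul_lt (Or.inl h0) (Or.inl ht), particleEnergy, closedEnergy,
      iInf_lt_iff] at h
    obtain ⟨ξ, h⟩ := h
    obtain ⟨hξ, h⟩ := iInf_lt_iff.1 h
    refine ⟨ξ, hξ, fun _ => ?_⟩
    rwa [mul_comm, ← ENNReal.lt_div_iff_mul_lt (Or.inl h0) (Or.inl ht)]
  · obtain ⟨ξ, hξ⟩ := hu
    exact ⟨ξ, hξ, fun h' => absurd h' h⟩

/-- Weak limits of functions with bounded energies have a gradient along all perturbations. -/
theorem WeakConv.exists_mem_gradGraph (hQ : IsDirichletProcessLaw β Q) {u : ∀ n, Lp ℝ 2 (q β n)}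
    {u' : Lp ℝ 2 Q} (hu : WeakConv β Q u u') (hdom : ∀ n, InDomain (particleGraph β n) (u n))
    {c : NNReal} (hc : ∃ᶠ n : ℕ in atTop, ((n : ℝ≥0∞) + 1) * particleEnergy β n (u n) < c) :
    ∃ ξ, (u', ξ) ∈ gradGraph Q ∧ ‖ξ‖ ≤ Real.sqrt c := by
  choose η hη hηc using fun n => exists_gradient_lt (hdom n) (c : ℝ≥0∞)
  have : (atTop ⊓ 𝓟 {n : ℕ | ((n : ℝ≥0∞) + 1) * particleEnergy β n (u n) < c}).NeBot :=
    frequently_mem_iff_neBot.1 hc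
  -- An ultrafilter finer than `atTop` and concentrated on the indices of small energy replaces the
  -- choice of a weakly convergent subsequence.
  set l := Ultrafilter.of (atTop ⊓ 𝓟 {n : ℕ | ((n : ℝ≥0∞) + 1) * particleEnergy β n (u n) < c})
  have hl : (l : Filter ℕ) ≤ atTop := (Ultrafilter.of_le _).trans inf_le_left
  have hbound : ∀ᶠ n in (l : Filter ℕ), ‖lift hQ n (η n)‖ ≤ Real.sqrt c := by
    have h1 : ∀ᶠ n : ℕ in (l : Filter ℕ), ((n : ℝ≥0∞) + 1) * particleEnergy β n (u n) < c :=
      (Ultrafilter.of_le _).trans inf_le_right (mem_principal_self _)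
    filter_upwards [h1] with n hn
    exact norm_lift_le hQ (hηc n hn).le
  obtain ⟨ξ, hξ, hlim⟩ := exists_weak_limit l (fun n => lift hQ n (η n)) _ hbound
  refine ⟨ξ, fun V s => ?_, hξ⟩
  exact V.eq_of_weak_limit s (l := (l : Filter ℕ)) (fun F => (hu.tendsto_inner_pull hQ F).mono_left hl)
    hlim hbound (fun F => (V.tendsto_discreteJ F).mono_left hl)
    (Eventually.of_forall fun n => V.T_pull_sub_of_mem_closure hQ n (hη n) s)

end Approximation

end WassersteinDiffusion

end

open WassersteinDiffusion in
theorem mainTheorem6 (β : ℝ) (hβ : 0 < β)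
    (Q : Measure G) [IsProbabilityMeasure Q] (hQ : IsDirichletProcessLaw β Q)
    (hE : MarkovUnique Q)
    (u : ∀ n : ℕ, Lp ℝ 2 (q β n)) (hdom : ∀ n, InDomain (particleGraph β n) (u n))
    (u' : Lp ℝ 2 Q) (hu : WeakConv β Q u u') :
    wassersteinEnergy Q u' ≤
      liminf (fun n : ℕ => ((n : ℝ≥0∞) + 1) * particleEnergy β n (u n)) atTop := by
  -- It is enough to bound the energy by every `c` above the lower limit; such a `c` exceeds the
  -- energies for infinitely many `n`.
  refine le_of_forall_gt_imp_ge_of_dense fun c hc => ?_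
  rcases eq_or_ne c ⊤ with rfl | hct
  · exact le_top
  lift c to NNReal using hct
  obtain ⟨ξ, hξ, hξc⟩ := hu.exists_mem_gradGraph hQ hdom (frequently_lt_of_liminf_lt (h := hc))
  -- Markov uniqueness serves only to place `u'` in the domain of the Wasserstein form. Uniqueness
  -- in `gradGraph` then identifies its gradient there with the weak limit `ξ`.
  obtain ⟨η, hη⟩ := hE (maximalForm hβ hQ) (extends_maximalForm hβ hQ)
    (generatorExtends_maximalForm hβ hQ) u' (mem_gradient_domain hξ)
  obtain rfl := gradGraph_unique hβ hQ hξ (closure_wassersteinGraph_subset hη)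
  rw [wassersteinEnergy_eq hβ hQ hη]
  have h : ‖ξ‖₊ ^ 2 ≤ c := by
    have := (Real.le_sqrt (norm_nonneg ξ) c.2).1 hξc
    exact_mod_cast this
  rw [enorm_eq_nnnorm]
  exact_mod_cast h
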